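/- Theorem (Dixmier trace of tensors of operators with symbols $a_m(x)\beta_m(j)$). Let $\mathbb T=\mathbb R/\mathbb Z$ carry its normalised Haar measure. For $m=1,\dots,N$ let $a_m\in L^\infty(\mathbb T)$ be real valued with $a_m\ge 0$ almost everywhere, let $\beta_m:\mathbb Z\to[0,\infty)$ satisfy $\sum_{j\in\mathbb Z}\beta_m(j)^p<\infty$ for every $p>1$, and let $A_m$ be the bounded pseudo-differential operator on $L^2(\mathbb T)$ with symbol $a_m(x)\beta_m(j)$, that is $$A_mf(x)=\sum_{j\in\mathbb Z}a_m(x)\,\beta_m(j)\,\widehat f(j)\,e^{2\pi i jx}.$$ Let $\bigotimes_{m=1}^N A_m$ be their tensor product on the Hilbert tensor product $L^2(\mathbb T)^{\otimes N}$. Suppose that the finite limit $$\lim_{p\to1^+}(p-1)\prod_{m=1}^N\|a_m\|_{L^\infty(\mathbb T)}^p\,\|\beta_m\|_{\ell^p(\mathbb Z)}^p$$ exists. The operators $A_m$ need not be normal. For $1<p<2$ the power $A^p$ of a bounded operator $A$ on a Hilbert space whose resolvent set contains $(-\infty,0)$ is understood in the sense of Balakrishnan, $$A^p=\frac{\sin(\pi(p-1))}{\pi}\int_0^\infty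 t^{p-2}A^2(t+A)^{-1}\,dt ,$$ whenever the integral converges absolutely in operator norm; for positive $A$ this is the usual power. Then for all $1<p<2$ the powers $A_m^p$ and $\left(\bigotimes_{m}A_m\right)^p$ exist, and $A_m^p$, $\left(\bigotimes_{m}A_m\right)^p$ and $\bigotimes_m A_m^p$ are trace class. Moreover, the operator $\bigotimes_m A_m$ belongs to the Dixmier ideal (the compact operators $T$ whose singular values satisfy $\sum_{k<n}s_k(T)=O(\log n)$), the limit $$L=\lim_{p\to1^+}(p-1)\operatorname{Tr}\Big(\Big(\bigotimes_{m=1}^N A_m\Big)^p\Big)$$ exists and is a finite real number, and $$\operatorname{Tr}_\omega\Big(\bigotimes_{m=1}^N A_m\Big)=\lim_{p\to1^+}(p-1)\operatorname{Tr}\Big(\bigotimes_{m=1}^N A_m^p\Big)=L$$ for every Dixmier trace $\operatorname{Tr}_\omega$. Here $\omega$ is any positive linear functional on $\ell^\infty$ that extends the limit of convergent sequences and satisfies $\omega(x_1,x_1,x_2,x_2,\dots)=\omega(x_1,x_2,\dots)$, and $\operatorname{Tr}_\omega$ is the linear functional on the Dixmier ideal with $\operatorname{Tr}_\omega(T)=\omega\big(\tfrac1{\log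 (n+1)}\sum_{k<n}s_k(T)\big)_{n\ge1}$ for $T\ge0$. -/

import Mathlib

open MeasureTheory Filter Topology

noncomputable section

/-! ### Hilbert tensor products of finitely many Hilbert spaces -/

namespace HilbertTensor

universe u v

variable {ι : Type u} [Fintype ι] {H : ι → Type v}
  [∀ i, NormedAddCommGroup (H i)] [∀ i, InnerProductSpace ℂ (H i)]

/-- The algebraic tensor product of the spaces `H i`, as a separate type: it carries the
inner product with `⟪⊗ φ_i, ⊗ ψ_i⟫ = ∏ ⟪φ_i, ψ_i⟫` (and not the projective norm). -/
def Alg (H : ι → Type v) [∀ i, NormedAddCommGroup (H i)]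
    [∀ i, InnerProductSpace ℂ (H i)] : Type (max u v) :=
  PiTensorProduct ℂ H

instance : AddCommGroup (Alg H) := inferInstanceAs (AddCommGroup (PiTensorProduct ℂ H))

instance : Module ℂ (Alg H) := inferInstanceAs (Module ℂ (PiTensorProduct ℂ H))

/-- The elementary tensor `⊗ φ_i` in the algebraic tensor product. -/
def algTmul (φ : ∀ i, H i) : Alg H := PiTensorProduct.tprod ℂ φ

theorem alg_induction {motive : Alg H → Prop} (z : Alg H)
    (smul : ∀ (c : ℂ) (φ : ∀ i, H i), motive (c • algTmul φ))
    (add : ∀ x y, motive x → motive y → motive (x + y)) : motive z :=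
  PiTensorProduct.induction_on (motive := motive) z smul add

/-- For fixed `x`, the multilinear map `y ↦ ∏ ⟪x i, y i⟫`. -/
def innerMulti (x : ∀ i, H i) : MultilinearMap ℂ H ℂ :=
  (MultilinearMap.mkPiAlgebra ℂ ι ℂ).compLinearMap (fun i => innerₛₗ ℂ (x i))

theorem innerMulti_apply (x y : ∀ i, H i) : innerMulti x y = ∏ i, inner ℂ (x i) (y i) := by
  simp [innerMulti]

theorem innerMulti_conj (x y : ∀ i, H i) :
    starRingEnd ℂ (innerMulti y x) = innerMulti x y := by
  simp [innerMulti_apply, map_prod]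

/-- For fixed `x`, the linear map on the tensor product with `⊗ y i ↦ ∏ ⟪x i, y i⟫`. -/
def innerLin (x : ∀ i, H i) : Alg H →ₗ[ℂ] ℂ := PiTensorProduct.lift (innerMulti x)

theorem innerLin_algTmul (x y : ∀ i, H i) :
    innerLin x (algTmul y) = ∏ i, inner ℂ (x i) (y i) := by
  rw [← innerMulti_apply]
  exact PiTensorProduct.lift.tprod y

/-- For fixed `w` in the tensor product, the multilinear map `x ↦ conj ⟪⊗ x i, w⟫`. -/
def innerMultiConj (w : Alg H) : MultilinearMap ℂ H ℂ where
  toFun x := starRingEnd ℂ (innerLin x w)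
  map_update_add' := by
    intro _ m i a b
    have h : innerMulti (Function.update m i (a + b))
        = innerMulti (Function.update m i a) + innerMulti (Function.update m i b) := by
      ext y
      rw [add_apply, ← innerMulti_conj, ← innerMulti_conj (Function.update m i a),
        ← innerMulti_conj (Function.update m i b), ← map_add]
      congr 1
      exact (innerMulti y).map_update_add m i a b
    unfold innerLin
    rw [h, map_add]
    exact map_add (starRingEnd ℂ) _ _
  map_update_smul' := by
    intro _ m i c a
    have h : innerMulti (Function.update m i (c • a))
        = (starRingEnd ℂ c) • innerMulti (Function.update m i a) := by
      ext y
      rw [smul_apply, ← innerMulti_conj,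
        ← innerMulti_conj (Function.update m i a), smul_eq_mul, ← map_mul]
      congr 1
      exact (innerMulti y).map_update_smul m i c a
    unfold innerLin
    rw [h, map_smul]
    refine (map_mul (starRingEnd ℂ) _ _).trans ?_
    rw [Complex.conj_conj]
    rfl

/-- For fixed `w`, the linear map `z ↦ conj ⟪z, w⟫`. -/
def innerLinConj (w : Alg H) : Alg H →ₗ[ℂ] ℂ := PiTensorProduct.lift (innerMultiConj w)

/-- The sesquilinear form on the algebraic tensor product. -/
def algInner (z w : Alg H) : ℂ := starRingEnd ℂ (innerLinConj w z)

theorem algInner_add_left (x y z : Alg H) :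
    algInner (x + y) z = algInner x z + algInner y z := by
  unfold algInner
  rw [LinearMap.map_add, map_add]

theorem algInner_smul_left (c : ℂ) (x z : Alg H) :
    algInner (c • x) z = starRingEnd ℂ c * algInner x z := by
  unfold algInner
  rw [LinearMap.map_smul, smul_eq_mul, map_mul]

theorem algInner_algTmul_left (x : ∀ i, H i) (w : Alg H) :
    algInner (algTmul x) w = innerLin x w := by
  have h : innerLinConj w (algTmul x)
      = starRingEnd ℂ (innerLin x w) := PiTensorProduct.lift.tprod x
  unfold algInner
  rw [h, Complex.conj_conj]

/-- `⟪⊗ x i, ⊗ y i⟫ = ∏ ⟪x i, y i⟫`. -/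
theorem algInner_algTmul (x y : ∀ i, H i) :
    algInner (algTmul x) (algTmul y) = ∏ i, inner ℂ (x i) (y i) := by
  rw [algInner_algTmul_left, innerLin_algTmul]

theorem algInner_add_right (x y z : Alg H) :
    algInner x (y + z) = algInner x y + algInner x z := by
  induction x using alg_induction with
  | smul c φ => simp only [algInner_smul_left, algInner_algTmul_left, map_add, mul_add]
  | add a b ha hb => simp only [algInner_add_left, ha, hb]; ring

theorem algInner_smul_right (c : ℂ) (x z : Alg H) :
    algInner x (c • z) = c * algInner x z := by
  induction x using alg_induction with
  | smul d φ =>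
    simp only [algInner_smul_left, algInner_algTmul_left, map_smul, smul_eq_mul]; ring
  | add a b ha hb => simp only [algInner_add_left, ha, hb]; ring

theorem algInner_conj_symm (x y : Alg H) : starRingEnd ℂ (algInner y x) = algInner x y := by
  induction x using alg_induction with
  | smul c φ =>
    induction y using alg_induction with
    | smul d ψ =>
      simp only [algInner_smul_left, algInner_smul_right, algInner_algTmul, map_mul, map_prod,
        inner_conj_symm, Complex.conj_conj]
      ring
    | add a b ha hb => simp only [algInner_add_left, algInner_add_right, map_add, ha, hb]
  | add a b ha hb => simp only [algInner_add_left, algInner_add_right, map_add, ha, hb]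

theorem exists_eq_sum (z : Alg H) :
    ∃ (n : ℕ) (c : Fin n → ℂ) (x : Fin n → ∀ i, H i), z = ∑ k, c k • algTmul (x k) := by
  induction z using alg_induction with
  | smul c φ => exact ⟨1, fun _ => c, fun _ => φ, by simp⟩
  | add a b ha hb =>
    obtain ⟨n, c, x, rfl⟩ := ha
    obtain ⟨m, d, y, rfl⟩ := hb
    refine ⟨n + m, Fin.append c d, Fin.append x y, ?_⟩
    simp [Fin.sum_univ_add]

open scoped ComplexOrder

theorem algInner_sum (n : ℕ) (c : Fin n → ℂ) (x : Fin n → ∀ i, H i) :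
    algInner (∑ k, c k • algTmul (x k)) (∑ k, c k • algTmul (x k))
      = star c ⬝ᵥ (Matrix.of fun k l => ∏ i, (Matrix.gram ℂ fun k => x k i) k l).mulVec c := by
  have hl : ∀ (s : Finset (Fin n)) (w : Alg H),
      algInner (∑ k ∈ s, c k • algTmul (x k)) w
        = ∑ k ∈ s, starRingEnd ℂ (c k) * algInner (algTmul (x k)) w := by
    intro s w
    classical
    induction s using Finset.induction_on with
    | empty => simp [algInner]
    | insert a s ha ih =>
      rw [Finset.sum_insert ha, Finset.sum_insert ha, algInner_add_left, ih, algInner_smul_left]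
  rw [hl]
  simp only [dotProduct, Matrix.mulVec, algInner_algTmul_left, map_sum, map_smul,
    innerLin_algTmul, Matrix.of_apply, Matrix.gram_apply, Pi.star_apply, smul_eq_mul]
  refine Finset.sum_congr rfl fun k _ => ?_
  congr 1
  exact Finset.sum_congr rfl fun l _ => mul_comm _ _

/-- Entrywise products of positive semidefinite matrices, compared factor by factor. -/
theorem posSemidef_prod {n : ℕ} (s : Finset ι) (P Q : ι → Matrix (Fin n) (Fin n) ℂ)
    (hP : ∀ i, (P i).PosSemidef) (hQ : ∀ i, (Q i - P i).PosSemidef) :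
    (Matrix.of fun k l => ∏ i ∈ s, P i k l).PosSemidef ∧
      (Matrix.of fun k l => (∏ i ∈ s, Q i k l) - ∏ i ∈ s, P i k l).PosSemidef := by
  classical
  induction s using Finset.induction_on with
  | empty =>
    constructor
    · have h := Matrix.posSemidef_gram ℂ (fun _ : Fin n => (1 : ℂ))
      have e : (Matrix.of fun _ _ => (1 : ℂ) : Matrix (Fin n) (Fin n) ℂ)
          = Matrix.gram ℂ (fun _ : Fin n => (1 : ℂ)) := by
        ext; simp [Matrix.gram_apply]
      simpa [e] using h
    · have e : (Matrix.of fun _ _ => (0 : ℂ) : Matrix (Fin n) (Fin n) ℂ) = 0 := rfl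
      simpa [e] using (Matrix.PosSemidef.zero : (0 : Matrix (Fin n) (Fin n) ℂ).PosSemidef)
  | insert a s ha ih =>
    obtain ⟨h1, h2⟩ := ih
    have hQa : (Q a).PosSemidef := by simpa using (hQ a).add (hP a)
    constructor
    · have e : (Matrix.of fun k l => ∏ i ∈ insert a s, P i k l)
          = (P a).hadamard (Matrix.of fun k l => ∏ i ∈ s, P i k l) := by
        ext k l
        simp [Finset.prod_insert ha]
      rw [e]
      exact (hP a).hadamard h1
    · have e : (Matrix.of fun k l => (∏ i ∈ insert a s, Q i k l) - ∏ i ∈ insert a s, P i k l)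
          = (Q a).hadamard (Matrix.of fun k l => (∏ i ∈ s, Q i k l) - ∏ i ∈ s, P i k l)
            + (Q a - P a).hadamard (Matrix.of fun k l => ∏ i ∈ s, P i k l) := by
        ext k l
        simp [Finset.prod_insert ha]
        ring
      rw [e]
      exact (hQa.hadamard h2).add ((hQ a).hadamard h1)

theorem algInner_self_nonneg (z : Alg H) : 0 ≤ algInner z z := by
  obtain ⟨n, c, x, rfl⟩ := exists_eq_sum z
  rw [algInner_sum]
  refine Matrix.PosSemidef.dotProduct_mulVec_nonneg ?_ c
  refine (posSemidef_prod Finset.univ (fun i => Matrix.gram ℂ fun k => x k i)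
    (fun i => Matrix.gram ℂ fun k => x k i) (fun i => Matrix.posSemidef_gram ℂ _)
    fun i => ?_).1
  rw [sub_self]
  exact Matrix.PosSemidef.zero

instance algCore : PreInnerProductSpace.Core ℂ (Alg H) where
  inner := algInner
  conj_inner_symm x y := algInner_conj_symm x y
  re_inner_nonneg x := (Complex.le_def.1 (algInner_self_nonneg x)).1
  add_left := algInner_add_left
  smul_left x y c := algInner_smul_left c x y

instance : SeminormedAddCommGroup (Alg H) :=
  InnerProductSpace.Core.toSeminormedAddCommGroup (𝕜 := ℂ)

instance : InnerProductSpace ℂ (Alg H) := InnerProductSpace.ofCore algCore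

theorem inner_eq_algInner (x y : Alg H) : inner ℂ x y = algInner x y := rfl

/-- The algebraic tensor product of bounded operators. -/
def algMap (A : ∀ i, H i →L[ℂ] H i) : Alg H →ₗ[ℂ] Alg H :=
  PiTensorProduct.map (fun i => (A i : H i →ₗ[ℂ] H i))

theorem algMap_algTmul (A : ∀ i, H i →L[ℂ] H i) (φ : ∀ i, H i) :
    algMap A (algTmul φ) = algTmul fun i => A i (φ i) :=
  PiTensorProduct.map_tprod _ _

theorem gram_sub_posSemidef {E : Type v} [NormedAddCommGroup E] [InnerProductSpace ℂ E]
    (A : E →L[ℂ] E) {n : ℕ} (x : Fin n → E) :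
    (((‖A‖ ^ 2 : ℝ) : ℂ) • Matrix.gram ℂ x - Matrix.gram ℂ fun k => A (x k)).PosSemidef := by
  have hsm : (((‖A‖ ^ 2 : ℝ) : ℂ) • Matrix.gram ℂ x).IsHermitian := by
    ext k l
    simp [Matrix.gram_apply]
  refine .of_dotProduct_mulVec_nonneg (hsm.sub (Matrix.isHermitian_gram ℂ _)) fun c => ?_
  rw [Matrix.sub_mulVec, Matrix.smul_mulVec, dotProduct_sub, dotProduct_smul,
    Matrix.star_dotProduct_gram_mulVec, Matrix.star_dotProduct_gram_mulVec]
  have h : ∑ i, c i • A (x i) = A (∑ i, c i • x i) := by simp [map_sum]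
  rw [h, inner_self_eq_norm_sq_to_K, inner_self_eq_norm_sq_to_K, sub_nonneg, smul_eq_mul]
  have hA := A.le_opNorm (∑ i, c i • x i)
  have h2 : ‖A (∑ i, c i • x i)‖ ^ 2 ≤ ‖A‖ ^ 2 * ‖∑ i, c i • x i‖ ^ 2 := by
    rw [← mul_pow]
    exact pow_le_pow_left₀ (norm_nonneg _) hA 2
  have h3 := Complex.real_le_real.2 h2
  simpa using h3

theorem algMap_bound (A : ∀ i, H i →L[ℂ] H i) (z : Alg H) :
    ‖algMap A z‖ ≤ (∏ i, ‖A i‖) * ‖z‖ := by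
  have key : algInner (algMap A z) (algMap A z)
      ≤ (((∏ i, ‖A i‖) ^ 2 : ℝ) : ℂ) * algInner z z := by
    obtain ⟨n, c, x, rfl⟩ := exists_eq_sum z
    have hmap : algMap A (∑ k, c k • algTmul (x k))
        = ∑ k, c k • algTmul (fun i => A i (x k i)) := by
      simp [map_sum, algMap_algTmul]
    rw [hmap, algInner_sum n c x, algInner_sum n c fun k i => A i (x k i)]
    have h := (posSemidef_prod Finset.univ (fun i => Matrix.gram ℂ fun k => A i (x k i))
      (fun i => ((‖A i‖ ^ 2 : ℝ) : ℂ) • Matrix.gram ℂ fun k => x k i)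
      (fun i => Matrix.posSemidef_gram ℂ _)
      fun i => gram_sub_posSemidef (A i) fun k => x k i).2
    have h' := h.dotProduct_mulVec_nonneg c
    have e : (Matrix.of fun k l =>
        (∏ i, (((‖A i‖ ^ 2 : ℝ) : ℂ) • Matrix.gram ℂ fun k => x k i) k l)
          - ∏ i, (Matrix.gram ℂ fun k => A i (x k i)) k l)
        = (((∏ i, ‖A i‖) ^ 2 : ℝ) : ℂ) •
            (Matrix.of fun k l => ∏ i, (Matrix.gram ℂ fun k => x k i) k l)
          - Matrix.of fun k l => ∏ i, (Matrix.gram ℂ fun k => A i (x k i)) k l := by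
      ext k l
      simp [Finset.prod_mul_distrib, Finset.prod_pow]
    rw [e, Matrix.sub_mulVec, Matrix.smul_mulVec, dotProduct_sub, dotProduct_smul,
      sub_nonneg, smul_eq_mul] at h'
    exact h'
  have hre := (Complex.le_def.1 key).1
  rw [Complex.re_ofReal_mul] at hre
  have h1 : ‖algMap A z‖ ^ 2 = (algInner (algMap A z) (algMap A z)).re :=
    norm_sq_eq_re_inner (𝕜 := ℂ) _
  have h2 : ‖z‖ ^ 2 = (algInner z z).re := norm_sq_eq_re_inner (𝕜 := ℂ) _
  rw [← h1, ← h2, ← mul_pow] at hre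
  exact le_of_sq_le_sq hre
    (mul_nonneg (Finset.prod_nonneg fun i _ => norm_nonneg _) (norm_nonneg _))

end HilbertTensor

/-- The Hilbert tensor product `⊗ H i`: the completion of the algebraic tensor product. -/
abbrev HilbertTensor {ι : Type*} [Fintype ι] (H : ι → Type*)
    [∀ i, NormedAddCommGroup (H i)] [∀ i, InnerProductSpace ℂ (H i)] : Type _ :=
  UniformSpace.Completion (HilbertTensor.Alg H)

namespace HilbertTensor

variable {ι : Type*} [Fintype ι] {H : ι → Type*}
  [∀ i, NormedAddCommGroup (H i)] [∀ i, InnerProductSpace ℂ (H i)]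

/-- The elementary tensor `⊗ φ i` in the Hilbert tensor product. -/
def tmul (φ : ∀ i, H i) : HilbertTensor H := ((algTmul φ : Alg H) : HilbertTensor H)

/-- The tensor product `⊗ A i` of bounded operators: the continuous extension of the
algebraic tensor product of the `A i`. -/
def map (A : ∀ i, H i →L[ℂ] H i) : HilbertTensor H →L[ℂ] HilbertTensor H :=
  ((algMap A).mkContinuous (∏ i, ‖A i‖) (algMap_bound A)).completion

theorem map_tmul (A : ∀ i, H i →L[ℂ] H i) (φ : ∀ i, H i) :
    map A (tmul φ) = tmul fun i => A i (φ i) := by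
  unfold map tmul
  rw [ContinuousLinearMap.completion_apply_coe, LinearMap.mkContinuous_apply, algMap_algTmul]

theorem inner_tmul (φ ψ : ∀ i, H i) :
    inner ℂ (tmul φ) (tmul ψ) = ∏ i, inner ℂ (φ i) (ψ i) := by
  unfold tmul
  rw [UniformSpace.Completion.inner_coe, inner_eq_algInner, algInner_algTmul]

end HilbertTensor

/-! ### Singular values, trace, fractional powers, Dixmier trace -/

section Operators

variable {H : Type*} [NormedAddCommGroup H] [InnerProductSpace ℂ H] [CompleteSpace H]

/-- The `k`-th singular value (`k = 0, 1, …`, in decreasing order, with multiplicity): the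
distance of `T` to the operators of rank at most `k`. For compact `T` this is the `k`-th
eigenvalue of `|T|`. -/
def singularValue (T : H →L[ℂ] H) (k : ℕ) : ℝ :=
  sInf {r : ℝ | ∃ F : H →L[ℂ] H, LinearMap.rank (F : H →ₗ[ℂ] H) ≤ k ∧ r = ‖T - F‖}

/-- The trace class `S_1(H)`. -/
def IsTraceClass (T : H →L[ℂ] H) : Prop :=
  IsCompactOperator T ∧ Summable (singularValue T)

variable (H) in
/-- The index set of some orthonormal basis of `H`. -/
def someBasisIndex : Set H := (exists_hilbertBasis ℂ H).choose

variable (H) in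
/-- Some orthonormal basis of `H`. -/
def someBasis : HilbertBasis (someBasisIndex H) ℂ H :=
  (exists_hilbertBasis ℂ H).choose_spec.choose

/-- The trace `∑ ⟪φ_k, T φ_k⟫`; for trace class `T` it does not depend on the orthonormal basis. -/
def opTrace (T : H →L[ℂ] H) : ℂ :=
  ∑' k, inner ℂ (someBasis H k) (T (someBasis H k))

/-- The integrand `t^{p-2} A² (t + A)⁻¹` of Balakrishnan's formula. -/
def balakrishnanIntegrand (A : H →L[ℂ] H) (p t : ℝ) : H →L[ℂ] H :=
  ((t ^ (p - 2) : ℝ) : ℂ) • (A ^ 2 * Ring.inverse ((t : ℂ) • (1 : H →L[ℂ] H) + A))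

/-- The power `A^p`, `1 < p < 2`, exists: the open negative half-axis lies in the resolvent set
of `A`, and the integral in Balakrishnan's formula converges absolutely in operator norm. -/
def HasFracPow (A : H →L[ℂ] H) (p : ℝ) : Prop :=
  (∀ t : ℝ, 0 < t → IsUnit ((t : ℂ) • (1 : H →L[ℂ] H) + A)) ∧
    IntegrableOn (balakrishnanIntegrand A p) (Set.Ioi 0)

/-- The power `A^p` for `1 < p < 2`, by Balakrishnan's formula
`A^p = (sin (π (p - 1)) / π) ∫_0^∞ t^{p-2} A² (t + A)⁻¹ dt`, which does not require `A` to be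
normal. For positive `A` it is the power given by the spectral theorem. -/
def fracPow (A : H →L[ℂ] H) (p : ℝ) : H →L[ℂ] H :=
  ((Real.sin (Real.pi * (p - 1)) / Real.pi : ℝ) : ℂ) •
    ∫ t in Set.Ioi (0 : ℝ), balakrishnanIntegrand A p t

/-- The partial sums of the singular values, divided by the logarithm of their number
(`log (n + 2)` is used for `n + 1` terms, so that the logarithm is never zero). -/
def dixmierSeq (T : H →L[ℂ] H) (n : ℕ) : ℝ :=
  (∑ k ∈ Finset.range (n + 1), singularValue T k) / Real.log (n + 2)

/-- The Dixmier ideal: compact operators with `s_0(T) + … + s_n(T) = O(log n)`. -/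
def IsInDixmierIdeal (T : H →L[ℂ] H) : Prop :=
  IsCompactOperator T ∧ ∃ C : ℝ, ∀ n, dixmierSeq T n ≤ C

end Operators

/-- The generalised limits `ω` on bounded sequences that define Dixmier traces: positive linear
functionals that extend the limit and are invariant under
`(x_0, x_1, …) ↦ (x_0, x_0, x_1, x_1, …)`. -/
structure DixmierLimit where
  toLinearMap : lp (fun _ : ℕ => ℝ) ⊤ →ₗ[ℝ] ℝ
  nonneg : ∀ x, (∀ n, 0 ≤ x n) → 0 ≤ toLinearMap x
  eq_of_tendsto : ∀ (x) (l : ℝ), Tendsto (fun n => x n) atTop (𝓝 l) → toLinearMap x = l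
  dilation : ∀ x y, (∀ n, y n = x (n / 2)) → toLinearMap y = toLinearMap x

section Operators

variable {H : Type*} [NormedAddCommGroup H] [InnerProductSpace ℂ H] [CompleteSpace H]

open Classical in
/-- `Tr_ω(T)` for a positive operator `T` in the Dixmier ideal. -/
def dixmierTracePos (ω : DixmierLimit) (T : H →L[ℂ] H) : ℝ :=
  if h : Memℓp (dixmierSeq T) ⊤ then ω.toLinearMap ⟨dixmierSeq T, h⟩ else 0

/-- The Dixmier trace: the linear extension of `dixmierTracePos` to the Dixmier ideal, through
the positive and negative parts of the real and imaginary parts of `T`. -/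
def dixmierTrace (ω : DixmierLimit) (T : H →L[ℂ] H) : ℂ :=
  ((dixmierTracePos ω ((realPart T : H →L[ℂ] H)⁺)
      - dixmierTracePos ω ((realPart T : H →L[ℂ] H)⁻) : ℝ) : ℂ) +
    Complex.I *
      ((dixmierTracePos ω ((imaginaryPart T : H →L[ℂ] H)⁺)
        - dixmierTracePos ω ((imaginaryPart T : H →L[ℂ] H)⁻) : ℝ) : ℂ)

end Operators

/-! ### Pseudo-differential operators on the circle -/

/-- The circle `𝕋 = ℝ/ℤ` with its normalised Haar measure, and `L²(𝕋)`. -/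
abbrev circleMeasure : Measure UnitAddCircle := AddCircle.haarAddCircle

/-- The Hilbert space `L²(𝕋)`. -/
abbrev L2Circle : Type := Lp ℂ 2 circleMeasure

/-- `A` is the pseudo-differential operator with symbol `σ` on `𝕋 × ℤ`:
`A f (x) = ∑_j σ(x, j) f̂(j) e^{2πijx}` for all `f ∈ L²(𝕋)`, with convergence in `L²(𝕋)`. -/
def HasSymbol (σ : UnitAddCircle → ℤ → ℂ) (A : L2Circle →L[ℂ] L2Circle) : Prop :=
  ∀ f : L2Circle, ∃ u : ℤ → L2Circle,
    (∀ j, u j =ᵐ[circleMeasure] fun x => σ x j * fourierCoeff f j * fourier j x) ∧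
      HasSum u (A f)

/-- The `L^∞(𝕋)` norm. -/
def supNorm (a : UnitAddCircle → ℝ) : ℝ := (eLpNorm a ⊤ circleMeasure).toReal

/-- The `ℓ^p(ℤ)` norm. -/
def ellNorm (p : ℝ) (β : ℤ → ℝ) : ℝ := (∑' j, |β j| ^ p) ^ (1 / p)

end

/-! Write `M` for multiplication by `a` and `B` for the Fourier multiplier with entries `β`. The
operator with symbol `a(x)β(j)` is `M B`, where `M = K† K` with `K` multiplication by `√a`, and `B =
Y²` with `Y` diagonal and self-adjoint. Since characters have modulus one, `‖K e_j‖² = ∫ a = α` for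
every `j`. `IsSymbolProduct` records exactly this structure. It is stable under tensor products
(`HilbertTensor.isSymbolProduct_map`): the entries and the constants `α` multiply. So it suffices to
treat one operator `A = K† K Y²`.

`A` is not normal, but `A = X Y` with `X = K† K Y`, and `Y X = S := Y K† K Y` is positive and
compact. The resolvents of `X Y` and `Y X` are linked algebraically, so the Balakrishnan power is
`A^p = X S^{p-1} Y` (`fracPow_mul`). Expanding `S^{p-1}` in eigenvectors of `S` gives a nuclear
series for `A^p`, whence `A^p` is trace class with trace `∑ s_k(S)^p`
(`IsSymbolProduct.exists_isNuclearSum`, `IsNuclearSum.opTrace_eq`).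

Two applications of Jensen's inequality, from the eigenbasis to the Fourier basis and back, give
`α^p ∑ b_j^p ≤ ∑ s_k(S)^p ≤ ‖K‖^{2(p-1)} α ∑ b_j^p`. After multiplication by `p - 1` both ends have
the limit `αℓ` as `p → 1+`, where `ℓ` is the limit of `(p - 1) ∑ b_j^p`. Traces of tensor products
of nuclear operators are products of traces (`HilbertTensor.opTrace_map`), and multiplying the
bounds of the factors gives the same limit for `⊗ A_m^p`.

Karamata's Tauberian theorem (`tendsto_sum_div_log`) turns the limit of `(p - 1) ∑ s_k(S)^p` into
convergence of the logarithmic means of `s_k(S)`, so every Dixmier trace of `S` equals `αℓ`. It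
remains to see that `A` and `S` have the same Dixmier trace. This is the trace property, proved by
polarisation in `dixmierTrace_mul` from the equality of the singular values of `W† W` and `W W†` and
from additivity of the Dixmier trace on positive operators, which rests on Ky Fan's inequalities and
the dilation invariance of `ω`. -/

set_option linter.unusedSectionVars false

/-! ### Orthogonal families of vectors of norm at most one -/

section SubOrthonormal

variable {H : Type*} [NormedAddCommGroup H] [InnerProductSpace ℂ H] {ι : Type*}

/-- A pairwise orthogonal family of vectors of norm at most one. -/
structure SubOrthonormal (v : ι → H) : Prop where
  inner_eq_zero : ∀ i j, i ≠ j → inner ℂ (v i) (v j) = 0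
  norm_le_one : ∀ i, ‖v i‖ ≤ 1

theorem Orthonormal.subOrthonormal {v : ι → H} (hv : Orthonormal ℂ v) : SubOrthonormal v :=
  ⟨fun _ _ h => hv.2 h, fun i => (hv.1 i).le⟩

theorem SubOrthonormal.inner_sum_right {v : ι → H} (hv : SubOrthonormal v) (s : Finset ι)
    (c : ι → ℂ) {i : ι} (hi : i ∈ s) :
    inner ℂ (v i) (∑ j ∈ s, c j • v j) = c i * (‖v i‖ : ℂ) ^ 2 := by
  rw [inner_sum, Finset.sum_eq_single i]
  · rw [inner_smul_right, inner_self_eq_norm_sq_to_K]; rfl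
  · intro j _ hj
    rw [inner_smul_right, hv.1 i j hj.symm, mul_zero]
  · exact fun h => absurd hi h

theorem SubOrthonormal.norm_sum_sq {v : ι → H} (hv : SubOrthonormal v) (s : Finset ι)
    (c : ι → ℂ) : ‖∑ j ∈ s, c j • v j‖ ^ 2 = ∑ j ∈ s, ‖c j‖ ^ 2 * ‖v j‖ ^ 2 := by
  have h : (inner ℂ (∑ j ∈ s, c j • v j) (∑ j ∈ s, c j • v j) : ℂ)
      = ((∑ j ∈ s, ‖c j‖ ^ 2 * ‖v j‖ ^ 2 : ℝ) : ℂ) := by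
    rw [sum_inner, Complex.ofReal_sum]
    refine Finset.sum_congr rfl fun i hi => ?_
    rw [inner_smul_left, hv.inner_sum_right s c hi, ← mul_assoc, Complex.conj_mul']
    push_cast; rfl
  rw [inner_self_eq_norm_sq_to_K] at h
  exact Complex.ofReal_injective (by rw [← h]; push_cast; rfl)

/-- Bessel's inequality. -/
theorem SubOrthonormal.sum_inner_le {v : ι → H} (hv : SubOrthonormal v) (s : Finset ι) (x : H) :
    ∑ j ∈ s, ‖inner ℂ (v j) x‖ ^ 2 ≤ ‖x‖ ^ 2 := by
  set y := ∑ j ∈ s, inner ℂ (v j) x • v j with hy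
  have h1 : RCLike.re (inner ℂ x y) = ∑ j ∈ s, ‖inner ℂ (v j) x‖ ^ 2 := by
    rw [hy, inner_sum, map_sum]
    refine Finset.sum_congr rfl fun i _ => ?_
    rw [inner_smul_right, ← inner_conj_symm x (v i), Complex.mul_conj']
    norm_cast
  have h2 : ‖y‖ ^ 2 ≤ ∑ j ∈ s, ‖inner ℂ (v j) x‖ ^ 2 := by
    rw [hy, hv.norm_sum_sq]
    refine Finset.sum_le_sum fun i _ => mul_le_of_le_one_right (by positivity) ?_
    exact pow_le_one₀ (norm_nonneg _) (hv.2 i)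
  have h3 := @norm_sub_sq ℂ _ _ _ _ x y
  have h4 : 0 ≤ ‖x - y‖ ^ 2 := by positivity
  linarith

theorem SubOrthonormal.summable_inner {v : ι → H} (hv : SubOrthonormal v) (x : H) :
    Summable fun j => ‖inner ℂ (v j) x‖ ^ 2 :=
  summable_of_sum_le (fun _ => by positivity) fun s => hv.sum_inner_le s x

end SubOrthonormal

/-! ### Singular values -/

section Singular

variable {H : Type*} [NormedAddCommGroup H] [InnerProductSpace ℂ H]

theorem bddBelow_singularValue (T : H →L[ℂ] H) (k : ℕ) : BddBelow
    {r : ℝ | ∃ F : H →L[ℂ] H, LinearMap.rank (F : H →ₗ[ℂ] H) ≤ k ∧ r = ‖T - F‖} :=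
  ⟨0, by rintro _ ⟨F, -, rfl⟩; exact norm_nonneg _⟩

theorem nonempty_singularValue (T : H →L[ℂ] H) (k : ℕ) : Set.Nonempty
    {r : ℝ | ∃ F : H →L[ℂ] H, LinearMap.rank (F : H →ₗ[ℂ] H) ≤ k ∧ r = ‖T - F‖} :=
  ⟨_, 0, by simp, rfl⟩

theorem singularValue_nonneg (T : H →L[ℂ] H) (k : ℕ) : 0 ≤ singularValue T k :=
  Real.sInf_nonneg (by rintro _ ⟨F, -, rfl⟩; exact norm_nonneg _)

theorem singularValue_le {T F : H →L[ℂ] H} {k : ℕ} (hF : LinearMap.rank (F : H →ₗ[ℂ] H) ≤ k) :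
    singularValue T k ≤ ‖T - F‖ :=
  csInf_le (bddBelow_singularValue T k) ⟨F, hF, rfl⟩

theorem le_singularValue {T : H →L[ℂ] H} {k : ℕ} {c : ℝ}
    (h : ∀ F : H →L[ℂ] H, LinearMap.rank (F : H →ₗ[ℂ] H) ≤ k → c ≤ ‖T - F‖) :
    c ≤ singularValue T k :=
  le_csInf (nonempty_singularValue T k) (by rintro _ ⟨F, hF, rfl⟩; exact h F hF)

theorem singularValue_antitone (T : H →L[ℂ] H) : Antitone (singularValue T) := by
  intro k l h
  exact le_singularValue fun F hF => singularValue_le (hF.trans (by exact_mod_cast h))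

theorem singularValue_le_norm (T : H →L[ℂ] H) (k : ℕ) : singularValue T k ≤ ‖T‖ := by
  simpa using singularValue_le (T := T) (F := 0) (k := k) (by simp)

theorem singularValue_mul_left_le (C T : H →L[ℂ] H) (k : ℕ) :
    singularValue (C * T) k ≤ ‖C‖ * singularValue T k := by
  rcases (norm_nonneg C).eq_or_lt with h0 | h0
  · have : C = 0 := norm_eq_zero.1 h0.symm
    subst this
    simpa using singularValue_le_norm ((0 : H →L[ℂ] H) * T) k
  rw [← div_le_iff₀' h0]
  refine le_singularValue fun F hF => ?_
  rw [div_le_iff₀' h0]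
  refine (singularValue_le (F := C * F) ?_).trans ?_
  · exact (LinearMap.rank_comp_le_right (F : H →ₗ[ℂ] H) (C : H →ₗ[ℂ] H)).trans hF
  · rw [← mul_sub]; exact norm_mul_le _ _

theorem singularValue_mul_right_le (C T : H →L[ℂ] H) (k : ℕ) :
    singularValue (T * C) k ≤ singularValue T k * ‖C‖ := by
  rcases (norm_nonneg C).eq_or_lt with h0 | h0
  · have : C = 0 := norm_eq_zero.1 h0.symm
    subst this
    simpa using singularValue_le_norm (T * (0 : H →L[ℂ] H)) k
  rw [← div_le_iff₀ h0]
  refine le_singularValue fun F hF => ?_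
  rw [div_le_iff₀ h0]
  refine (singularValue_le (F := F * C) ?_).trans ?_
  · exact (LinearMap.rank_comp_le_left (C : H →ₗ[ℂ] H) (F : H →ₗ[ℂ] H)).trans hF
  · rw [← sub_mul]; exact norm_mul_le _ _

theorem singularValue_mul_mul_le (C T D : H →L[ℂ] H) (k : ℕ) :
    singularValue (C * (T * D)) k ≤ ‖C‖ * ‖D‖ * singularValue T k :=
  calc singularValue (C * (T * D)) k ≤ ‖C‖ * singularValue (T * D) k :=
        singularValue_mul_left_le _ _ k
    _ ≤ ‖C‖ * (singularValue T k * ‖D‖) :=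
        mul_le_mul_of_nonneg_left (singularValue_mul_right_le _ _ k) (norm_nonneg _)
    _ = _ := by ring

/-- `k + 1` orthonormal eigenvectors with large eigenvalues bound `s_k` from below. -/
theorem le_singularValue_of_orthonormal {T : H →L[ℂ] H} {k : ℕ} {c : ℝ}
    {u : Fin (k + 1) → H} (hu : Orthonormal ℂ u) {l : Fin (k + 1) → ℝ}
    (hT : ∀ i, T (u i) = (l i : ℂ) • u i) (hc : 0 ≤ c) (hl : ∀ i, c ≤ l i) :
    c ≤ singularValue T k := by
  refine le_singularValue fun F hF => ?_
  -- A map of rank at most `k` has a kernel vector in the `(k + 1)`-dimensional span of the `u i`;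
  -- there `T - F` acts as `T`, which stretches by at least `c`.
  obtain ⟨a, ha0, ha⟩ : ∃ a : Fin (k + 1) → ℂ, a ≠ 0 ∧ F (∑ i, a i • u i) = 0 := by
    have hdep : ¬ LinearIndependent ℂ fun i => F (u i) := by
      intro h
      have h1 : LinearIndependent ℂ
          (fun i => (⟨F (u i), LinearMap.mem_range_self (F : H →ₗ[ℂ] H) (u i)⟩ :
            LinearMap.range (F : H →ₗ[ℂ] H))) :=
        LinearIndependent.of_comp (LinearMap.range (F : H →ₗ[ℂ] H)).subtype h
      have h2 := h1.cardinal_lift_le_rank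
      simp only [Cardinal.mk_fin, Cardinal.lift_natCast] at h2
      have h4 := h2.trans (Cardinal.lift_le.2 hF)
      rw [Cardinal.lift_natCast] at h4
      exact absurd (Nat.cast_le.1 h4) (by omega)
    rw [Fintype.linearIndependent_iff] at hdep
    push Not at hdep
    obtain ⟨a, h0, i, hi⟩ := hdep
    refine ⟨a, fun h => hi (by simp [h]), ?_⟩
    simpa using h0
  set x := ∑ i, a i • u i with hx
  have hxn : ‖x‖ ^ 2 = ∑ i, ‖a i‖ ^ 2 := by
    rw [hx, hu.subOrthonormal.norm_sum_sq]; simp [hu.1]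
  have hTx : ‖T x‖ ^ 2 = ∑ i, (l i * ‖a i‖) ^ 2 := by
    have : T x = ∑ i, (a i * l i) • u i := by
      rw [hx, map_sum]
      refine Finset.sum_congr rfl fun i _ => ?_
      rw [map_smul, hT, smul_smul]
    rw [this, hu.subOrthonormal.norm_sum_sq]
    refine Finset.sum_congr rfl fun i _ => ?_
    rw [hu.1, norm_mul, Complex.norm_real, Real.norm_of_nonneg (hc.trans (hl i))]
    ring
  have hx0 : 0 < ‖x‖ := by
    rw [norm_pos_iff]
    intro h
    rw [h, norm_zero] at hxn
    apply ha0
    have := (Finset.sum_eq_zero_iff_of_nonneg (fun i _ => by positivity)).1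
      (show ∑ i, ‖a i‖ ^ 2 = 0 by rw [← hxn]; norm_num)
    ext i
    simpa using this i (Finset.mem_univ i)
  have h1 : c * ‖x‖ ≤ ‖T x‖ := by
    refine le_of_sq_le_sq ?_ (norm_nonneg _)
    rw [mul_pow, hxn, hTx, Finset.mul_sum]
    refine Finset.sum_le_sum fun i _ => ?_
    rw [mul_pow]
    have := hl i
    gcongr
  have h2 : T x = (T - F) x := by rw [sub_apply, ha, sub_zero]
  rw [h2] at h1
  exact le_of_mul_le_mul_right (h1.trans ((T - F).le_opNorm x)) hx0

theorem rank_sum_smul_rankOne_le (v : ℕ → H) (c : ℕ → ℂ) (n : ℕ) :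
    LinearMap.rank ((∑ k ∈ Finset.range n,
      c k • InnerProductSpace.rankOne ℂ (v k) (v k) : H →L[ℂ] H) : H →ₗ[ℂ] H) ≤ n := by
  classical
  have hsub : LinearMap.range ((∑ k ∈ Finset.range n,
      c k • InnerProductSpace.rankOne ℂ (v k) (v k) : H →L[ℂ] H) : H →ₗ[ℂ] H)
      ≤ Submodule.span ℂ (((Finset.range n).image v : Finset H) : Set H) := by
    rintro _ ⟨x, rfl⟩
    simp only [ContinuousLinearMap.coe_coe, sum_apply, smul_apply,
      InnerProductSpace.rankOne_apply]
    refine Submodule.sum_mem _ fun k hk => Submodule.smul_mem _ _ (Submodule.smul_mem _ _ ?_)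
    exact Submodule.subset_span (by simpa using ⟨k, Finset.mem_range.1 hk, rfl⟩)
  refine (Submodule.rank_mono hsub).trans ((rank_span_finset_le _).trans ?_)
  exact_mod_cast Finset.card_image_le.trans (by simp)

theorem isCompactOperator_of_finiteDimensional_range {F : H →L[ℂ] H}
    (hF : FiniteDimensional ℂ (LinearMap.range (F : H →ₗ[ℂ] H))) : IsCompactOperator F := by
  have h1 : IsCompactOperator (F.codRestrict (LinearMap.range (F : H →ₗ[ℂ] H))
      (fun x => LinearMap.mem_range_self (F : H →ₗ[ℂ] H) x)) := by
    have : ProperSpace (LinearMap.range (F : H →ₗ[ℂ] H)) := FiniteDimensional.proper ℂ _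
    exact isCompactOperator_of_locallyCompactSpace_dom
      (F.codRestrict (LinearMap.range (F : H →ₗ[ℂ] H))
        fun x => LinearMap.mem_range_self (F : H →ₗ[ℂ] H) x)
  exact h1.clm_comp (LinearMap.range (F : H →ₗ[ℂ] H)).subtypeL

variable [CompleteSpace H]

/-- Near-minimisers in the definition of `s_k` have finite rank and converge to `T` in norm. The
slack `1 / (k + 1)` avoids having to know that the infimum is attained. -/
theorem isCompactOperator_of_tendsto_singularValue {T : H →L[ℂ] H}
    (hT : Tendsto (singularValue T) atTop (𝓝 0)) : IsCompactOperator T := by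
  have h : ∀ k : ℕ, ∃ F : H →L[ℂ] H, LinearMap.rank (F : H →ₗ[ℂ] H) ≤ k ∧
      ‖T - F‖ < singularValue T k + 1 / ((k : ℝ) + 1) := by
    intro k
    obtain ⟨_, ⟨F, hF, rfl⟩, h⟩ := exists_lt_of_csInf_lt (nonempty_singularValue T k)
      (show sInf _ < singularValue T k + 1 / ((k : ℝ) + 1) from
        lt_add_of_pos_right _ (by positivity))
    exact ⟨F, hF, h⟩
  choose F hF hFT using h
  have hlim : Tendsto F atTop (𝓝 T) := by
    rw [tendsto_iff_norm_sub_tendsto_zero]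
    refine squeeze_zero (fun _ => norm_nonneg _) (fun k => ?_)
      (by simpa only [add_zero] using hT.add tendsto_one_div_add_atTop_nhds_zero_nat)
    rw [norm_sub_rev]
    exact (hFT k).le
  refine isCompactOperator_of_tendsto hlim (Eventually.of_forall fun k => ?_)
  refine isCompactOperator_of_finiteDimensional_range ?_
  have : Module.rank ℂ (LinearMap.range (F k : H →ₗ[ℂ] H)) < Cardinal.aleph0 :=
    (hF k).trans_lt (Cardinal.natCast_lt_aleph0)
  exact Module.rank_lt_aleph0_iff.1 this

end Singular

/-! ### The spectral theorem for positive compact operators -/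

section Spectral

variable {H : Type*} [NormedAddCommGroup H] [InnerProductSpace ℂ H] [CompleteSpace H]

/-- The vectors `v k` are eigenvectors of the positive compact operator `T` for its singular
values, and diagonalise it (`v k = 0` once the singular values vanish). -/
structure IsSpectralSeq (T : H →L[ℂ] H) (v : ℕ → H) : Prop where
  orth : SubOrthonormal v
  norm_eq_one : ∀ k, singularValue T k ≠ 0 → ‖v k‖ = 1
  eq_zero : ∀ k, singularValue T k = 0 → v k = 0
  map_eq : ∀ k, T (v k) = (singularValue T k : ℂ) • v k
  tendsto : Tendsto (singularValue T) atTop (𝓝 0)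
  norm_sub_le : ∀ n, ‖T - ∑ k ∈ Finset.range n,
    (singularValue T k : ℂ) • InnerProductSpace.rankOne ℂ (v k) (v k)‖ ≤ singularValue T n
  sum_le : ∀ n x, ∑ k ∈ Finset.range n, singularValue T k * ‖inner ℂ (v k) x‖ ^ 2
    ≤ (inner ℂ (T x) x).re
  le_sum : ∀ n x, (inner ℂ (T x) x).re
    ≤ ∑ k ∈ Finset.range n, singularValue T k * ‖inner ℂ (v k) x‖ ^ 2
      + singularValue T n * (‖x‖ ^ 2 - ∑ k ∈ Finset.range n, ‖inner ℂ (v k) x‖ ^ 2)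

/-- The norm of a positive operator lies in its spectrum, and a nonzero spectral value of a compact
operator is an eigenvalue. For `R = 0` the vector is set to zero, so that the deflation below can
run for ever. -/
theorem exists_top_eigenvector {R : H →L[ℂ] H} (hR : R.IsPositive) (hc : IsCompactOperator R) :
    ∃ v : H, (R = 0 → v = 0) ∧ (R ≠ 0 → ‖v‖ = 1) ∧ R v = (‖R‖ : ℂ) • v := by
  by_cases h0 : R = 0
  · exact ⟨0, by simp, by simp [h0], by simp⟩
  have hnt : Nontrivial H := by
    by_contra h
    rw [not_nontrivial_iff_subsingleton] at h
    exact h0 (Subsingleton.elim _ _)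
  have hspec : ((‖R‖ : ℝ) : ℂ) ∈ spectrum ℂ R :=
    spectrum.algebraMap_mem ℂ (CStarAlgebra.norm_mem_spectrum_of_nonneg
      (ContinuousLinearMap.nonneg_iff_isPositive R |>.2 hR))
  have hne : ((‖R‖ : ℝ) : ℂ) ≠ 0 := by simpa using h0
  obtain ⟨w, hw⟩ := ((IsCompactOperator.hasEigenvalue_iff_mem_spectrum hc hne).2
    hspec).exists_hasEigenvector
  refine ⟨((‖w‖⁻¹ : ℝ) : ℂ) • w, fun h => absurd h h0, fun _ => ?_, ?_⟩
  · rw [norm_smul, Complex.norm_real, norm_inv, norm_norm,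
      inv_mul_cancel₀ (norm_ne_zero_iff.2 hw.2)]
  · rw [map_smul, smul_comm]
    congr 1
    exact hw.apply_eq_smul

theorem re_inner_smul_rankOne (c : ℝ) (v x : H) :
    (inner ℂ (((c : ℂ) • InnerProductSpace.rankOne ℂ v v : H →L[ℂ] H) x) x).re
      = c * ‖inner ℂ v x‖ ^ 2 := by
  rw [smul_apply, InnerProductSpace.rankOne_apply, inner_smul_left, inner_smul_left,
    Complex.conj_mul', Complex.conj_ofReal]
  norm_cast

/-- Removing the top eigenvector amounts to the compression `P R P` with `P = 1 - v ⊗ v`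
self-adjoint, and compressions preserve positivity. -/
theorem ContinuousLinearMap.IsPositive.deflate {R : H →L[ℂ] H} (hR : R.IsPositive) {v : H}
    (hv : R ≠ 0 → ‖v‖ = 1) (h : R v = (‖R‖ : ℂ) • v) :
    (R - (‖R‖ : ℂ) • InnerProductSpace.rankOne ℂ v v : H →L[ℂ] H).IsPositive := by
  by_cases h0 : R = 0
  · subst h0; simp
  have hv1 := hv h0
  have hP : (InnerProductSpace.rankOne ℂ v v : H →L[ℂ] H).IsPositive :=
    InnerProductSpace.isPositive_rankOne_self v
  have e : R - (‖R‖ : ℂ) • InnerProductSpace.rankOne ℂ v v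
      = (ContinuousLinearMap.adjoint (1 - InnerProductSpace.rankOne ℂ v v : H →L[ℂ] H))
        ∘L R ∘L (1 - InnerProductSpace.rankOne ℂ v v : H →L[ℂ] H) := by
    have hadj : ContinuousLinearMap.adjoint (1 - InnerProductSpace.rankOne ℂ v v : H →L[ℂ] H)
        = 1 - InnerProductSpace.rankOne ℂ v v := by
      rw [map_sub]
      congr 1
      · exact ContinuousLinearMap.isPositive_one.isSelfAdjoint
      · exact hP.isSelfAdjoint
    rw [hadj]
    ext x
    have h2 : inner ℂ v (R x) = (‖R‖ : ℂ) * inner ℂ v x := by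
      rw [← hR.inner_left_eq_inner_right, h, inner_smul_left, Complex.conj_ofReal]
    have h3 : inner ℂ v v = (1 : ℂ) := by rw [inner_self_eq_norm_sq_to_K, hv1]; simp
    simp only [sub_apply, smul_apply,
      InnerProductSpace.rankOne_apply, ContinuousLinearMap.comp_apply, map_sub, map_smul, h,
      one_apply_eq_self, h2, h3]
    module
  rw [e]
  exact hR.adjoint_conj _

theorem ContinuousLinearMap.IsPositive.norm_le_of_sub {R S : H →L[ℂ] H} (hR : R.IsPositive)
    (hS : (S - R).IsPositive) : ‖R‖ ≤ ‖S‖ :=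
  CStarAlgebra.norm_le_norm_of_nonneg_of_le
    ((ContinuousLinearMap.nonneg_iff_isPositive R).2 hR)
    ((ContinuousLinearMap.le_def R S).2 hS)

/-- The images of two distinct `v k` are orthogonal of norm at least `c`, hence at distance at least
`c`, so no subsequence of the images converges. -/
theorem IsCompactOperator.not_orthonormal_eigenvectors {T : H →L[ℂ] H} (hT : IsCompactOperator T)
    {v : ℕ → H} (hv : Orthonormal ℂ v) {l : ℕ → ℝ} {c : ℝ} (hc : 0 < c) (hl : ∀ k, c ≤ l k)
    (h : ∀ k, T (v k) = (l k : ℂ) • v k) : False := by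
  obtain ⟨K, hK, hK'⟩ := IsCompactOperator.image_closedBall_subset_compact
    (f := (T : H →ₗ[ℂ] H)) hT 1
  obtain ⟨y, -, φ, hφ, hy⟩ := hK.tendsto_subseq
    (x := fun n => T (v n)) (fun n => hK' ⟨v n, by simp [hv.1], rfl⟩)
  have hy := hy.cauchySeq
  rw [Metric.cauchySeq_iff'] at hy
  obtain ⟨n, hn⟩ := hy c hc
  have h1 := hn (n + 1) (by omega)
  simp only [Function.comp_apply, h, dist_eq_norm] at h1
  have hne : φ (n + 1) ≠ φ n := (hφ (Nat.lt_succ_self n)).ne'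
  have h2 := @norm_sub_sq ℂ _ _ _ _ ((l (φ (n + 1)) : ℂ) • v (φ (n + 1)))
    ((l (φ n) : ℂ) • v (φ n))
  rw [inner_smul_left, inner_smul_right, hv.2 hne, norm_smul, norm_smul, hv.1, hv.1,
    Complex.norm_real, Complex.norm_real] at h2
  simp only [mul_zero, map_zero, sub_zero, mul_one, Real.norm_eq_abs, sq_abs] at h2
  have h3 := hl (φ (n + 1))
  nlinarith [norm_nonneg ((l (φ (n + 1)) : ℂ) • v (φ (n + 1)) - (l (φ n) : ℂ) • v (φ n)),
    sq_nonneg (l (φ n))]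

/-- Deflation: `D 0 = T`, and `D (n + 1)` is `D n` without its top eigenvector `v n`. As `T - D n`
has rank at most `n`, `s_n ≤ ‖D n‖`; the eigenvectors `v 0, …, v n` with eigenvalues at least `‖D
n‖` give the converse. The norms decrease to zero, since otherwise there would be infinitely many
orthonormal eigenvectors with eigenvalues bounded below. -/
theorem exists_isSpectralSeq {T : H →L[ℂ] H} (hT : T.IsPositive) (hc : IsCompactOperator T) :
    ∃ v : ℕ → H, IsSpectralSeq T v := by
  -- The choice of eigenvector is made for every operator, so that the recursion `D` can be defined
  -- before positivity and compactness are carried along it.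
  have hex : ∀ R : H →L[ℂ] H, ∃ v : H, R.IsPositive → IsCompactOperator R →
      (R = 0 → v = 0) ∧ (R ≠ 0 → ‖v‖ = 1) ∧ R v = (‖R‖ : ℂ) • v := by
    intro R
    by_cases h : R.IsPositive ∧ IsCompactOperator R
    · obtain ⟨v, hv⟩ := exists_top_eigenvector h.1 h.2
      exact ⟨v, fun _ _ => hv⟩
    · exact ⟨0, fun h1 h2 => absurd ⟨h1, h2⟩ h⟩
  choose f hf using hex
  let D : ℕ → (H →L[ℂ] H) := fun n => Nat.rec T
    (fun _ R => R - (‖R‖ : ℂ) • InnerProductSpace.rankOne ℂ (f R) (f R)) n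
  let v : ℕ → H := fun n => f (D n)
  have hDs : ∀ n, D (n + 1) = D n - (‖D n‖ : ℂ) • InnerProductSpace.rankOne ℂ (v n) (v n) :=
    fun n => rfl
  have hD : ∀ n, (D n).IsPositive ∧ IsCompactOperator (D n) := by
    intro n
    induction n with
    | zero => exact ⟨hT, hc⟩
    | succ n ih =>
      have hv := hf (D n) ih.1 ih.2
      refine ⟨ih.1.deflate hv.2.1 hv.2.2, ?_⟩
      refine IsCompactOperator.sub (f := D n) ih.2 ?_
      have hr := rank_sum_smul_rankOne_le (fun _ => f (D n)) (fun _ => (‖D n‖ : ℂ)) 1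
      rw [Finset.sum_range_one] at hr
      refine isCompactOperator_of_finiteDimensional_range
        (F := (‖D n‖ : ℂ) • InnerProductSpace.rankOne ℂ (f (D n)) (f (D n))) ?_
      exact Module.rank_lt_aleph0_iff.1 (hr.trans_lt Cardinal.natCast_lt_aleph0)
  have hv : ∀ n, (D n = 0 → v n = 0) ∧ (D n ≠ 0 → ‖v n‖ = 1) ∧ D n (v n) = (‖D n‖ : ℂ) • v n :=
    fun n => hf (D n) (hD n).1 (hD n).2
  -- Each remainder annihilates the vectors already removed; by symmetry its own top eigenvector is
  -- then orthogonal to them.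
  have hkill : ∀ n, ∀ i < n, D n (v i) = 0 := by
    intro n
    induction n with
    | zero => simp
    | succ n ih =>
      intro i hi
      rw [hDs, sub_apply, smul_apply, InnerProductSpace.rankOne_apply]
      rcases Nat.lt_succ_iff_lt_or_eq.1 hi with h | rfl
      · have h1 : (‖D n‖ : ℂ) * inner ℂ (v n) (v i) = 0 := by
          have h2 := (hD n).1.inner_left_eq_inner_right (v n) (v i)
          rwa [(hv n).2.2, ih i h, inner_zero_right, inner_smul_left, Complex.conj_ofReal] at h2
        rw [ih i h, smul_smul, h1, zero_smul, sub_zero]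
      · rw [(hv i).2.2]
        rcases eq_or_ne (D i) 0 with h0 | h0
        · simp [h0]
        · rw [inner_self_eq_norm_sq_to_K, (hv i).2.1 h0]
          simp
  have horth' : ∀ n, ∀ i < n, inner ℂ (v n) (v i) = 0 := by
    intro n i hi
    rcases eq_or_ne (D n) 0 with h0 | h0
    · rw [(hv n).1 h0, inner_zero_left]
    · have h2 := (hD n).1.inner_left_eq_inner_right (v n) (v i)
      rw [(hv n).2.2, hkill n i hi, inner_zero_right, inner_smul_left, Complex.conj_ofReal] at h2
      exact (mul_eq_zero.1 h2).resolve_left (by simpa using h0)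
  have horth : SubOrthonormal v := by
    refine ⟨fun i j hij => ?_, fun i => ?_⟩
    · rcases lt_or_gt_of_ne hij with h | h
      · rw [← inner_conj_symm, horth' j i h, map_zero]
      · exact horth' i j h
    · rcases eq_or_ne (D i) 0 with h0 | h0
      · simp [(hv i).1 h0]
      · exact ((hv i).2.1 h0).le
  have hanti : Antitone fun n => ‖D n‖ := by
    refine antitone_nat_of_succ_le fun n => (hD (n + 1)).1.norm_le_of_sub ?_
    rw [hDs, sub_sub_cancel]
    exact (InnerProductSpace.isPositive_rankOne_self (v n)).smul_of_nonneg
      (by exact_mod_cast norm_nonneg (D n))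
  have hsum : ∀ n, D n = T - ∑ k ∈ Finset.range n,
      (‖D k‖ : ℂ) • InnerProductSpace.rankOne ℂ (v k) (v k) := by
    intro n
    induction n with
    | zero => simp [D]
    | succ n ih => rw [Finset.sum_range_succ, ← sub_sub, ← ih, hDs]
  have hTv : ∀ k, T (v k) = (‖D k‖ : ℂ) • v k := by
    intro k
    have h1 : T = D k + ∑ i ∈ Finset.range k,
      (‖D i‖ : ℂ) • InnerProductSpace.rankOne ℂ (v i) (v i) := by rw [hsum k]; abel
    rw [h1, add_apply, (hv k).2.2, sum_apply, Finset.sum_eq_zero, add_zero]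
    intro i hi
    rw [smul_apply, InnerProductSpace.rankOne_apply,
      horth.1 i k (Finset.mem_range.1 hi).ne, zero_smul, smul_zero]
  have hs : ∀ n, singularValue T n = ‖D n‖ := by
    intro n
    refine le_antisymm ?_ ?_
    · rw [hsum n]
      exact singularValue_le (rank_sum_smul_rankOne_le v (fun k => (‖D k‖ : ℂ)) n)
    · rcases (norm_nonneg (D n)).eq_or_lt with h | h
      · rw [← h]; exact singularValue_nonneg T n
      have hne : ∀ i : Fin (n + 1), D i ≠ 0 := fun i => by
        rw [← norm_pos_iff]
        exact h.trans_le (hanti (by omega))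
      refine le_singularValue_of_orthonormal (u := fun i : Fin (n + 1) => v i)
        ⟨fun i => (hv i).2.1 (hne i), fun i j hij => horth.1 _ _ fun e => hij (Fin.ext e)⟩
        (l := fun i => ‖D i‖) (fun i => hTv i) h.le fun i => hanti (by omega)
  have hlim : Tendsto (fun n => ‖D n‖) atTop (𝓝 0) := by
    have h1 := tendsto_atTop_ciInf hanti ⟨0, by rintro _ ⟨n, rfl⟩; exact norm_nonneg _⟩
    have h2 : 0 ≤ ⨅ n, ‖D n‖ := le_ciInf fun n => norm_nonneg _
    rcases h2.eq_or_lt with h | h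
    · rwa [← h] at h1
    · exfalso
      have h3 : ∀ n, (⨅ n, ‖D n‖) ≤ ‖D n‖ := fun n => ciInf_le
        ⟨0, by rintro _ ⟨n, rfl⟩; exact norm_nonneg _⟩ n
      have h4 : ∀ n, D n ≠ 0 := fun n => norm_pos_iff.1 (h.trans_le (h3 n))
      exact hc.not_orthonormal_eigenvectors
        ⟨fun n => (hv n).2.1 (h4 n), fun i j hij => horth.1 i j hij⟩ h h3 hTv
  refine ⟨v, horth, ?_, ?_, ?_, ?_, ?_, ?_, ?_⟩
  · intro k hk
    rw [hs] at hk
    exact (hv k).2.1 (norm_ne_zero_iff.1 hk)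
  · intro k hk
    rw [hs] at hk
    exact (hv k).1 (norm_eq_zero.1 hk)
  · intro k; rw [hs]; exact hTv k
  · rw [show singularValue T = fun n => ‖D n‖ from funext hs]
    exact hlim
  · intro n
    simp only [hs]
    rw [← hsum]
  · intro n x
    have h1 := (hD n).1.re_inner_nonneg_left x
    rw [hsum n, sub_apply, inner_sub_left, map_sub, sum_apply, sum_inner, map_sum, sub_nonneg] at h1
    refine le_trans (le_of_eq ?_) h1
    refine Finset.sum_congr rfl fun k _ => ?_
    rw [hs]
    exact (re_inner_smul_rankOne _ _ _).symm
  · intro n x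
    -- Only the component `y` of `x` orthogonal to `v 0, …, v (n - 1)` is seen by `D n`; this is why
    -- `‖x‖²` minus the Bessel sum appears in the upper bound.
    set y := x - ∑ k ∈ Finset.range n, inner ℂ (v k) x • v k with hy
    have hDy : D n y = D n x := by
      rw [hy, map_sub, map_sum, Finset.sum_eq_zero, sub_zero]
      intro i hi
      rw [map_smul, hkill n i (Finset.mem_range.1 hi), smul_zero]
    have hyn : ‖y‖ ^ 2 = ‖x‖ ^ 2 - ∑ k ∈ Finset.range n, ‖inner ℂ (v k) x‖ ^ 2 := by
      have h1 := @norm_sub_sq ℂ _ _ _ _ x (∑ k ∈ Finset.range n, inner ℂ (v k) x • v k)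
      rw [horth.norm_sum_sq, inner_sum, map_sum] at h1
      have h2 : ∀ k, RCLike.re (inner ℂ x (inner ℂ (v k) x • v k)) = ‖inner ℂ (v k) x‖ ^ 2 := by
        intro k
        rw [inner_smul_right, ← inner_conj_symm x (v k), Complex.mul_conj']
        norm_cast
      have h3 : ∀ k, ‖inner ℂ (v k) x‖ ^ 2 * ‖v k‖ ^ 2 = ‖inner ℂ (v k) x‖ ^ 2 := by
        intro k
        rcases eq_or_ne (D k) 0 with h0 | h0
        · simp [(hv k).1 h0]
        · simp [(hv k).2.1 h0]
      simp only [h2, h3] at h1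
      rw [hy, h1]; ring
    have h1 : (inner ℂ (D n x) x).re ≤ ‖D n‖ * ‖y‖ ^ 2 := by
      have h2 : inner ℂ (D n x) x = inner ℂ (D n y) y := by
        rw [← hDy, (hD n).1.inner_left_eq_inner_right, (hD n).1.inner_left_eq_inner_right, hDy]
      rw [h2]
      refine (Complex.re_le_norm _).trans ((norm_inner_le_norm _ _).trans ?_)
      rw [sq, ← mul_assoc]
      exact mul_le_mul_of_nonneg_right ((D n).le_opNorm y) (norm_nonneg _)
    rw [hsum n, sub_apply, inner_sub_left, Complex.sub_re, sum_apply, sum_inner,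
      Complex.re_sum, ← hsum n, hyn] at h1
    simp only [re_inner_smul_rankOne] at h1
    simp only [hs]
    linarith

end Spectral

/-! ### Ky Fan inequalities and singular values of `W† W` and `W W†` -/

section KyFan

variable {H : Type*} [NormedAddCommGroup H] [InnerProductSpace ℂ H] [CompleteSpace H]

theorem inner_self_eq_ofReal (x : H) : inner ℂ x x = ((‖x‖ ^ 2 : ℝ) : ℂ) := by
  rw [inner_self_eq_norm_sq_to_K]; push_cast; rfl

theorem IsSpectralSeq.mul_norm_sq {T : H →L[ℂ] H} {v : ℕ → H} (hv : IsSpectralSeq T v) (k : ℕ) :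
    singularValue T k * ‖v k‖ ^ 2 = singularValue T k := by
  rcases eq_or_ne (singularValue T k) 0 with h | h
  · rw [h, zero_mul]
  · rw [hv.norm_eq_one k h]; ring

/-- `W` maps orthonormal eigenvectors of `W† W` to orthogonal eigenvectors of `W W†` with the same
eigenvalues. Divided by the square roots of the eigenvalues they are orthonormal, and they bound the
singular values of `W W†` from below. -/
theorem singularValue_adjoint_comp_self_le (W : H →L[ℂ] H)
    (hc : IsCompactOperator (ContinuousLinearMap.adjoint W * W)) (k : ℕ) :
    singularValue (ContinuousLinearMap.adjoint W * W) k
      ≤ singularValue (W * ContinuousLinearMap.adjoint W) k := by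
  set T := ContinuousLinearMap.adjoint W * W with hTdef
  obtain ⟨v, hv⟩ := exists_isSpectralSeq (T := T)
    (ContinuousLinearMap.isPositive_adjoint_comp_self W : T.IsPositive) hc
  rcases (singularValue_nonneg T k).eq_or_lt with h | h
  · rw [← h]; exact singularValue_nonneg _ _
  have hpos : ∀ i : Fin (k + 1), 0 < singularValue T i := fun i =>
    h.trans_le (singularValue_antitone T (by omega))
  have hin : ∀ i j, inner ℂ (W (v i)) (W (v j)) = (singularValue T j : ℂ) * inner ℂ (v i) (v j) := by
    intro i j
    rw [← ContinuousLinearMap.adjoint_inner_right, ← inner_smul_right, ← hv.map_eq]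
    rfl
  have hsq : ∀ i : Fin (k + 1), Real.sqrt (singularValue T i) * Real.sqrt (singularValue T i)
    = singularValue T i := fun i => Real.mul_self_sqrt (hpos i).le
  refine le_singularValue_of_orthonormal
    (u := fun i : Fin (k + 1) => ((Real.sqrt (singularValue T i))⁻¹ : ℂ) • W (v i))
    ?_ (l := fun i => singularValue T i) ?_ h.le fun i => singularValue_antitone T (by omega)
  · rw [orthonormal_iff_ite]
    intro i j
    rw [inner_smul_left, inner_smul_right, hin]
    split_ifs with hij
    · subst hij
      rw [inner_self_eq_ofReal, hv.norm_eq_one _ (hpos i).ne', ← Complex.ofReal_inv,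
        Complex.conj_ofReal]
      have h0 : Real.sqrt (singularValue T i) ≠ 0 := (Real.sqrt_pos.2 (hpos i)).ne'
      have : (Real.sqrt (singularValue T i))⁻¹ * ((Real.sqrt (singularValue T i))⁻¹
          * (singularValue T i * 1 ^ 2)) = 1 := by
        have h1 := hsq i
        field_simp
        nlinarith
      exact_mod_cast this
    · rw [hv.orth.1 _ _ fun e => hij (Fin.ext e)]
      simp
  · intro i
    rw [map_smul, smul_comm]
    congr 1
    change W (T (v i)) = _
    rw [hv.map_eq, map_smul]

theorem singularValue_adjoint_comp_self (W : H →L[ℂ] H)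
    (hc : IsCompactOperator (ContinuousLinearMap.adjoint W * W))
    (hc' : IsCompactOperator (W * ContinuousLinearMap.adjoint W)) (k : ℕ) :
    singularValue (ContinuousLinearMap.adjoint W * W) k
      = singularValue (W * ContinuousLinearMap.adjoint W) k := by
  refine le_antisymm (singularValue_adjoint_comp_self_le W hc k) ?_
  have := singularValue_adjoint_comp_self_le (ContinuousLinearMap.adjoint W)
    (by rwa [ContinuousLinearMap.adjoint_adjoint]) k
  rwa [ContinuousLinearMap.adjoint_adjoint] at this

/-- With `P` the projection onto the first `n` eigenvectors of `R† R`, the competitor `R P` has rank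
at most `n`, and `‖R y‖² = ⟨R† R y, y⟩` is at most `s_n(R† R) ‖y‖²` for `y` in the range of `1 - P`.
-/
theorem singularValue_sq_le (R : H →L[ℂ] H)
    (hc : IsCompactOperator (ContinuousLinearMap.adjoint R * R)) (n : ℕ) :
    singularValue R n ^ 2 ≤ singularValue (ContinuousLinearMap.adjoint R * R) n := by
  set T := ContinuousLinearMap.adjoint R * R with hTdef
  obtain ⟨v, hv⟩ := exists_isSpectralSeq (T := T)
    (ContinuousLinearMap.isPositive_adjoint_comp_self R : T.IsPositive) hc
  set P : H →L[ℂ] H := ∑ k ∈ Finset.range n,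
    (1 : ℂ) • InnerProductSpace.rankOne ℂ (v k) (v k) with hP
  have hle : ‖R - R * P‖ ≤ Real.sqrt (singularValue T n) := by
    refine ContinuousLinearMap.opNorm_le_bound _ (Real.sqrt_nonneg _) fun x => ?_
    set y := x - P x with hy
    have hPx : P x = ∑ k ∈ Finset.range n, inner ℂ (v k) x • v k := by
      simp [hP, sum_apply]
    have hvy : ∀ k ∈ Finset.range n, inner ℂ (v k) y = 0 := by
      intro k hk
      rw [hy, hPx, inner_sub_right, hv.orth.inner_sum_right _ _ hk]
      rcases eq_or_ne (singularValue T k) 0 with h | h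
      · simp [hv.eq_zero k h]
      · simp [hv.norm_eq_one k h]
    have hyx : ‖y‖ ≤ ‖x‖ := by
      have h1 : inner ℂ (P x) y = 0 := by
        rw [hPx, sum_inner]
        exact Finset.sum_eq_zero fun k hk => by rw [inner_smul_left, hvy k hk, mul_zero]
      have h2 := norm_add_sq_eq_norm_sq_add_norm_sq_of_inner_eq_zero (P x) y h1
      rw [hy, add_sub_cancel, ← hy] at h2
      exact le_of_sq_le_sq (by nlinarith [mul_self_nonneg ‖P x‖]) (norm_nonneg _)
    have h1 : (R - R * P) x = R y := by rw [hy, map_sub]; rfl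
    have h2 : ‖R y‖ ^ 2 = (inner ℂ (T y) y).re := by
      have : inner ℂ (T y) y = inner ℂ (R y) (R y) := ContinuousLinearMap.adjoint_inner_left R y (R y)
      rw [this]
      exact norm_sq_eq_re_inner (𝕜 := ℂ) _
    have h3 := hv.le_sum n y
    rw [Finset.sum_eq_zero (fun k hk => by rw [hvy k hk]; simp),
      Finset.sum_eq_zero (fun k hk => by rw [hvy k hk]; simp), ← h2, zero_add, sub_zero] at h3
    rw [h1]
    refine le_of_sq_le_sq ?_ (by positivity)
    rw [mul_pow, Real.sq_sqrt (singularValue_nonneg T n)]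
    refine h3.trans (mul_le_mul_of_nonneg_left ?_ (singularValue_nonneg T n))
    gcongr
  have hs : singularValue R n ≤ ‖R - R * P‖ := singularValue_le
    ((LinearMap.rank_comp_le_right (P : H →ₗ[ℂ] H) (R : H →ₗ[ℂ] H)).trans
      (rank_sum_smul_rankOne_le v (fun _ => 1) n))
  calc singularValue R n ^ 2 ≤ Real.sqrt (singularValue T n) ^ 2 :=
        pow_le_pow_left₀ (singularValue_nonneg R n) (hs.trans hle) 2
    _ = _ := Real.sq_sqrt (singularValue_nonneg T n)

theorem IsCompactOperator.tendsto_singularValue_of_isPositive {T : H →L[ℂ] H}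
    (hc : IsCompactOperator T) (hT : T.IsPositive) : Tendsto (singularValue T) atTop (𝓝 0) := by
  obtain ⟨v, hv⟩ := exists_isSpectralSeq hT hc
  exact hv.tendsto

theorem isCompactOperator_of_adjoint_comp_self (R : H →L[ℂ] H)
    (hc : IsCompactOperator (ContinuousLinearMap.adjoint R * R)) : IsCompactOperator R := by
  refine isCompactOperator_of_tendsto_singularValue ?_
  have h1 := IsCompactOperator.tendsto_singularValue_of_isPositive hc
    (ContinuousLinearMap.isPositive_adjoint_comp_self R)
  have h2 := (Real.continuous_sqrt.tendsto 0).comp h1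
  rw [Real.sqrt_zero] at h2
  refine squeeze_zero (singularValue_nonneg R) (fun n => ?_) h2
  exact Real.le_sqrt_of_sq_le (singularValue_sq_le R hc n)

/-- The Ky Fan inequality. -/
theorem IsSpectralSeq.sum_inner_le {T : H →L[ℂ] H} {v : ℕ → H} (hv : IsSpectralSeq T v)
    {ι : Type*} {u : ι → H} (hu : SubOrthonormal u) (s : Finset ι) {n : ℕ} (hs : s.card ≤ n) :
    ∑ i ∈ s, (inner ℂ (T (u i)) (u i)).re ≤ ∑ k ∈ Finset.range n, singularValue T k := by
  -- Subtracting the level `s_n` leaves nonnegative weights `s_k - s_n`, to which Bessel's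
  -- inequality for the `u i` applies; the level itself costs at most `n s_n`, and the two
  -- contributions add up to the partial sum.
  have h1 : ∀ i, (inner ℂ (T (u i)) (u i)).re ≤ (∑ k ∈ Finset.range n,
      (singularValue T k - singularValue T n) * ‖inner ℂ (v k) (u i)‖ ^ 2)
      + singularValue T n := by
    intro i
    have h2 := hv.le_sum n (u i)
    have h3 : singularValue T n * ‖u i‖ ^ 2 ≤ singularValue T n :=
      mul_le_of_le_one_right (singularValue_nonneg T n)
        (pow_le_one₀ (norm_nonneg _) (hu.2 i))
    simp only [sub_mul, Finset.sum_sub_distrib, ← Finset.mul_sum]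
    linarith
  calc ∑ i ∈ s, (inner ℂ (T (u i)) (u i)).re
      ≤ ∑ i ∈ s, ((∑ k ∈ Finset.range n,
        (singularValue T k - singularValue T n) * ‖inner ℂ (v k) (u i)‖ ^ 2)
        + singularValue T n) := Finset.sum_le_sum fun i _ => h1 i
    _ = (∑ k ∈ Finset.range n, (singularValue T k - singularValue T n)
        * ∑ i ∈ s, ‖inner ℂ (v k) (u i)‖ ^ 2) + s.card * singularValue T n := by
      rw [Finset.sum_add_distrib, Finset.sum_comm, Finset.sum_const, nsmul_eq_mul]
      simp only [Finset.mul_sum]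
    _ ≤ (∑ k ∈ Finset.range n, (singularValue T k - singularValue T n) * 1)
        + n * singularValue T n := by
      gcongr with k hk
      · exact sub_nonneg.2 (singularValue_antitone T (Finset.mem_range.1 hk).le)
      · have h4 := hu.sum_inner_le s (v k)
        simp only [norm_inner_symm (u _) (v k)] at h4
        exact h4.trans (pow_le_one₀ (norm_nonneg _) (hv.orth.2 k))
      · exact singularValue_nonneg T n
    _ = _ := by simp [Finset.sum_sub_distrib]

theorem IsSpectralSeq.inner_map_self {T : H →L[ℂ] H} {v : ℕ → H} (hv : IsSpectralSeq T v)
    (k : ℕ) : (inner ℂ (T (v k)) (v k)).re = singularValue T k := by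
  rw [hv.map_eq, inner_smul_left, Complex.conj_ofReal, inner_self_eq_ofReal,
    ← Complex.ofReal_mul, Complex.ofReal_re, hv.mul_norm_sq]

/-- The eigenvectors of `T + S` are admissible in the Ky Fan inequality of each summand. -/
theorem sum_singularValue_add_le {T S : H →L[ℂ] H} (hT : T.IsPositive) (hS : S.IsPositive)
    (hTc : IsCompactOperator T) (hSc : IsCompactOperator S) (n : ℕ) :
    ∑ k ∈ Finset.range n, singularValue (T + S) k
      ≤ ∑ k ∈ Finset.range n, singularValue T k + ∑ k ∈ Finset.range n, singularValue S k := by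
  obtain ⟨v, hv⟩ := exists_isSpectralSeq hT hTc
  obtain ⟨w, hw⟩ := exists_isSpectralSeq hS hSc
  obtain ⟨u, hu⟩ := exists_isSpectralSeq (hT.add hS) (IsCompactOperator.add hTc hSc)
  have h1 := hv.sum_inner_le hu.orth (Finset.range n) (Finset.card_range n).le
  have h2 := hw.sum_inner_le hu.orth (Finset.range n) (Finset.card_range n).le
  refine le_trans (le_of_eq ?_) (add_le_add h1 h2)
  rw [← Finset.sum_add_distrib]
  refine Finset.sum_congr rfl fun k _ => ?_
  rw [← hu.inner_map_self, add_apply, inner_add_left, Complex.add_re]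

/-- By Parseval in `V`, the part of `T` carried by the first `n` eigenvectors has its full trace on
any subspace that contains them; the rest of `T` is positive. -/
theorem IsSpectralSeq.le_sum_inner {T : H →L[ℂ] H} {v : ℕ → H} (hv : IsSpectralSeq T v)
    {V : Submodule ℂ H} {ι : Type*} [Fintype ι] (b : OrthonormalBasis ι ℂ V) {n : ℕ}
    (hV : ∀ k < n, v k ∈ V) :
    ∑ k ∈ Finset.range n, singularValue T k ≤ ∑ i, (inner ℂ (T (b i : H)) (b i : H)).re := by
  calc ∑ k ∈ Finset.range n, singularValue T k
      = ∑ k ∈ Finset.range n, singularValue T k * ∑ i, ‖inner ℂ (v k) (b i : H)‖ ^ 2 := by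
        refine Finset.sum_congr rfl fun k hk => ?_
        have h1 := b.sum_sq_norm_inner_right ⟨v k, hV k (Finset.mem_range.1 hk)⟩
        simp only [Submodule.coe_inner, Submodule.coe_norm] at h1
        simp only [norm_inner_symm (v k)]
        rw [h1, hv.mul_norm_sq]
    _ = ∑ i, ∑ k ∈ Finset.range n, singularValue T k * ‖inner ℂ (v k) (b i : H)‖ ^ 2 := by
        simp only [Finset.mul_sum]
        rw [Finset.sum_comm]
    _ ≤ _ := Finset.sum_le_sum fun i _ => hv.sum_le n _

/-- The first `n` eigenvectors of `T` and of `S` together span a space of dimension at most `2n`.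
The trace of `T + S` on it dominates both sums and is bounded by Ky Fan. The doubling of the number
of terms is what dilation invariance of `ω` later absorbs. -/
theorem le_sum_singularValue_add {T S : H →L[ℂ] H} (hT : T.IsPositive) (hS : S.IsPositive)
    (hTc : IsCompactOperator T) (hSc : IsCompactOperator S) (n : ℕ) :
    ∑ k ∈ Finset.range n, singularValue T k + ∑ k ∈ Finset.range n, singularValue S k
      ≤ ∑ k ∈ Finset.range (2 * n), singularValue (T + S) k := by
  classical
  obtain ⟨v, hv⟩ := exists_isSpectralSeq hT hTc
  obtain ⟨w, hw⟩ := exists_isSpectralSeq hS hSc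
  obtain ⟨u, hu⟩ := exists_isSpectralSeq (hT.add hS) (IsCompactOperator.add hTc hSc)
  set s : Finset H := (Finset.range n).image v ∪ (Finset.range n).image w with hs
  have hcard : s.card ≤ 2 * n := by
    refine (Finset.card_union_le _ _).trans ?_
    have h1 := Finset.card_image_le (s := Finset.range n) (f := v)
    have h2 := Finset.card_image_le (s := Finset.range n) (f := w)
    rw [Finset.card_range] at h1 h2
    omega
  set V : Submodule ℂ H := Submodule.span ℂ (s : Set H) with hV
  have hfin : FiniteDimensional ℂ V := FiniteDimensional.span_finset ℂ s
  let b := stdOrthonormalBasis ℂ V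
  have hvV : ∀ k < n, v k ∈ V := fun k hk => Submodule.subset_span
    (by simp only [hs, Finset.coe_union, Finset.coe_image]
        exact Or.inl ⟨k, by simpa using hk, rfl⟩)
  have hwV : ∀ k < n, w k ∈ V := fun k hk => Submodule.subset_span
    (by simp only [hs, Finset.coe_union, Finset.coe_image]
        exact Or.inr ⟨k, by simpa using hk, rfl⟩)
  have hb : SubOrthonormal fun i => (b i : H) :=
    (b.orthonormal.comp_linearIsometry V.subtypeₗᵢ).subOrthonormal
  have h1 := hu.sum_inner_le hb Finset.univ (n := 2 * n)
    (by rw [Finset.card_univ, Fintype.card_fin]; exact (finrank_span_finset_le_card s).trans hcard)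
  refine (add_le_add (hv.le_sum_inner b hvV) (hw.le_sum_inner b hwV)).trans
    (le_trans (le_of_eq ?_) h1)
  rw [← Finset.sum_add_distrib]
  refine Finset.sum_congr rfl fun k _ => ?_
  rw [add_apply, inner_add_left, Complex.add_re]

end KyFan

/-! ### Nuclear sums and the trace -/

section Nuclear

variable {H : Type*} [NormedAddCommGroup H] [InnerProductSpace ℂ H] [CompleteSpace H]

/-- `T = ∑ ⟪y k, ·⟫ x k` with `∑ ‖x k‖ ‖y k‖ < ∞`. -/
structure IsNuclearSum {ι : Type*} (T : H →L[ℂ] H) (x y : ι → H) : Prop where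
  summable : Summable fun k => ‖x k‖ * ‖y k‖
  hasSum : ∀ f, HasSum (fun k => inner ℂ (y k) f • x k) (T f)

theorem SubOrthonormal.sum_mul_inner_le {ι : Type*} {v w : ι → H} (hv : SubOrthonormal v)
    (hw : SubOrthonormal w) (s : Finset ι) (x y : H) :
    ∑ k ∈ s, ‖inner ℂ (v k) x‖ * ‖inner ℂ (w k) y‖ ≤ ‖x‖ * ‖y‖ := by
  refine (Real.sum_mul_le_sqrt_mul_sqrt s _ _).trans ?_
  gcongr
  · exact Real.sqrt_le_left (norm_nonneg _) |>.2 (hv.sum_inner_le s x)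
  · exact Real.sqrt_le_left (norm_nonneg _) |>.2 (hw.sum_inner_le s y)

theorem isCompactOperator_rankOne (x y : H) :
    IsCompactOperator (InnerProductSpace.rankOne ℂ x y : H →L[ℂ] H) := by
  refine isCompactOperator_of_finiteDimensional_range ?_
  have hsub : LinearMap.range ((InnerProductSpace.rankOne ℂ x y : H →L[ℂ] H) : H →ₗ[ℂ] H)
      ≤ Submodule.span ℂ {x} := by
    rintro _ ⟨z, rfl⟩
    exact Submodule.smul_mem _ _ (Submodule.mem_span_singleton_self x)
  exact Submodule.finiteDimensional_of_le hsub

variable {ι : Type*} {T : H →L[ℂ] H} {x y : ι → H}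

theorem IsNuclearSum.hasSum_rankOne (h : IsNuclearSum T x y) :
    HasSum (fun k => (InnerProductSpace.rankOne ℂ (x k) (y k) : H →L[ℂ] H)) T := by
  have h1 : Summable fun k => (InnerProductSpace.rankOne ℂ (x k) (y k) : H →L[ℂ] H) :=
    Summable.of_norm (by simpa only [InnerProductSpace.norm_rankOne] using h.summable)
  obtain ⟨T', hT'⟩ := h1
  have : T' = T := by
    ext f
    have h2 := (ContinuousLinearMap.apply ℂ H f).hasSum hT'
    exact h2.unique (h.hasSum f)
  rwa [this] at hT'

theorem IsNuclearSum.isCompactOperator (h : IsNuclearSum T x y) : IsCompactOperator T := by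
  refine isCompactOperator_of_tendsto h.hasSum_rankOne (Eventually.of_forall fun s => ?_)
  exact (compactOperator (RingHom.id ℂ) H H).sum_mem
    (f := fun k => (InnerProductSpace.rankOne ℂ (x k) (y k) : H →L[ℂ] H))
    fun k _ => isCompactOperator_rankOne _ _

/-- Let `v k` be eigenvectors of `T† T`, `c k` the square roots of the eigenvalues, and `w k = T (v
k) / c k`. Then `s_k(T) ≤ c k = ⟨w k, T (v k)⟩`. Inserting the series for `T` and summing over `k`,
Cauchy–Schwarz and Bessel bound the `j`-th term by `‖x j‖ ‖y j‖`. -/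
theorem IsNuclearSum.sum_singularValue_le (h : IsNuclearSum T x y) (n : ℕ) :
    ∑ k ∈ Finset.range n, singularValue T k ≤ ∑' j, ‖x j‖ * ‖y j‖ := by
  set S := ContinuousLinearMap.adjoint T * T with hS
  have hc : IsCompactOperator S :=
    IsCompactOperator.clm_comp (f := T) h.isCompactOperator (ContinuousLinearMap.adjoint T)
  obtain ⟨v, hv⟩ := exists_isSpectralSeq (T := S)
    (ContinuousLinearMap.isPositive_adjoint_comp_self T) hc
  set c : ℕ → ℝ := fun k => Real.sqrt (singularValue S k) with hcdef
  have hcc : ∀ k, c k * c k = singularValue S k :=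
    fun k => Real.mul_self_sqrt (singularValue_nonneg S k)
  have hin : ∀ i j, inner ℂ (T (v i)) (T (v j)) = (singularValue S j : ℂ) * inner ℂ (v i) (v j) := by
    intro i j
    rw [← ContinuousLinearMap.adjoint_inner_right, ← inner_smul_right, ← hv.map_eq]
    rfl
  have hnorm : ∀ k, inner ℂ (T (v k)) (T (v k)) = ((c k * c k : ℝ) : ℂ) := by
    intro k
    rw [hin, inner_self_eq_ofReal, ← Complex.ofReal_mul, hv.mul_norm_sq, hcc]
  -- Where `c k = 0` the inverse is zero and so is `w k`; the family is only sub-orthonormal, which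
  -- is all that Bessel's inequality needs.
  set w : ℕ → H := fun k => ((c k)⁻¹ : ℂ) • T (v k) with hw
  have hwo : SubOrthonormal w := by
    refine ⟨fun i j hij => ?_, fun i => ?_⟩
    · simp only [hw]
      rw [inner_smul_left, inner_smul_right, hin, hv.orth.1 i j hij]
      simp
    · have h1 := hnorm i
      rw [inner_self_eq_ofReal] at h1
      have h2 : ‖T (v i)‖ ^ 2 = c i * c i := Complex.ofReal_injective h1
      have h3 : ‖T (v i)‖ = c i := by
        refine (pow_left_inj₀ (norm_nonneg _) (Real.sqrt_nonneg _) two_ne_zero).1 ?_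
        rw [h2, sq]
      simp only [hw]
      rw [norm_smul, norm_inv, Complex.norm_real, h3, Real.norm_of_nonneg (Real.sqrt_nonneg _)]
      exact inv_mul_le_one
  have hwT : ∀ k, (inner ℂ (w k) (T (v k))) = (c k : ℂ) := by
    intro k
    simp only [hw]
    rw [inner_smul_left, hnorm, ← Complex.ofReal_inv, Complex.conj_ofReal, ← Complex.ofReal_mul]
    congr 1
    rcases eq_or_ne (c k) 0 with h0 | h0
    · rw [h0]; simp
    · field_simp
  have hsum : HasSum (fun j => ∑ k ∈ Finset.range n, inner ℂ (y j) (v k) * inner ℂ (w k) (x j))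
      (∑ k ∈ Finset.range n, (c k : ℂ)) := by
    refine hasSum_sum fun k _ => ?_
    rw [← hwT k]
    have h1 := (innerSL ℂ (w k)).hasSum (h.hasSum (v k))
    simpa [inner_smul_right] using h1
  have hb : ∀ j, ‖∑ k ∈ Finset.range n, inner ℂ (y j) (v k) * inner ℂ (w k) (x j)‖
      ≤ ‖x j‖ * ‖y j‖ := by
    intro j
    refine (norm_sum_le _ _).trans ?_
    have h1 := hwo.sum_mul_inner_le hv.orth (Finset.range n) (x j) (y j)
    refine le_trans (le_of_eq (Finset.sum_congr rfl fun k _ => ?_)) h1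
    rw [norm_mul, norm_inner_symm (y j), mul_comm]
  have hle := hsum.norm_le_of_bounded h.summable.hasSum hb
  refine le_trans (Finset.sum_le_sum (g := c) fun k _ => ?_) ((le_of_eq ?_).trans hle)
  · exact Real.le_sqrt_of_sq_le (singularValue_sq_le T hc k)
  · rw [← Complex.ofReal_sum, Complex.norm_real, Real.norm_of_nonneg]
    exact Finset.sum_nonneg fun k _ => Real.sqrt_nonneg _

theorem IsNuclearSum.isTraceClass (h : IsNuclearSum T x y) : IsTraceClass T :=
  ⟨h.isCompactOperator, summable_of_sum_range_le (singularValue_nonneg T)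
    h.sum_singularValue_le⟩

/-- Fubini and Parseval: the double family over the series and the basis is absolutely summable, by
Cauchy–Schwarz and Bessel in the basis index. -/
theorem IsNuclearSum.opTrace_eq (h : IsNuclearSum T x y) :
    opTrace T = ∑' k, inner ℂ (y k) (x k) := by
  set b := someBasis H
  have hb : SubOrthonormal b := b.orthonormal.subOrthonormal
  have hle : ∀ j (s : Finset (someBasisIndex H)),
      ∑ i ∈ s, ‖inner ℂ (y j) (b i) * inner ℂ (b i) (x j)‖ ≤ ‖x j‖ * ‖y j‖ := by
    intro j s
    refine le_trans (le_of_eq (Finset.sum_congr rfl fun k _ => ?_))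
      (hb.sum_mul_inner_le hb s (x j) (y j))
    rw [norm_mul, norm_inner_symm (y j), mul_comm]
  have hs : ∀ j, Summable fun i => ‖inner ℂ (y j) (b i) * inner ℂ (b i) (x j)‖ := fun j =>
    summable_of_sum_le (fun _ => norm_nonneg _) (hle j)
  have hS : Summable fun p : ι × someBasisIndex H =>
      inner ℂ (y p.1) (b p.2) * inner ℂ (b p.2) (x p.1) := by
    refine Summable.of_norm ?_
    rw [summable_prod_of_nonneg fun _ => norm_nonneg _]
    refine ⟨hs, ?_⟩
    exact Summable.of_nonneg_of_le (fun j => tsum_nonneg fun _ => norm_nonneg _)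
      (fun j => (hs j).tsum_le_of_sum_le (hle j)) h.summable
  have h1 : ∀ i, inner ℂ (b i) (T (b i)) = ∑' j, inner ℂ (y j) (b i) * inner ℂ (b i) (x j) := by
    intro i
    have h2 := (innerSL ℂ (b i)).hasSum (h.hasSum (b i))
    simp only [innerSL_apply_apply, inner_smul_right] at h2
    exact h2.tsum_eq.symm
  unfold opTrace
  rw [tsum_congr h1, tsum_congr fun k => (b.tsum_inner_mul_inner (y k) (x k)).symm]
  exact Summable.tsum_comm (f := fun j i => inner ℂ (y j) (b i) * inner ℂ (b i) (x j)) hS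

end Nuclear

/-! ### Karamata's Tauberian theorem -/

section Karamata

variable {s : ℕ → ℝ} {L : ℝ}

theorem summable_mul_of_continuousOn (hs0 : ∀ k, 0 ≤ s k) (hs1 : ∀ k, s k ≤ 1)
    (hsum : ∀ q : ℝ, 0 < q → Summable fun k => s k ^ (1 + q)) {φ : ℝ → ℝ}
    (hφ : ContinuousOn φ (Set.Icc 0 1)) {q : ℝ} (hq : 0 < q) :
    Summable fun k => s k ^ (1 + q) * φ (s k ^ q) := by
  obtain ⟨C, hC⟩ := isCompact_Icc.exists_bound_of_continuousOn hφ
  refine Summable.of_norm_bounded ((hsum q hq).mul_right C) fun k => ?_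
  rw [norm_mul, Real.norm_of_nonneg (Real.rpow_nonneg (hs0 k) _)]
  exact mul_le_mul_of_nonneg_left
    (hC _ ⟨Real.rpow_nonneg (hs0 k) _, Real.rpow_le_one (hs0 k) (hs1 k) hq.le⟩)
    (Real.rpow_nonneg (hs0 k) _)

/-- For `u^m` the summand is `s_k ^ (1 + (m + 1) q)`. Replacing `q` by `(m + 1) q` in the hypothesis
gives `L / (m + 1)`, which is `L` times the integral of `u^m`. -/
theorem tendsto_karamata_polynomial (hs0 : ∀ k, 0 ≤ s k) (hs1 : ∀ k, s k ≤ 1)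
    (hsum : ∀ q : ℝ, 0 < q → Summable fun k => s k ^ (1 + q))
    (hL : Tendsto (fun q : ℝ => q * ∑' k, s k ^ (1 + q)) (𝓝[>] 0) (𝓝 L)) (P : Polynomial ℝ) :
    Tendsto (fun q : ℝ => q * ∑' k, s k ^ (1 + q) * P.eval (s k ^ q)) (𝓝[>] 0)
      (𝓝 (L * ∫ u in (0 : ℝ)..1, P.eval u)) := by
  induction P using Polynomial.induction_on' with
  | add P Q hP hQ =>
    have h := hP.add hQ
    rw [← mul_add, ← intervalIntegral.integral_add (P.continuous.intervalIntegrable _ _)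
      (Q.continuous.intervalIntegrable _ _)] at h
    simp only [Polynomial.eval_add]
    refine h.congr' ?_
    filter_upwards [self_mem_nhdsWithin] with q hq
    rw [← mul_add, ← (summable_mul_of_continuousOn hs0 hs1 hsum P.continuousOn hq).tsum_add
      (summable_mul_of_continuousOn hs0 hs1 hsum Q.continuousOn hq)]
    simp only [mul_add]
  | monomial m a =>
    have hm : (0 : ℝ) < m + 1 := by positivity
    have h1 : Tendsto (fun q : ℝ => ((m : ℝ) + 1) * q) (𝓝[>] 0) (𝓝[>] 0) := by
      refine tendsto_nhdsWithin_iff.2 ⟨?_, ?_⟩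
      · have : Tendsto (fun q : ℝ => ((m : ℝ) + 1) * q) (𝓝 0) (𝓝 (((m : ℝ) + 1) * 0)) :=
          (continuous_const_mul _).tendsto 0
        rw [mul_zero] at this
        exact this.mono_left nhdsWithin_le_nhds
      · filter_upwards [self_mem_nhdsWithin] with q hq
        exact mul_pos hm hq
    have h2 := (hL.comp h1).mul_const (a / ((m : ℝ) + 1))
    have h3 : ∫ u in (0 : ℝ)..1, (Polynomial.monomial m a).eval u = a / ((m : ℝ) + 1) := by
      simp only [Polynomial.eval_monomial]
      rw [intervalIntegral.integral_const_mul, integral_pow]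
      simp; ring
    rw [h3]
    refine h2.congr' ?_
    filter_upwards [self_mem_nhdsWithin] with q hq
    have hq : 0 < q := hq
    have h4 : ∀ k, s k ^ (1 + q) * (Polynomial.monomial m a).eval (s k ^ q)
        = s k ^ (1 + ((m : ℝ) + 1) * q) * a := by
      intro k
      have h5 : s k ^ (1 + ((m : ℝ) + 1) * q) = s k ^ (1 + q) * (s k ^ q) ^ m := by
        rw [← Real.rpow_mul_natCast (hs0 k), ← Real.rpow_add' (hs0 k) (by positivity)]
        congr 1; ring
      rw [Polynomial.eval_monomial, h5]; ring
    simp only [h4, Function.comp_apply, tsum_mul_right]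
    field_simp

/-- Weierstrass approximation extends the polynomial case: a uniform error `δ` on `[0, 1]` costs at
most `δ` times `q ∑ s_k ^ (1 + q)`, which stays bounded as `q → 0`. -/
theorem tendsto_karamata (hs0 : ∀ k, 0 ≤ s k) (hs1 : ∀ k, s k ≤ 1)
    (hsum : ∀ q : ℝ, 0 < q → Summable fun k => s k ^ (1 + q))
    (hL : Tendsto (fun q : ℝ => q * ∑' k, s k ^ (1 + q)) (𝓝[>] 0) (𝓝 L)) {φ : ℝ → ℝ}
    (hφ : ContinuousOn φ (Set.Icc 0 1)) :
    Tendsto (fun q : ℝ => q * ∑' k, s k ^ (1 + q) * φ (s k ^ q)) (𝓝[>] 0)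
      (𝓝 (L * ∫ u in (0 : ℝ)..1, φ u)) := by
  rw [Metric.tendsto_nhds]
  intro ε hε
  -- The errors are `δ` from the polynomial limit, `|L| δ` from the integrals and `(|L| + 1) δ` from
  -- the sums; `2|L| + 3` exceeds the total factor.
  set δ := ε / (2 * |L| + 3) with hδ
  have hδ0 : 0 < δ := by positivity
  obtain ⟨P, hP⟩ := exists_polynomial_near_of_continuousOn 0 1 φ hφ δ hδ0
  have h1 := Metric.tendsto_nhds.1 (tendsto_karamata_polynomial hs0 hs1 hsum hL P) δ hδ0
  have h2 := Metric.tendsto_nhds.1 hL 1 one_pos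
  filter_upwards [h1, h2, self_mem_nhdsWithin] with q hq1 hq2 hq0
  have hq0 : 0 < q := hq0
  rw [Real.dist_eq] at hq1 hq2 ⊢
  have hint : |(∫ u in (0 : ℝ)..1, P.eval u) - ∫ u in (0 : ℝ)..1, φ u| ≤ δ := by
    rw [← intervalIntegral.integral_sub (P.continuous.intervalIntegrable _ _)
      (ContinuousOn.intervalIntegrable (by rwa [Set.uIcc_of_le zero_le_one]))]
    have := intervalIntegral.norm_integral_le_of_norm_le_const (a := (0 : ℝ)) (b := 1)
      (f := fun u => P.eval u - φ u) (C := δ) (fun u hu => by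
        rw [Set.uIoc_of_le zero_le_one] at hu
        exact (hP u ⟨hu.1.le, hu.2⟩).le)
    simpa using this
  have hdiff : |q * (∑' k, s k ^ (1 + q) * P.eval (s k ^ q))
      - q * ∑' k, s k ^ (1 + q) * φ (s k ^ q)| ≤ δ * (q * ∑' k, s k ^ (1 + q)) := by
    rw [← mul_sub, ← (summable_mul_of_continuousOn hs0 hs1 hsum P.continuousOn hq0).tsum_sub
      (summable_mul_of_continuousOn hs0 hs1 hsum hφ hq0), abs_mul, abs_of_pos hq0, mul_left_comm,
      ← tsum_mul_left]
    refine mul_le_mul_of_nonneg_left ?_ hq0.le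
    rw [← Real.norm_eq_abs]
    refine tsum_of_norm_bounded ((hsum q hq0).mul_left δ).hasSum fun k => ?_
    rw [← mul_sub, norm_mul, Real.norm_of_nonneg (Real.rpow_nonneg (hs0 k) _), mul_comm]
    exact mul_le_mul_of_nonneg_right
      (hP _ ⟨Real.rpow_nonneg (hs0 k) _, Real.rpow_le_one (hs0 k) (hs1 k) hq0.le⟩).le
      (Real.rpow_nonneg (hs0 k) _)
  have hZ : q * ∑' k, s k ^ (1 + q) ≤ |L| + 1 := by
    have := abs_sub_lt_iff.1 hq2
    have := le_abs_self L
    linarith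
  have h3 : |L * (∫ u in (0 : ℝ)..1, P.eval u) - L * ∫ u in (0 : ℝ)..1, φ u| ≤ |L| * δ := by
    rw [← mul_sub, abs_mul]
    gcongr
  have h4 : δ * (q * ∑' k, s k ^ (1 + q)) ≤ δ * (|L| + 1) := by gcongr
  have h5 : δ * (2 * |L| + 3) = ε := by rw [hδ]; field_simp
  have h6 := abs_lt.1 hq1
  have h7 := abs_le.1 hdiff
  have h8 := abs_le.1 h3
  rw [abs_lt]
  constructor <;> nlinarith [abs_nonneg L]

/-- The test function is a continuous majorant of `u⁻¹` cut off to `[c, 1]`, with a steep polynomial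
ramp on `[0, c]`; the ramp contributes only `1 / (M + 1)`. -/
theorem integral_upper_test {c : ℝ} (hc0 : 0 < c) (hc1 : c ≤ 1) (M : ℕ) :
    ∫ u in (0 : ℝ)..1, (max u c)⁻¹ * (min u c / c) ^ M = 1 / ((M : ℝ) + 1) - Real.log c := by
  have hcont : Continuous fun u : ℝ => (max u c)⁻¹ * (min u c / c) ^ M := by
    refine Continuous.mul (Continuous.inv₀ (by fun_prop) fun u => ?_) (by fun_prop)
    exact (lt_max_of_lt_right hc0).ne'
  rw [← intervalIntegral.integral_add_adjacent_intervals (b := c)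
    (hcont.intervalIntegrable _ _) (hcont.intervalIntegrable _ _)]
  have h1 : ∫ u in (0 : ℝ)..c, (max u c)⁻¹ * (min u c / c) ^ M
      = ∫ u in (0 : ℝ)..c, c⁻¹ * c⁻¹ ^ M * u ^ M := by
    refine intervalIntegral.integral_congr fun u hu => ?_
    rw [Set.uIcc_of_le hc0.le] at hu
    simp only [max_eq_right hu.2, min_eq_left hu.2, div_eq_mul_inv, mul_pow]
    ring
  have h2 : ∫ u in c..(1 : ℝ), (max u c)⁻¹ * (min u c / c) ^ M = ∫ u in c..(1 : ℝ), u⁻¹ := by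
    refine intervalIntegral.integral_congr fun u hu => ?_
    rw [Set.uIcc_of_le hc1] at hu
    simp only [max_eq_left hu.1, min_eq_right hu.1, div_self hc0.ne', one_pow, mul_one]
  rw [h1, h2, intervalIntegral.integral_const_mul, integral_pow,
    integral_inv_of_pos hc0 one_pos, Real.log_div one_ne_zero hc0.ne', Real.log_one]
  rw [zero_pow (Nat.succ_ne_zero M), pow_succ, inv_pow]
  have := pow_ne_zero M hc0.ne'
  field_simp
  ring

/-- The test function vanishes on `[0, c]` and is a continuous minorant of `u⁻¹` on `[c, 1]`; its
loss against the cut-off is at most `1 / M`. -/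
theorem integral_lower_test {c : ℝ} (hc0 : 0 < c) (hc1 : c ≤ 1) {M : ℕ} (hM : 0 < M) :
    - Real.log c - 1 / (M : ℝ)
      ≤ ∫ u in (0 : ℝ)..1, (max u c)⁻¹ * (1 - (c / max u c) ^ M) := by
  have hcont : Continuous fun u : ℝ => (max u c)⁻¹ * (1 - (c / max u c) ^ M) := by
    have h0 : ∀ u : ℝ, max u c ≠ 0 := fun u => (lt_max_of_lt_right hc0).ne'
    refine Continuous.mul (Continuous.inv₀ (by fun_prop) h0)
      (continuous_const.sub (Continuous.pow (Continuous.div₀ (by fun_prop) (by fun_prop) h0) _))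
  rw [← intervalIntegral.integral_add_adjacent_intervals (b := c)
    (hcont.intervalIntegrable _ _) (hcont.intervalIntegrable _ _)]
  have h1 : ∫ u in (0 : ℝ)..c, (max u c)⁻¹ * (1 - (c / max u c) ^ M)
      = ∫ u in (0 : ℝ)..c, 0 := by
    refine intervalIntegral.integral_congr fun u hu => ?_
    rw [Set.uIcc_of_le hc0.le] at hu
    simp only [max_eq_right hu.2, div_self hc0.ne', one_pow, sub_self, mul_zero]
  have hderiv : ∀ u ∈ Set.uIcc c 1, HasDerivAt
      (fun u : ℝ => Real.log u + c ^ M / M * (u ^ M)⁻¹)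
      ((max u c)⁻¹ * (1 - (c / max u c) ^ M)) u := by
    intro u hu
    rw [Set.uIcc_of_le hc1] at hu
    have hu0 : u ≠ 0 := (hc0.trans_le hu.1).ne'
    have hd := (Real.hasDerivAt_log hu0).add
      (((hasDerivAt_pow M u).inv (pow_ne_zero M hu0)).const_mul (c ^ M / M))
    refine HasDerivAt.congr_deriv hd ?_
    rw [max_eq_left hu.1]
    obtain ⟨m, rfl⟩ : ∃ m, M = m + 1 := ⟨M - 1, by omega⟩
    have : ((m + 1 : ℕ) : ℝ) ≠ 0 := by positivity
    simp only [Nat.add_sub_cancel, div_pow]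
    field_simp
    ring
  rw [h1, intervalIntegral.integral_zero, zero_add,
    intervalIntegral.integral_eq_sub_of_hasDerivAt hderiv (hcont.intervalIntegrable _ _)]
  have hM' : (0 : ℝ) < M := by exact_mod_cast hM
  have h2 : c ^ M / M * (c ^ M)⁻¹ = 1 / (M : ℝ) := by
    have : c ^ M ≠ 0 := (pow_pos hc0 M).ne'
    field_simp
  have h3 : 0 ≤ c ^ M / M * ((1 : ℝ) ^ M)⁻¹ := by positivity
  rw [h2, Real.log_one]
  linarith

end Karamata

/-! ### From power sums to logarithmic means -/

section Karamata

variable {s : ℕ → ℝ} {L : ℝ}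

theorem tendsto_log_nat_add_two : Tendsto (fun n : ℕ => Real.log ((n : ℝ) + 2)) atTop atTop :=
  Real.tendsto_log_atTop.comp (tendsto_atTop_add_const_right _ _ tendsto_natCast_atTop_atTop)

theorem log_nat_add_two_pos (n : ℕ) : 0 < Real.log ((n : ℝ) + 2) :=
  Real.log_pos (by have := Nat.cast_nonneg (α := ℝ) n; linarith)

/-- With `q = 1 / log (n + 2)` the threshold `s_k ≥ 1 / (n + 2)` reads `s_k ^ q ≥ e⁻¹`. Above it the
factor `u⁻¹` of the test function turns `s_k ^ (1 + q)` back into `s_k`; the remaining terms among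
the first `n + 1` sum to at most `1`, negligible against the logarithm. -/
theorem eventually_sum_div_log_lt (hs0 : ∀ k, 0 ≤ s k) (hs1 : ∀ k, s k ≤ 1)
    (hsum : ∀ q : ℝ, 0 < q → Summable fun k => s k ^ (1 + q)) (hL0 : 0 ≤ L)
    (hL : Tendsto (fun q : ℝ => q * ∑' k, s k ^ (1 + q)) (𝓝[>] 0) (𝓝 L)) {δ : ℝ} (hδ : 0 < δ) :
    ∀ᶠ n : ℕ in atTop,
      (∑ k ∈ Finset.range (n + 1), s k) / Real.log ((n : ℝ) + 2) < L + δ := by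
  -- Chosen so that the ramp of the test function costs `L / (M + 1) < δ / 2`.
  obtain ⟨M, hM⟩ := exists_nat_gt (L * 3 / δ)
  set c := Real.exp (-1) with hc
  have hc0 : 0 < c := Real.exp_pos _
  have hc1 : c ≤ 1 := Real.exp_le_one_iff.2 (by norm_num)
  set g : ℝ → ℝ := fun u => (max u c)⁻¹ * (min u c / c) ^ M with hg
  have hgc : Continuous g := by
    refine Continuous.mul (Continuous.inv₀ (by fun_prop) fun u => ?_) (by fun_prop)
    exact (lt_max_of_lt_right hc0).ne'
  have hint : ∫ u in (0 : ℝ)..1, g u = 1 / ((M : ℝ) + 1) + 1 := by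
    rw [hg, integral_upper_test hc0 hc1 M, hc, Real.log_exp]; ring
  have hq : Tendsto (fun n : ℕ => (Real.log ((n : ℝ) + 2))⁻¹) atTop (𝓝[>] 0) :=
    tendsto_inv_atTop_nhdsGT_zero.comp tendsto_log_nat_add_two
  have h1 := (tendsto_karamata hs0 hs1 hsum hL hgc.continuousOn).comp hq
  rw [hint] at h1
  have h2 : L * (1 / ((M : ℝ) + 1) + 1) < L + δ / 2 := by
    have : L * (1 / ((M : ℝ) + 1)) < δ / 2 := by
      rw [mul_one_div, div_lt_iff₀ (by positivity)]
      rw [div_lt_iff₀ hδ] at hM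
      nlinarith
    linarith
  have h3 : Tendsto (fun n : ℕ => (Real.log ((n : ℝ) + 2))⁻¹) atTop (𝓝 0) :=
    hq.mono_right nhdsWithin_le_nhds
  filter_upwards [h1.eventually_lt_const h2, h3.eventually_lt_const (half_pos hδ)] with n hn1 hn2
  have hl := log_nat_add_two_pos n
  set q := (Real.log ((n : ℝ) + 2))⁻¹ with hqdef
  have hq0 : 0 < q := inv_pos.2 hl
  simp only [Function.comp_apply, ← hqdef] at hn1
  have hn : (0 : ℝ) < (n : ℝ) + 2 := by positivity
  have hnn : ∀ k, 0 ≤ s k ^ (1 + q) * g (s k ^ q) := by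
    intro k
    have := hs0 k
    have h0 : 0 ≤ min (s k ^ q) c := le_min (by positivity) hc0.le
    have h0' : 0 ≤ max (s k ^ q) c := hc0.le.trans (le_max_right _ _)
    positivity
  have hterm : ∀ k, s k ≤ s k ^ (1 + q) * g (s k ^ q) + ((n : ℝ) + 2)⁻¹ := by
    intro k
    rcases le_or_gt ((n : ℝ) + 2)⁻¹ (s k) with h | h
    · have hsk : 0 < s k := (inv_pos.2 hn).trans_le h
      have h4 : c ≤ s k ^ q := by
        have : (((n : ℝ) + 2)⁻¹) ^ q = c := by
          rw [Real.rpow_def_of_pos (inv_pos.2 hn), Real.log_inv, hqdef, neg_mul,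
            mul_inv_cancel₀ hl.ne']
        rw [← this]
        exact Real.rpow_le_rpow (inv_pos.2 hn).le h hq0.le
      have h5 : s k ^ (1 + q) * g (s k ^ q) = s k := by
        simp only [hg, max_eq_left h4, min_eq_right h4, div_self hc0.ne', one_pow, mul_one]
        rw [Real.rpow_add hsk, Real.rpow_one, mul_assoc,
          mul_inv_cancel₀ (Real.rpow_pos_of_pos hsk q).ne', mul_one]
      rw [h5]
      have := inv_pos.2 hn
      linarith
    · have := hnn k
      linarith
  have hsumle : ∑ k ∈ Finset.range (n + 1), s k ≤ (∑' k, s k ^ (1 + q) * g (s k ^ q)) + 1 := by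
    refine (Finset.sum_le_sum fun k _ => hterm k).trans ?_
    rw [Finset.sum_add_distrib]
    refine add_le_add ((summable_mul_of_continuousOn hs0 hs1 hsum hgc.continuousOn
      hq0).sum_le_tsum _ fun k _ => hnn k) ?_
    rw [Finset.sum_const, Finset.card_range, nsmul_eq_mul, ← div_eq_mul_inv, div_le_one hn]
    push_cast
    linarith
  rw [div_eq_inv_mul]
  calc q * ∑ k ∈ Finset.range (n + 1), s k
      ≤ q * ((∑' k, s k ^ (1 + q) * g (s k ^ q)) + 1) := by gcongr
    _ < L + δ := by rw [mul_add]; linarith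

/-- The lower test function must vanish on all terms beyond the `n`-th. Monotonicity and convergence
of `∑ s_k ^ (1 + ε)` force `s_k ≤ (n + 2) ^ (-(1 - ε))` there, so `q = 1 / ((1 - ε) log (n + 2))`
places these terms at `s_k ^ q ≤ e⁻¹`. -/
theorem eventually_lt_sum_div_log (hs0 : ∀ k, 0 ≤ s k) (hs1 : ∀ k, s k ≤ 1) (hs : Antitone s)
    (hsum : ∀ q : ℝ, 0 < q → Summable fun k => s k ^ (1 + q)) (hL0 : 0 ≤ L)
    (hL : Tendsto (fun q : ℝ => q * ∑' k, s k ^ (1 + q)) (𝓝[>] 0) (𝓝 L)) {δ : ℝ} (hδ : 0 < δ) :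
    ∀ᶠ n : ℕ in atTop,
      L - δ < (∑ k ∈ Finset.range (n + 1), s k) / Real.log ((n : ℝ) + 2) := by
  -- The final bound is `(1 - ε) (L (1 - ε) - ε)`, which is at least `L - ε (2L + 1)`.
  obtain ⟨ε, hε0, hε1, hεδ⟩ : ∃ ε : ℝ, 0 < ε ∧ ε < 1 ∧ ε * (2 * L + 1) < δ := by
    refine ⟨min (1 / 2) (δ / (2 * (2 * L + 1))), by positivity,
      (min_le_left _ _).trans_lt (by norm_num), ?_⟩
    calc min (1 / 2) (δ / (2 * (2 * L + 1))) * (2 * L + 1)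
        ≤ δ / (2 * (2 * L + 1)) * (2 * L + 1) := by gcongr; exact min_le_right _ _
      _ = δ / 2 := by field_simp
      _ < δ := by linarith
  obtain ⟨M, hM⟩ := exists_nat_gt (1 / ε)
  have hM0 : 0 < M := by
    have : (0 : ℝ) < M := lt_trans (by positivity) hM
    exact_mod_cast this
  set c := Real.exp (-1) with hc
  have hc0 : 0 < c := Real.exp_pos _
  have hc1 : c ≤ 1 := Real.exp_le_one_iff.2 (by norm_num)
  set g : ℝ → ℝ := fun u => (max u c)⁻¹ * (1 - (c / max u c) ^ M) with hg
  have hgc : Continuous g := by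
    have h0 : ∀ u : ℝ, max u c ≠ 0 := fun u => (lt_max_of_lt_right hc0).ne'
    exact Continuous.mul (Continuous.inv₀ (by fun_prop) h0)
      (continuous_const.sub (Continuous.pow (Continuous.div₀ (by fun_prop) (by fun_prop) h0) _))
  have hint : 1 - ε ≤ ∫ u in (0 : ℝ)..1, g u := by
    have h1 := integral_lower_test hc0 hc1 hM0
    rw [hc, Real.log_exp, ← hc] at h1
    have h2 : 1 / (M : ℝ) ≤ ε := by
      rw [div_le_iff₀ (by exact_mod_cast hM0)]
      rw [div_lt_iff₀ hε0] at hM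
      linarith
    linarith
  have h1ε : 0 < 1 - ε := by linarith
  have hq : Tendsto (fun n : ℕ => ((1 - ε) * Real.log ((n : ℝ) + 2))⁻¹) atTop (𝓝[>] 0) :=
    tendsto_inv_atTop_nhdsGT_zero.comp (tendsto_log_nat_add_two.const_mul_atTop h1ε)
  have h1 := (tendsto_karamata hs0 hs1 hsum hL hgc.continuousOn).comp hq
  have h2 : L * (1 - ε) - ε < L * ∫ u in (0 : ℝ)..1, g u := by
    have := mul_le_mul_of_nonneg_left hint hL0
    linarith
  -- A term `s_k > (n + 2) ^ (-(1 - ε))` with `k > n` would force the sum of `s_i ^ (1 + ε)` to be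
  -- at least `(n + 2) ^ (1 - (1 - ε)(1 + ε)) = (n + 2) ^ (ε²)`.
  have h3 : Tendsto (fun n : ℕ => ((n : ℝ) + 2) ^ (ε ^ 2)) atTop atTop :=
    (tendsto_rpow_atTop (by positivity)).comp
      (tendsto_atTop_add_const_right _ _ tendsto_natCast_atTop_atTop)
  filter_upwards [h1.eventually_const_lt h2, h3.eventually_gt_atTop (∑' k, s k ^ (1 + ε))]
    with n hn1 hn2
  have hl := log_nat_add_two_pos n
  set q := ((1 - ε) * Real.log ((n : ℝ) + 2))⁻¹ with hqdef
  have hq0 : 0 < q := inv_pos.2 (by positivity)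
  simp only [Function.comp_apply, ← hqdef] at hn1
  have hn : (0 : ℝ) < (n : ℝ) + 2 := by positivity
  have htail : ∀ k ∉ Finset.range (n + 1), s k ^ (1 + q) * g (s k ^ q) = 0 := by
    intro k hk
    have hk : n + 1 ≤ k := by simpa using hk
    have h4 : ((n : ℝ) + 2) * s k ^ (1 + ε) ≤ ∑' k, s k ^ (1 + ε) := by
      calc ((n : ℝ) + 2) * s k ^ (1 + ε) ≤ ∑ i ∈ Finset.range (k + 1), s k ^ (1 + ε) := by
            rw [Finset.sum_const, Finset.card_range, nsmul_eq_mul]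
            have : (n : ℝ) + 1 ≤ k := by exact_mod_cast hk
            have := Real.rpow_nonneg (hs0 k) (1 + ε)
            push_cast
            exact mul_le_mul_of_nonneg_right (by linarith) this
        _ ≤ ∑ i ∈ Finset.range (k + 1), s i ^ (1 + ε) := by
            refine Finset.sum_le_sum fun i hi => ?_
            exact Real.rpow_le_rpow (hs0 k) (hs (by simpa [Nat.lt_succ_iff] using hi)) (by positivity)
        _ ≤ _ := (hsum ε hε0).sum_le_tsum _ fun i _ => Real.rpow_nonneg (hs0 i) _
    have h5 : s k ≤ ((n : ℝ) + 2) ^ (-(1 - ε)) := by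
      by_contra! hcon
      have h6 : (((n : ℝ) + 2) ^ (-(1 - ε))) ^ (1 + ε) ≤ s k ^ (1 + ε) :=
        Real.rpow_le_rpow (Real.rpow_nonneg hn.le _) hcon.le (by positivity)
      have h7 : ((n : ℝ) + 2) * (((n : ℝ) + 2) ^ (-(1 - ε))) ^ (1 + ε)
          = ((n : ℝ) + 2) ^ (ε ^ 2) := by
        nth_rewrite 1 [← Real.rpow_one ((n : ℝ) + 2)]
        rw [← Real.rpow_mul hn.le, ← Real.rpow_add hn]
        congr 1; ring
      have h8 := mul_le_mul_of_nonneg_left h6 hn.le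
      linarith
    have h6 : s k ^ q ≤ c := by
      have h7 : (((n : ℝ) + 2) ^ (-(1 - ε))) ^ q = c := by
        rw [← Real.rpow_mul hn.le, Real.rpow_def_of_pos hn, hc, hqdef]
        congr 1
        field_simp
      rw [← h7]
      exact Real.rpow_le_rpow (hs0 k) h5 hq0.le
    simp only [hg, max_eq_right h6, div_self hc0.ne', one_pow, sub_self, mul_zero]
  have hterm : ∀ k, s k ^ (1 + q) * g (s k ^ q) ≤ s k := by
    intro k
    have hu : 0 ≤ s k ^ q := Real.rpow_nonneg (hs0 k) _
    have hm : 0 < max (s k ^ q) c := lt_max_of_lt_right hc0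
    rw [Real.rpow_add' (hs0 k) (by positivity), Real.rpow_one, mul_assoc]
    refine mul_le_of_le_one_right (hs0 k) ?_
    simp only [hg]
    rw [← mul_assoc]
    refine mul_le_one₀ ?_ ?_ ?_
    · rw [← div_eq_mul_inv, div_le_one hm]; exact le_max_left _ _
    · exact sub_nonneg.2 (pow_le_one₀ (by positivity) ((div_le_one hm).2 (le_max_right _ _)))
    · linarith [pow_nonneg (div_nonneg hc0.le hm.le) M]
  have hsumle : ∑' k, s k ^ (1 + q) * g (s k ^ q) ≤ ∑ k ∈ Finset.range (n + 1), s k := by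
    rw [tsum_eq_sum htail]
    exact Finset.sum_le_sum fun k _ => hterm k
  have h4 : (∑ k ∈ Finset.range (n + 1), s k) / Real.log ((n : ℝ) + 2)
      = (1 - ε) * (q * ∑ k ∈ Finset.range (n + 1), s k) := by
    rw [hqdef]; field_simp
  rw [h4]
  have h5 := mul_le_mul_of_nonneg_left hsumle hq0.le
  have h6 := mul_lt_mul_of_pos_left (hn1.trans_le h5) h1ε
  nlinarith [mul_nonneg hL0 (sq_nonneg ε), sq_nonneg ε]

/-- The Tauberian theorem relating `∑ s_k ^ p` to the logarithmic growth of `∑_{k ≤ n} s_k`. -/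
theorem tendsto_sum_div_log (hs0 : ∀ k, 0 ≤ s k) (hs : Antitone s)
    (hsum : ∀ p : ℝ, 1 < p → Summable fun k => s k ^ p)
    (hL : Tendsto (fun p : ℝ => (p - 1) * ∑' k, s k ^ p) (𝓝[>] 1) (𝓝 L)) :
    Tendsto (fun n : ℕ => (∑ k ∈ Finset.range (n + 1), s k) / Real.log ((n : ℝ) + 2)) atTop
      (𝓝 L) := by
  -- Rescaling puts the sequence into `[0, 1]`, where `s_k ^ q` stays in the domain of the test
  -- functions; as `c ^ p → c`, the limit becomes `L / c`.
  set c := max (s 0) 1 with hc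
  have hc0 : 0 < c := lt_max_of_lt_right one_pos
  set r : ℕ → ℝ := fun k => s k / c with hr
  have hr0 : ∀ k, 0 ≤ r k := fun k => div_nonneg (hs0 k) hc0.le
  have hr1 : ∀ k, r k ≤ 1 := fun k =>
    (div_le_one hc0).2 ((hs (Nat.zero_le k)).trans (le_max_left _ _))
  have hra : Antitone r := fun i j h => div_le_div_of_nonneg_right (hs h) hc0.le
  have hrp : ∀ (p : ℝ) k, r k ^ p = s k ^ p / c ^ p := fun p k => Real.div_rpow (hs0 k) hc0.le p
  have hrsum : ∀ q : ℝ, 0 < q → Summable fun k => r k ^ (1 + q) := by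
    intro q hq
    simp only [hrp]
    exact (hsum (1 + q) (by linarith)).div_const _
  have hshift : Tendsto (fun q : ℝ => 1 + q) (𝓝[>] 0) (𝓝[>] 1) := by
    refine tendsto_nhdsWithin_iff.2 ⟨?_, ?_⟩
    · have : Tendsto (fun q : ℝ => 1 + q) (𝓝 0) (𝓝 (1 + 0)) := (continuous_const_add 1).tendsto 0
      rw [add_zero] at this
      exact this.mono_left nhdsWithin_le_nhds
    · filter_upwards [self_mem_nhdsWithin] with q hq
      have : (0 : ℝ) < q := hq
      exact Set.mem_Ioi.2 (by linarith)
  have hrL : Tendsto (fun q : ℝ => q * ∑' k, r k ^ (1 + q)) (𝓝[>] 0) (𝓝 (L / c)) := by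
    have h1 : Tendsto (fun q : ℝ => c ^ (1 + q)) (𝓝[>] 0) (𝓝 c) := by
      have h2 : Tendsto (fun p : ℝ => c ^ p) (𝓝 1) (𝓝 (c ^ (1 : ℝ))) :=
        (Real.continuous_const_rpow hc0.ne').tendsto 1
      rw [Real.rpow_one] at h2
      exact (h2.mono_left nhdsWithin_le_nhds).comp hshift
    refine ((hL.comp hshift).div h1 hc0.ne').congr fun q => ?_
    simp only [Function.comp_apply, Pi.div_apply, hrp, tsum_div_const]
    ring
  have hL0 : 0 ≤ L / c := by
    refine ge_of_tendsto hrL ?_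
    filter_upwards [self_mem_nhdsWithin] with q hq
    exact mul_nonneg (le_of_lt hq) (tsum_nonneg fun k => Real.rpow_nonneg (hr0 k) _)
  have key : Tendsto (fun n : ℕ => (∑ k ∈ Finset.range (n + 1), r k) / Real.log ((n : ℝ) + 2))
      atTop (𝓝 (L / c)) := by
    rw [Metric.tendsto_nhds]
    intro δ hδ
    filter_upwards [eventually_sum_div_log_lt hr0 hr1 hrsum hL0 hrL hδ,
      eventually_lt_sum_div_log hr0 hr1 hra hrsum hL0 hrL hδ] with n h1 h2
    rw [Real.dist_eq, abs_lt]
    constructor <;> linarith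
  have h2 := key.mul_const c
  rw [div_mul_cancel₀ _ hc0.ne'] at h2
  refine h2.congr fun n => ?_
  simp only [hr, ← Finset.sum_div]
  field_simp

end Karamata

/-! ### Dixmier traces -/

section DixmierLimit

namespace DixmierLimit

variable (ω : DixmierLimit) {x y : ℕ → ℝ}

theorem mono (hx : Memℓp x ⊤) (hy : Memℓp y ⊤) (h : ∀ n, x n ≤ y n) :
    ω.toLinearMap ⟨x, hx⟩ ≤ ω.toLinearMap ⟨y, hy⟩ := by
  rw [← sub_nonneg, ← map_sub]
  exact ω.nonneg _ fun n => sub_nonneg.2 (h n)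

theorem congr_of_tendsto (hx : Memℓp x ⊤) (hy : Memℓp y ⊤)
    (h : Tendsto (fun n => x n - y n) atTop (𝓝 0)) :
    ω.toLinearMap ⟨x, hx⟩ = ω.toLinearMap ⟨y, hy⟩ := by
  rw [← sub_eq_zero, ← map_sub]
  exact ω.eq_of_tendsto _ 0 h

end DixmierLimit

theorem memℓp_top_of_bound {x : ℕ → ℝ} {C : ℝ} (h : ∀ n, |x n| ≤ C) : Memℓp x ⊤ :=
  memℓp_infty ⟨C, by rintro _ ⟨n, rfl⟩; exact h n⟩

theorem tendsto_zero_of_abs_le_div_log {x : ℕ → ℝ} {C : ℝ}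
    (h : ∀ n : ℕ, |x n| ≤ C / Real.log ((n : ℝ) + 2)) : Tendsto x atTop (𝓝 0) :=
  squeeze_zero_norm h (tendsto_log_nat_add_two.const_div_atTop C)

end DixmierLimit

/-! ### Additivity and unitary-type invariance of the Dixmier trace on positive operators -/

section Dixmier

variable {H : Type*} [NormedAddCommGroup H] [InnerProductSpace ℂ H]

theorem dixmierSeq_nonneg (T : H →L[ℂ] H) (n : ℕ) : 0 ≤ dixmierSeq T n :=
  div_nonneg (Finset.sum_nonneg fun k _ => singularValue_nonneg T k) (log_nat_add_two_pos n).le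

theorem dixmierSeq_le_of_sum_le {T S : H →L[ℂ] H} {C : ℝ}
    (h : ∀ n, ∑ k ∈ Finset.range n, singularValue T k
      ≤ C * ∑ k ∈ Finset.range n, singularValue S k) (n : ℕ) :
    dixmierSeq T n ≤ C * dixmierSeq S n := by
  unfold dixmierSeq
  rw [← mul_div_assoc]
  exact div_le_div_of_nonneg_right (h _) (log_nat_add_two_pos n).le

theorem dixmierSeq_le_of_singularValue_le {T S : H →L[ℂ] H} {C : ℝ}
    (h : ∀ k, singularValue T k ≤ C * singularValue S k) (n : ℕ) :
    dixmierSeq T n ≤ C * dixmierSeq S n :=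
  dixmierSeq_le_of_sum_le (fun n => by
    rw [Finset.mul_sum]; exact Finset.sum_le_sum fun k _ => h k) n

theorem IsInDixmierIdeal.of_singularValue_le {T S : H →L[ℂ] H} (hS : IsInDixmierIdeal S)
    (hT : IsCompactOperator T) {C : ℝ} (hC : 0 ≤ C)
    (h : ∀ k, singularValue T k ≤ C * singularValue S k) : IsInDixmierIdeal T := by
  obtain ⟨D, hD⟩ := hS.2
  exact ⟨hT, C * D, fun n => (dixmierSeq_le_of_singularValue_le h n).trans
    (mul_le_mul_of_nonneg_left (hD n) hC)⟩

theorem IsInDixmierIdeal.memℓp {T : H →L[ℂ] H} (hT : IsInDixmierIdeal T) :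
    Memℓp (dixmierSeq T) ⊤ := by
  obtain ⟨C, hC⟩ := hT.2
  exact memℓp_top_of_bound (C := C) fun n => by
    rw [abs_of_nonneg (dixmierSeq_nonneg T n)]; exact hC n

theorem dixmierTracePos_eq (ω : DixmierLimit) {T : H →L[ℂ] H} (hT : IsInDixmierIdeal T) :
    dixmierTracePos ω T = ω.toLinearMap ⟨dixmierSeq T, hT.memℓp⟩ :=
  dif_pos hT.memℓp

theorem dixmierTracePos_eq_of_tendsto (ω : DixmierLimit) {T : H →L[ℂ] H}
    (hT : IsInDixmierIdeal T) {L : ℝ} (h : Tendsto (dixmierSeq T) atTop (𝓝 L)) :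
    dixmierTracePos ω T = L := by
  rw [dixmierTracePos_eq ω hT]
  exact ω.eq_of_tendsto _ L h

variable [CompleteSpace H]

theorem IsInDixmierIdeal.add {T S : H →L[ℂ] H} (hT : T.IsPositive) (hS : S.IsPositive)
    (hTd : IsInDixmierIdeal T) (hSd : IsInDixmierIdeal S) : IsInDixmierIdeal (T + S) := by
  obtain ⟨C, hC⟩ := hTd.2
  obtain ⟨D, hD⟩ := hSd.2
  refine ⟨IsCompactOperator.add hTd.1 hSd.1, C + D, fun n => ?_⟩
  refine le_trans ?_ (add_le_add (hC n) (hD n))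
  unfold dixmierSeq
  rw [← add_div]
  exact div_le_div_of_nonneg_right (sum_singularValue_add_le hT hS hTd.1 hSd.1 _)
    (log_nat_add_two_pos n).le

theorem log_two_mul_add_three_sub_le (n : ℕ) :
    Real.log ((2 * n + 1 : ℕ) + 2) - Real.log ((n : ℝ) + 2) ≤ Real.log 2 := by
  have h : (0 : ℝ) ≤ n := Nat.cast_nonneg n
  rw [sub_le_iff_le_add, ← Real.log_mul two_ne_zero (by positivity)]
  refine Real.log_le_log (by positivity) ?_
  push_cast
  linarith

/-- One more term adds at most `‖T‖` to the sum and at most `log 2` to the logarithm, so consecutive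
means become asymptotically equal. -/
theorem abs_dixmierSeq_succ_sub_le {T : H →L[ℂ] H} {C : ℝ} (hC : ∀ n, dixmierSeq T n ≤ C) (n : ℕ) :
    |dixmierSeq T (n + 1) - dixmierSeq T n|
      ≤ (‖T‖ + C * Real.log 2) / Real.log ((n : ℝ) + 2) := by
  have hl := log_nat_add_two_pos n
  have hl' : 0 < Real.log ((n + 1 : ℕ) + 2) := log_nat_add_two_pos (n + 1)
  have hll : Real.log ((n : ℝ) + 2) ≤ Real.log ((n + 1 : ℕ) + 2) := by
    refine Real.log_le_log (by positivity) ?_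
    push_cast
    linarith
  have hld : Real.log ((n + 1 : ℕ) + 2) - Real.log ((n : ℝ) + 2) ≤ Real.log 2 := by
    have h : (0 : ℝ) ≤ n := Nat.cast_nonneg n
    rw [sub_le_iff_le_add, ← Real.log_mul two_ne_zero (by positivity)]
    refine Real.log_le_log (by positivity) ?_
    push_cast
    linarith
  have hs0 := singularValue_nonneg T (n + 1)
  have hs := singularValue_le_norm T (n + 1)
  have hd0 := dixmierSeq_nonneg T n
  have hd := hC n
  have e : dixmierSeq T (n + 1) - dixmierSeq T n
      = (singularValue T (n + 1) - dixmierSeq T n *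
        (Real.log ((n + 1 : ℕ) + 2) - Real.log ((n : ℝ) + 2))) / Real.log ((n + 1 : ℕ) + 2) := by
    have h1 : ∑ k ∈ Finset.range (n + 1), singularValue T k
        = dixmierSeq T n * Real.log ((n : ℝ) + 2) := by
      unfold dixmierSeq; field_simp
    have h2 : dixmierSeq T (n + 1) = (∑ k ∈ Finset.range (n + 1), singularValue T k
      + singularValue T (n + 1)) / Real.log ((n + 1 : ℕ) + 2) := by
      rw [← Finset.sum_range_succ]; rfl
    rw [h2, h1]
    field_simp
    ring
  have hprod : dixmierSeq T n * (Real.log ((n + 1 : ℕ) + 2) - Real.log ((n : ℝ) + 2))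
      ≤ C * Real.log 2 := mul_le_mul hd hld (by linarith) (hd0.trans hd)
  have hprod0 : 0 ≤ dixmierSeq T n * (Real.log ((n + 1 : ℕ) + 2) - Real.log ((n : ℝ) + 2)) :=
    mul_nonneg hd0 (by linarith)
  rw [e, abs_div, abs_of_pos hl']
  refine div_le_div₀ ?_ ?_ hl hll
  · linarith
  · rw [abs_le]; constructor <;> linarith

/-- One inequality is Ky Fan's. For the other, the sums for `T` and `S` over `n + 1` terms are
together at most the sum for `T + S` over `2n + 2` terms. Replacing `log (n + 2)` by `log (2n + 3)`
is asymptotically harmless, and dilation invariance identifies the value of `ω` on the subsequence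
with its value on the whole sequence. -/
theorem dixmierTracePos_add (ω : DixmierLimit) {T S : H →L[ℂ] H} (hT : T.IsPositive)
    (hS : S.IsPositive) (hTd : IsInDixmierIdeal T) (hSd : IsInDixmierIdeal S) :
    dixmierTracePos ω (T + S) = dixmierTracePos ω T + dixmierTracePos ω S := by
  have hd := IsInDixmierIdeal.add hT hS hTd hSd
  have hsum : Memℓp (dixmierSeq T + dixmierSeq S) ⊤ := hTd.memℓp.add hSd.memℓp
  have hadd : dixmierTracePos ω T + dixmierTracePos ω S
      = ω.toLinearMap ⟨dixmierSeq T + dixmierSeq S, hsum⟩ := by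
    rw [dixmierTracePos_eq ω hTd, dixmierTracePos_eq ω hSd, ← map_add]
    rfl
  obtain ⟨C, hC⟩ := hd.2
  rw [hadd, dixmierTracePos_eq ω hd]
  refine le_antisymm (ω.mono _ _ fun n => ?_) ?_
  · simp only [Pi.add_apply]
    unfold dixmierSeq
    rw [← add_div]
    exact div_le_div_of_nonneg_right (sum_singularValue_add_le hT hS hTd.1 hSd.1 _)
      (log_nat_add_two_pos n).le
  -- Index `2n + 1` stands for `2n + 2` terms. The dilated sequence `y` takes the value of
  -- `dixmierSeq (T + S)` at `2m + 1` for both indices `2m` and `2m + 1`, so it differs from that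
  -- sequence by at most one step.
  set z : ℕ → ℝ := fun n => dixmierSeq (T + S) (2 * n + 1) with hz
  set y : ℕ → ℝ := fun n => z (n / 2) with hy
  set Z : ℕ → ℝ := fun n => (∑ k ∈ Finset.range (2 * (n + 1)), singularValue (T + S) k)
    / Real.log ((n : ℝ) + 2) with hZ
  have hzm : Memℓp z ⊤ := memℓp_top_of_bound (C := C) fun n => by
    rw [abs_of_nonneg (dixmierSeq_nonneg _ _)]; exact hC _
  have hym : Memℓp y ⊤ := memℓp_top_of_bound (C := C) fun n => by
    rw [abs_of_nonneg (dixmierSeq_nonneg _ _)]; exact hC _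
  have hZz : ∀ n, |Z n - z n| ≤ (C * Real.log 2) / Real.log ((n : ℝ) + 2) := by
    intro n
    have hl := log_nat_add_two_pos n
    have hl' : 0 < Real.log ((2 * n + 1 : ℕ) + 2) := log_nat_add_two_pos (2 * n + 1)
    have hll : Real.log ((n : ℝ) + 2) ≤ Real.log ((2 * n + 1 : ℕ) + 2) := by
      have h : (0 : ℝ) ≤ n := Nat.cast_nonneg n
      refine Real.log_le_log (by positivity) ?_
      push_cast
      linarith
    have h1 : ∑ k ∈ Finset.range (2 * (n + 1)), singularValue (T + S) k
        = z n * Real.log ((2 * n + 1 : ℕ) + 2) := by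
      simp only [hz]
      unfold dixmierSeq
      field_simp
      rfl
    have e : Z n - z n = z n * (Real.log ((2 * n + 1 : ℕ) + 2) - Real.log ((n : ℝ) + 2))
        / Real.log ((n : ℝ) + 2) := by
      simp only [hZ]
      rw [h1]; field_simp
    have hz0 : 0 ≤ z n := dixmierSeq_nonneg _ _
    rw [e, abs_of_nonneg (div_nonneg (mul_nonneg hz0 (by linarith)) hl.le)]
    refine div_le_div_of_nonneg_right ?_ hl.le
    exact mul_le_mul (hC _) (log_two_mul_add_three_sub_le n) (by linarith) (hz0.trans (hC _))
  have hZzt := tendsto_zero_of_abs_le_div_log hZz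
  have hZm : Memℓp Z ⊤ := by
    have h1 : Memℓp (fun n => Z n - z n) ⊤ := by
      obtain ⟨D, hD⟩ := hZzt.norm.bddAbove_range
      exact memℓp_top_of_bound (C := D) fun n => hD ⟨n, rfl⟩
    have h2 := h1.add hzm
    have h3 : (fun n => Z n - z n) + z = Z := by ext n; simp
    rwa [h3] at h2
  have hyd : Tendsto (fun n => y n - dixmierSeq (T + S) n) atTop (𝓝 0) := by
    refine tendsto_zero_of_abs_le_div_log (C := ‖T + S‖ + C * Real.log 2) fun n => ?_
    have hC0 : 0 ≤ C := (dixmierSeq_nonneg _ 0).trans (hC 0)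
    rcases Nat.even_or_odd' n with ⟨m, rfl | rfl⟩
    · have : y (2 * m) = dixmierSeq (T + S) (2 * m + 1) := by
        simp only [hy, hz]; congr 2; omega
      rw [this]
      exact abs_dixmierSeq_succ_sub_le hC (2 * m)
    · have : y (2 * m + 1) = dixmierSeq (T + S) (2 * m + 1) := by
        simp only [hy, hz]; congr 2; omega
      rw [this, sub_self, abs_zero]
      exact div_nonneg (by positivity) (log_nat_add_two_pos _).le
  calc ω.toLinearMap ⟨dixmierSeq T + dixmierSeq S, hsum⟩
      ≤ ω.toLinearMap ⟨Z, hZm⟩ := by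
        refine ω.mono _ _ fun n => ?_
        simp only [Pi.add_apply, hZ]
        unfold dixmierSeq
        rw [← add_div]
        exact div_le_div_of_nonneg_right (le_sum_singularValue_add hT hS hTd.1 hSd.1 _)
          (log_nat_add_two_pos n).le
    _ = ω.toLinearMap ⟨z, hzm⟩ := ω.congr_of_tendsto _ _ hZzt
    _ = ω.toLinearMap ⟨y, hym⟩ := (ω.dilation ⟨z, hzm⟩ ⟨y, hym⟩ fun n => rfl).symm
    _ = ω.toLinearMap ⟨dixmierSeq (T + S), hd.memℓp⟩ := ω.congr_of_tendsto _ _ hyd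
    _ ≤ _ := le_rfl

/-- On an eigenvector of `T⁺` with nonzero eigenvalue `T⁻` vanishes, so the eigenvalue equals `⟨T v,
v⟩ ≤ ⟨P v, v⟩`, and Ky Fan for `P` bounds the partial sums. Compactness comes from `(T⁺)² = T⁺ T`.
-/
theorem IsInDixmierIdeal.posPart {T P Q : H →L[ℂ] H} (hsa : IsSelfAdjoint T)
    (hP : P.IsPositive) (hQ : Q.IsPositive) (hPd : IsInDixmierIdeal P) (hQd : IsInDixmierIdeal Q)
    (hT : T = P - Q) : IsInDixmierIdeal T⁺ := by
  have hpos : (T⁺).IsPositive :=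
    (ContinuousLinearMap.nonneg_iff_isPositive _).1 (CFC.posPart_nonneg T)
  have hTc : IsCompactOperator T := by
    rw [hT]; exact IsCompactOperator.sub hPd.1 hQd.1
  have hmul : ContinuousLinearMap.adjoint T⁺ * T⁺ = T⁺ * T := by
    rw [ContinuousLinearMap.isSelfAdjoint_iff'.1 hpos.isSelfAdjoint]
    nth_rewrite 4 [← CFC.posPart_sub_negPart T hsa]
    rw [mul_sub, CFC.posPart_mul_negPart, sub_zero]
  have hc : IsCompactOperator (T⁺ : H →L[ℂ] H) := by
    refine isCompactOperator_of_adjoint_comp_self _ ?_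
    rw [hmul]
    exact IsCompactOperator.clm_comp hTc T⁺
  obtain ⟨v, hv⟩ := exists_isSpectralSeq hpos hc
  obtain ⟨w, hw⟩ := exists_isSpectralSeq hP hPd.1
  obtain ⟨C, hC⟩ := hPd.2
  have hneg : ∀ k, T⁻ (v k) = 0 := by
    intro k
    rcases eq_or_ne (singularValue T⁺ k) 0 with h | h
    · rw [hv.eq_zero k h, map_zero]
    · have h1 : (T⁻ * T⁺) (v k) = 0 := by rw [CFC.negPart_mul_posPart]; rfl
      change T⁻ (T⁺ (v k)) = 0 at h1
      rw [hv.map_eq, map_smul] at h1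
      exact (smul_eq_zero.1 h1).resolve_left (by exact_mod_cast h)
  have hle : ∀ k, singularValue T⁺ k ≤ (inner ℂ (P (v k)) (v k)).re := by
    intro k
    have h1 : T⁺ (v k) = P (v k) - Q (v k) := by
      have h2 : (T⁺ - T⁻) (v k) = (P - Q) (v k) := by rw [CFC.posPart_sub_negPart T hsa, hT]
      rwa [sub_apply, hneg, sub_zero, sub_apply] at h2
    rw [← hv.inner_map_self, h1, inner_sub_left, Complex.sub_re]
    have := hQ.re_inner_nonneg_left (v k)
    have h3 : 0 ≤ (inner ℂ (Q (v k)) (v k)).re := this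
    linarith
  refine ⟨hc, C, fun n => ?_⟩
  have h1 := dixmierSeq_le_of_sum_le (T := T⁺) (S := P) (C := 1) (fun n => by
    rw [one_mul]
    exact (Finset.sum_le_sum fun k _ => hle k).trans
      (hw.sum_inner_le hv.orth (Finset.range n) (Finset.card_range n).le)) n
  rw [one_mul] at h1
  exact h1.trans (hC n)

/-- From `T⁺ + Q = T⁻ + P` and additivity. Hence the Dixmier trace of a self-adjoint operator may be
computed from any difference of positive operators in the ideal, not only from its Jordan
decomposition. -/
theorem dixmierTracePos_posPart_sub (ω : DixmierLimit) {T P Q : H →L[ℂ] H}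
    (hsa : IsSelfAdjoint T) (hP : P.IsPositive) (hQ : Q.IsPositive) (hPd : IsInDixmierIdeal P)
    (hQd : IsInDixmierIdeal Q) (hT : T = P - Q) :
    dixmierTracePos ω T⁺ - dixmierTracePos ω T⁻ = dixmierTracePos ω P - dixmierTracePos ω Q := by
  have hp := IsInDixmierIdeal.posPart hsa hP hQ hPd hQd hT
  have hn : IsInDixmierIdeal T⁻ := by
    have := IsInDixmierIdeal.posPart hsa.neg hQ hP hQd hPd (by rw [hT, neg_sub])
    rwa [CFC.posPart_neg] at this
  have hpp : (T⁺).IsPositive :=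
    (ContinuousLinearMap.nonneg_iff_isPositive _).1 (CFC.posPart_nonneg T)
  have hnp : (T⁻).IsPositive :=
    (ContinuousLinearMap.nonneg_iff_isPositive _).1 (CFC.negPart_nonneg T)
  have h1 : T⁺ + Q = T⁻ + P := by
    have h2 := CFC.posPart_sub_negPart T hsa
    rw [sub_eq_iff_eq_add] at h2
    rw [h2, hT]; abel
  have h3 := dixmierTracePos_add ω hpp hQ hp hQd
  rw [h1, dixmierTracePos_add ω hnp hP hn hPd] at h3
  linarith

theorem dixmierTracePos_adjoint_comp_self (ω : DixmierLimit) {W : H →L[ℂ] H}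
    (hW : IsCompactOperator W) :
    dixmierTracePos ω (ContinuousLinearMap.adjoint W * W)
      = dixmierTracePos ω (W * ContinuousLinearMap.adjoint W) := by
  have h : dixmierSeq (ContinuousLinearMap.adjoint W * W)
      = dixmierSeq (W * ContinuousLinearMap.adjoint W) := by
    ext n
    unfold dixmierSeq
    congr 1
    refine Finset.sum_congr rfl fun k _ => singularValue_adjoint_comp_self W ?_ ?_ k
    · exact IsCompactOperator.clm_comp (f := W) hW (ContinuousLinearMap.adjoint W)
    · exact IsCompactOperator.comp_clm (f := W) hW (ContinuousLinearMap.adjoint W)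
  -- `dixmierTracePos` depends on the operator only through `dixmierSeq`.
  exact congrArg (fun x : ℕ → ℝ => @dite ℝ (Memℓp x ⊤) (Classical.propDecidable _)
    (fun h => ω.toLinearMap ⟨x, h⟩) fun _ => 0) h

end Dixmier

/-! ### The trace property for `M Y²` -/

section DixmierProduct

variable {H : Type*} [NormedAddCommGroup H] [InnerProductSpace ℂ H] [CompleteSpace H]

open ContinuousLinearMap in
/-- The Dixmier trace of `M Y²` for positive `M = K† K` and self-adjoint `Y`. -/
theorem dixmierTrace_mul (ω : DixmierLimit) {K Y : H →L[ℂ] H} (hY : IsSelfAdjoint Y)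
    (hd : IsInDixmierIdeal (Y * Y)) :
    dixmierTrace ω (adjoint K * K * (Y * Y)) = (dixmierTracePos ω (Y * (adjoint K * K) * Y) : ℂ) := by
  set M := adjoint K * K with hM
  have hYs : adjoint Y = Y := hY
  have hMs : adjoint M = M := (isPositive_adjoint_comp_self K).isSelfAdjoint
  have hYc : IsCompactOperator Y := by
    refine isCompactOperator_of_adjoint_comp_self Y ?_
    rw [hYs]; exact hd.1
  have hadj_mul : ∀ P Q : H →L[ℂ] H, adjoint (P * Q) = adjoint Q * adjoint P :=
    fun P Q => star_mul P Q
  have hadj_one : adjoint (1 : H →L[ℂ] H) = 1 := star_one _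
  -- Polarisation: for `W c = Y (1 + c M) / 2`, the real and imaginary parts of `M Y²` are the
  -- differences of `W† W` at `c = 1, -1` and at `c = i, -i`.
  set D : ℂ → (H →L[ℂ] H) := fun c => (2⁻¹ : ℂ) • (1 + c • M) with hD
  have hDs : ∀ c, adjoint (D c) = D (starRingEnd ℂ c) := by
    intro c
    simp only [hD, map_smulₛₗ, map_add, hMs, hadj_one, map_inv₀, map_ofNat]
  set W : ℂ → (H →L[ℂ] H) := fun c => Y * D c with hW
  have hWs : ∀ c, adjoint (W c) = D (starRingEnd ℂ c) * Y := by
    intro c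
    simp only [hW, hadj_mul, hDs, hYs]
  have hWc : ∀ c, IsCompactOperator (W c) := fun c => hYc.comp_clm (D c)
  have hP : ∀ c, (adjoint (W c) * W c).IsPositive := fun c => isPositive_adjoint_comp_self (W c)
  have hP' : ∀ c, (W c * adjoint (W c)).IsPositive := fun c => isPositive_self_comp_adjoint (W c)
  have hPd : ∀ c, IsInDixmierIdeal (adjoint (W c) * W c) := by
    intro c
    refine hd.of_singularValue_le (IsCompactOperator.clm_comp (f := W c) (hWc c) (adjoint (W c)))
      (C := ‖D (starRingEnd ℂ c)‖ * ‖D c‖) (by positivity) fun k => ?_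
    have e : adjoint (W c) * W c = D (starRingEnd ℂ c) * ((Y * Y) * D c) := by
      rw [hWs]; simp only [hW, mul_assoc]
    rw [e]
    exact singularValue_mul_mul_le _ _ _ k
  have hPd' : ∀ c, IsInDixmierIdeal (W c * adjoint (W c)) := by
    intro c
    refine (hPd c).of_singularValue_le
      (IsCompactOperator.comp_clm (f := W c) (hWc c) (adjoint (W c))) zero_le_one fun k => ?_
    rw [one_mul]
    exact (singularValue_adjoint_comp_self (W c)
      (IsCompactOperator.clm_comp (f := W c) (hWc c) (adjoint (W c)))
      (IsCompactOperator.comp_clm (f := W c) (hWc c) (adjoint (W c))) k).ge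
  have hstar : star (M * (Y * Y)) = Y * Y * M := by
    rw [star_mul, star_mul]
    change (adjoint Y * adjoint Y) * adjoint M = _
    rw [hYs, hMs]
  have hre : (realPart (M * (Y * Y)) : H →L[ℂ] H)
      = adjoint (W 1) * W 1 - adjoint (W (-1)) * W (-1) := by
    rw [realPart_apply_coe, hstar, hWs, hWs, ← Complex.coe_smul]
    simp only [hW, hD, map_one, map_neg, smul_mul_assoc, mul_smul_comm, mul_add, add_mul, one_mul,
      mul_one, neg_smul, smul_smul, mul_neg, neg_mul, mul_assoc, smul_add, smul_neg]
    push_cast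
    module
  have him : (imaginaryPart (M * (Y * Y)) : H →L[ℂ] H)
      = adjoint (W Complex.I) * W Complex.I - adjoint (W (-Complex.I)) * W (-Complex.I) := by
    rw [imaginaryPart_apply_coe, hstar, hWs, hWs, ← Complex.coe_smul (2⁻¹ : ℝ)]
    simp only [hW, hD, map_neg, Complex.conj_I, smul_mul_assoc, mul_smul_comm, mul_add,
      add_mul, one_mul, mul_one, neg_smul, smul_smul, mul_neg, neg_mul, mul_assoc,
      smul_add, smul_neg, smul_sub, neg_neg]
    push_cast
    module
  -- In the reversed order the difference at `c = ±1` is exactly `Y M Y`; it is written as a sum so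
  -- that additivity on positive operators applies.
  have hS : Y * M * Y + W (-1) * adjoint (W (-1)) = W 1 * adjoint (W 1) := by
    rw [hWs, hWs]
    simp only [hW, hD, map_one, map_neg, smul_mul_assoc, mul_smul_comm, mul_add, add_mul, one_mul,
      mul_one, neg_smul, smul_smul, mul_neg, neg_mul, mul_assoc, smul_add, smul_neg]
    module
  -- Both sides are `Y (1 + M²) Y / 4`, so the imaginary part has Dixmier trace zero.
  have hI : W Complex.I * adjoint (W Complex.I) = W (-Complex.I) * adjoint (W (-Complex.I)) := by
    rw [hWs, hWs]
    simp only [hW, hD, map_neg, Complex.conj_I, smul_mul_assoc, mul_smul_comm, mul_add, add_mul,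
      one_mul, mul_one, neg_smul, smul_smul, mul_neg, neg_mul, mul_assoc, smul_add, smul_neg,
      neg_neg]
    module
  have hSY : Y * M * Y = adjoint (K * Y) * (K * Y) := by
    rw [hadj_mul, hYs, hM]; simp only [mul_assoc]
  have hSp : (Y * M * Y).IsPositive := by
    rw [hSY]; exact isPositive_adjoint_comp_self (K * Y)
  have hKYc : IsCompactOperator (K * Y) := IsCompactOperator.clm_comp (f := Y) hYc K
  have hSd : IsInDixmierIdeal (Y * M * Y) := by
    rw [hSY]
    refine hd.of_singularValue_le
      (IsCompactOperator.clm_comp (f := K * Y) hKYc (adjoint (K * Y)))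
      (C := ‖K‖ * ‖adjoint K‖) (by positivity) fun k => ?_
    rw [singularValue_adjoint_comp_self (K * Y)
      (IsCompactOperator.clm_comp (f := K * Y) hKYc (adjoint (K * Y)))
      (IsCompactOperator.comp_clm (f := K * Y) hKYc (adjoint (K * Y)))]
    have e : K * Y * adjoint (K * Y) = K * ((Y * Y) * adjoint K) := by
      rw [hadj_mul, hYs]; simp only [mul_assoc]
    rw [e]
    exact singularValue_mul_mul_le _ _ _ k
  have h1 := dixmierTracePos_posPart_sub ω (realPart (M * (Y * Y))).2 (hP 1) (hP (-1)) (hPd 1)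
    (hPd (-1)) hre
  have h2 := dixmierTracePos_posPart_sub ω (imaginaryPart (M * (Y * Y))).2 (hP Complex.I)
    (hP (-Complex.I)) (hPd Complex.I) (hPd (-Complex.I)) him
  have h3 := dixmierTracePos_add ω hSp (hP' (-1)) hSd (hPd' (-1))
  rw [hS, ← dixmierTracePos_adjoint_comp_self ω (hWc 1),
    ← dixmierTracePos_adjoint_comp_self ω (hWc (-1))] at h3
  rw [dixmierTracePos_adjoint_comp_self ω (hWc Complex.I), hI,
    ← dixmierTracePos_adjoint_comp_self ω (hWc (-Complex.I)), sub_self] at h2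
  unfold dixmierTrace
  rw [h1, h2, h3]
  simp

end DixmierProduct

/-! ### Balakrishnan powers of products -/

/-- Writing `1 / (1 + t)` as the integral of `exp (-(1 + t) u)` over `u > 0` and applying Fubini
gives `Γ(r) Γ(1 - r)`, and Euler's reflection formula concludes. -/
theorem integral_rpowIntegrand₀₁_one {r : ℝ} (hr : r ∈ Set.Ioo 0 1) :
    ∫ t in Set.Ioi (0 : ℝ), r.rpowIntegrand₀₁ t 1 = Real.pi / Real.sin (Real.pi * r) := by
  have hr0 := hr.1
  have hr1 := hr.2
  set μ := (volume : Measure ℝ).restrict (Set.Ioi 0) with hμ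
  set f : ℝ → ℝ → ℝ := fun t u => t ^ (r - 1) * Real.exp (-(u * t)) * Real.exp (-u) with hf
  have h1 : ∀ u : ℝ, 0 < u → ∫ t, f t u ∂μ = Real.Gamma r * (Real.exp (-u) * u ^ ((1 - r) - 1)) := by
    intro u hu
    simp only [hf, hμ]
    rw [integral_mul_const, Real.integral_rpow_mul_exp_neg_mul_Ioi hr0 hu, one_div,
      Real.inv_rpow hu.le, ← Real.rpow_neg hu.le]
    have : (1 - r) - 1 = -r := by ring
    rw [this]; ring
  -- A non-integrable function has integral zero by convention, whereas the value found is positive.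
  have h1i : ∀ u : ℝ, 0 < u → Integrable (fun t => f t u) μ := by
    intro u hu
    by_contra hcon
    have h2 := h1 u hu
    rw [integral_undef hcon] at h2
    have := Real.Gamma_pos_of_pos hr0
    have : 0 < Real.Gamma r * (Real.exp (-u) * u ^ ((1 - r) - 1)) := by positivity
    linarith
  have hmeas : AEStronglyMeasurable (Function.uncurry f) (μ.prod μ) := by
    apply Measurable.aestronglyMeasurable
    simp only [hf, Function.uncurry_def]
    fun_prop
  have hpos : ∀ᵐ u ∂μ, 0 < u := ae_restrict_mem measurableSet_Ioi
  have hint : Integrable (Function.uncurry f) (μ.prod μ) := by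
    rw [integrable_prod_iff' hmeas]
    refine ⟨hpos.mono fun u hu => h1i u hu, ?_⟩
    have h2 := (Real.GammaIntegral_convergent (s := 1 - r) (by linarith)).const_mul (Real.Gamma r)
    refine Integrable.congr h2 ?_
    filter_upwards [hpos] with u hu
    rw [← h1 u hu]
    refine integral_congr_ae ?_
    filter_upwards [hpos] with t ht
    rw [Function.uncurry_apply_pair, Real.norm_of_nonneg]
    simp only [hf]
    positivity
  have hswap := integral_integral_swap hint
  have hL : ∫ t, ∫ u, f t u ∂μ ∂μ = ∫ t in Set.Ioi (0 : ℝ), r.rpowIntegrand₀₁ t 1 := by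
    refine integral_congr_ae ?_
    filter_upwards [hpos] with t ht
    rw [Real.rpowIntegrand₀₁_eq_pow_div hr ht.le zero_le_one]
    have h3 := Real.integral_rpow_mul_exp_neg_mul_Ioi (a := 1) (r := t + 1) one_pos (by linarith)
    simp only [sub_self, Real.rpow_zero, one_mul, Real.rpow_one, Real.Gamma_one, mul_one] at h3
    rw [mul_one, div_eq_mul_one_div, ← h3, ← integral_const_mul]
    refine integral_congr_ae (Eventually.of_forall fun u => ?_)
    simp only [hf]
    rw [mul_assoc, ← Real.exp_add]
    congr 2; ring
  have hR : ∫ u, ∫ t, f t u ∂μ ∂μ = Real.Gamma r * Real.Gamma (1 - r) := by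
    rw [Real.Gamma_eq_integral (by linarith : 0 < 1 - r), ← integral_const_mul]
    refine integral_congr_ae ?_
    filter_upwards [hpos] with u hu
    exact h1 u hu
  rw [← hL, hswap, hR, Real.Gamma_mul_Gamma_one_sub]

theorem integral_rpow_mul_div_add {p s : ℝ} (hp : 1 < p) (hp2 : p < 2) (hs : 0 ≤ s) :
    Real.sin (Real.pi * (p - 1)) / Real.pi * ∫ t in Set.Ioi (0 : ℝ), t ^ (p - 2) * (s / (t + s))
      = s ^ (p - 1) := by
  have hr : p - 1 ∈ Set.Ioo (0 : ℝ) 1 := ⟨by linarith, by linarith⟩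
  have h1 := Real.integral_rpowIntegrand₀₁_eq_rpow_mul_const hr hs
  rw [integral_rpowIntegrand₀₁_one hr] at h1
  have h2 : ∫ t in Set.Ioi (0 : ℝ), t ^ (p - 2) * (s / (t + s))
      = ∫ t in Set.Ioi (0 : ℝ), (p - 1).rpowIntegrand₀₁ t s := by
    refine setIntegral_congr_fun measurableSet_Ioi fun t ht => ?_
    have ht : 0 < t := ht
    rw [Real.rpowIntegrand₀₁_eq_pow_div hr ht.le hs, mul_div_assoc]
    congr 2; ring
  have hsin : 0 < Real.sin (Real.pi * (p - 1)) := by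
    refine Real.sin_pos_of_pos_of_lt_pi (mul_pos Real.pi_pos hr.1) ?_
    exact mul_lt_of_lt_one_right Real.pi_pos hr.2
  rw [h2, h1]
  field_simp [Real.pi_pos.ne', hsin.ne']

/-! ### Resolvents and powers of `X Y` when `Y X` is positive -/

section Balakrishnan

variable {H : Type*} [NormedAddCommGroup H] [InnerProductSpace ℂ H] [CompleteSpace H]

theorem ContinuousLinearMap.IsPositive.le_norm_smul_one_add {S : H →L[ℂ] H} (hS : S.IsPositive)
    (t : ℝ) (x : H) : t * ‖x‖ ^ 2 ≤ (inner ℂ (((t : ℂ) • (1 : H →L[ℂ] H) + S) x) x).re := by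
  rw [add_apply, inner_add_left, smul_apply, one_apply_eq_self, inner_smul_left,
    Complex.conj_ofReal, inner_self_eq_ofReal, Complex.add_re, ← Complex.ofReal_mul,
    Complex.ofReal_re]
  have : 0 ≤ (inner ℂ (S x) x).re := hS.re_inner_nonneg_left x
  linarith

theorem ContinuousLinearMap.IsPositive.isUnit_smul_one_add {S : H →L[ℂ] H} (hS : S.IsPositive)
    {t : ℝ} (ht : 0 < t) : IsUnit ((t : ℂ) • (1 : H →L[ℂ] H) + S) := by
  refine ContinuousLinearMap.isUnit_of_forall_le_norm_inner_map _ (c := ⟨t, ht.le⟩) ht fun x => ?_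
  refine le_trans ?_ (Complex.re_le_norm _)
  have := hS.le_norm_smul_one_add t x
  rw [mul_comm] at this
  exact this

theorem ContinuousLinearMap.IsPositive.norm_inverse_le {S : H →L[ℂ] H} (hS : S.IsPositive)
    {t : ℝ} (ht : 0 < t) : ‖Ring.inverse ((t : ℂ) • (1 : H →L[ℂ] H) + S)‖ ≤ t⁻¹ := by
  set B := (t : ℂ) • (1 : H →L[ℂ] H) + S with hB
  refine ContinuousLinearMap.opNorm_le_bound _ (inv_nonneg.2 ht.le) fun y => ?_
  set x := Ring.inverse B y with hx
  have h1 : B x = y := by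
    have h2 : (B * Ring.inverse B) y = y := by
      rw [Ring.mul_inverse_cancel _ (hS.isUnit_smul_one_add ht)]; rfl
    exact h2
  have h2 := (hS.le_norm_smul_one_add t x).trans
    ((Complex.re_le_norm _).trans (norm_inner_le_norm _ _))
  rw [← hB, h1] at h2
  rw [inv_mul_eq_div, le_div_iff₀ ht]
  rcases (norm_nonneg x).eq_or_lt with h0 | h0
  · rw [← h0, zero_mul]; exact norm_nonneg _
  · refine le_of_mul_le_mul_right ?_ h0
    rw [mul_assoc]
    linarith

variable {X Y : H →L[ℂ] H}

/-- The inverse of `t + X Y` is `t⁻¹ (1 - X (t + Y X)⁻¹ Y)`, so positivity of `Y X` suffices and `X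
Y` need not be normal. -/
theorem isUnit_smul_one_add_mul (hS : (Y * X).IsPositive) {t : ℝ} (ht : 0 < t) :
    IsUnit ((t : ℂ) • (1 : H →L[ℂ] H) + X * Y) := by
  set R := Ring.inverse ((t : ℂ) • (1 : H →L[ℂ] H) + Y * X) with hR
  have h1 : ((t : ℂ) • (1 : H →L[ℂ] H) + Y * X) * R = 1 :=
    Ring.mul_inverse_cancel _ (hS.isUnit_smul_one_add ht)
  have h2 : R * ((t : ℂ) • (1 : H →L[ℂ] H) + Y * X) = 1 :=
    Ring.inverse_mul_cancel _ (hS.isUnit_smul_one_add ht)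
  have ht' : (t : ℂ) ≠ 0 := by exact_mod_cast ht.ne'
  refine isUnit_iff_exists.2 ⟨(t : ℂ)⁻¹ • (1 - X * R * Y), ?_, ?_⟩
  · have e : ((t : ℂ) • (1 : H →L[ℂ] H) + X * Y) * (1 - X * R * Y)
        = (t : ℂ) • (1 : H →L[ℂ] H) + X * Y
          - X * (((t : ℂ) • (1 : H →L[ℂ] H) + Y * X) * R) * Y := by
      simp only [mul_sub, add_mul, mul_add, smul_mul_assoc, mul_smul_comm, one_mul, mul_one,
        mul_assoc]
    rw [mul_smul_comm, e, h1, mul_one, add_sub_cancel_right, smul_smul, inv_mul_cancel₀ ht',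
      one_smul]
  · have e : (1 - X * R * Y) * ((t : ℂ) • (1 : H →L[ℂ] H) + X * Y)
        = (t : ℂ) • (1 : H →L[ℂ] H) + X * Y
          - X * (R * ((t : ℂ) • (1 : H →L[ℂ] H) + Y * X)) * Y := by
      simp only [sub_mul, add_mul, mul_add, smul_mul_assoc, mul_smul_comm, one_mul, mul_one,
        mul_assoc, smul_sub]
      abel
    rw [smul_mul_assoc, e, h2, mul_one, add_sub_cancel_right, smul_smul, inv_mul_cancel₀ ht',
      one_smul]

/-- The integrand `t^{p-2} S (t + S)⁻¹` of the power `S^{p-1}`. -/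
noncomputable def resolventIntegrand (S : H →L[ℂ] H) (p t : ℝ) : H →L[ℂ] H :=
  ((t ^ (p - 2) : ℝ) : ℂ) • (S * Ring.inverse ((t : ℂ) • (1 : H →L[ℂ] H) + S))

/-- The intertwining `Y (t + X Y) = (t + Y X) Y` moves the resolvent of `X Y` onto `Y X`; the two
factors of `A²` supply the outer `X` and `Y`. -/
theorem balakrishnanIntegrand_mul (hS : (Y * X).IsPositive) (p : ℝ) {t : ℝ} (ht : 0 < t) :
    balakrishnanIntegrand (X * Y) p t = X * resolventIntegrand (Y * X) p t * Y := by
  have hU := isUnit_smul_one_add_mul hS ht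
  have h2 : Ring.inverse ((t : ℂ) • (1 : H →L[ℂ] H) + Y * X)
      * ((t : ℂ) • (1 : H →L[ℂ] H) + Y * X) = 1 :=
    Ring.inverse_mul_cancel _ (hS.isUnit_smul_one_add ht)
  unfold balakrishnanIntegrand resolventIntegrand
  set R := Ring.inverse ((t : ℂ) • (1 : H →L[ℂ] H) + Y * X) with hR
  have e : X * (Y * X * R) * Y * ((t : ℂ) • (1 : H →L[ℂ] H) + X * Y) = (X * Y) ^ 2 := by
    have e1 : X * (Y * X * R) * Y * ((t : ℂ) • (1 : H →L[ℂ] H) + X * Y)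
        = X * (Y * X) * (R * ((t : ℂ) • (1 : H →L[ℂ] H) + Y * X)) * Y := by
      simp only [mul_add, add_mul, smul_mul_assoc, mul_smul_comm, mul_one, mul_assoc]
    rw [e1, h2, sq]
    simp only [mul_one, mul_assoc]
  rw [mul_smul_comm, smul_mul_assoc, ← e, mul_assoc _ _ (Ring.inverse _),
    Ring.mul_inverse_cancel _ hU, mul_one]

/-- Adding `t ‖S R‖ ≤ ‖S‖` to `‖S‖ ‖S R‖ ≤ 2 ‖S‖`. The bound is a multiple of the scalar integrand
at `s = ‖S‖`, so integrability reduces to the scalar case. -/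
theorem norm_mul_inverse_le {S : H →L[ℂ] H} (hS : S.IsPositive) {t : ℝ} (ht : 0 < t) :
    ‖S * Ring.inverse ((t : ℂ) • (1 : H →L[ℂ] H) + S)‖ ≤ 3 * (‖S‖ / (t + ‖S‖)) := by
  set R := Ring.inverse ((t : ℂ) • (1 : H →L[ℂ] H) + S) with hR
  have hRn : ‖R‖ ≤ t⁻¹ := hS.norm_inverse_le ht
  have htR : t * ‖R‖ ≤ 1 := by
    rw [← mul_inv_cancel₀ ht.ne']; exact mul_le_mul_of_nonneg_left hRn ht.le
  have h1 : ((t : ℂ) • (1 : H →L[ℂ] H) + S) * R = 1 :=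
    Ring.mul_inverse_cancel _ (hS.isUnit_smul_one_add ht)
  have h2 : S * R = 1 - (t : ℂ) • R := by
    rw [eq_sub_iff_add_eq, add_comm, ← h1, add_mul, smul_mul_assoc, one_mul]
  have h3 : ‖S * R‖ ≤ 2 := by
    rw [h2]
    refine (norm_sub_le _ _).trans ?_
    have h4 : ‖(1 : H →L[ℂ] H)‖ ≤ 1 := ContinuousLinearMap.norm_id_le
    rw [norm_smul, Complex.norm_real, Real.norm_of_nonneg ht.le]
    linarith
  have h4 : t * ‖S * R‖ ≤ ‖S‖ := by
    calc t * ‖S * R‖ ≤ t * (‖S‖ * ‖R‖) := mul_le_mul_of_nonneg_left (norm_mul_le _ _) ht.le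
      _ = ‖S‖ * (t * ‖R‖) := by ring
      _ ≤ ‖S‖ * 1 := mul_le_mul_of_nonneg_left htR (norm_nonneg _)
      _ = ‖S‖ := mul_one _
  have hpos : 0 < t + ‖S‖ := by positivity
  rw [← mul_div_assoc, le_div_iff₀ hpos]
  nlinarith [norm_nonneg S]

theorem integrableOn_resolventIntegrand {S : H →L[ℂ] H} (hS : S.IsPositive) {p : ℝ} (hp : 1 < p)
    (hp2 : p < 2) : IntegrableOn (resolventIntegrand S p) (Set.Ioi 0) := by
  have hr : p - 1 ∈ Set.Ioo (0 : ℝ) 1 := ⟨by linarith, by linarith⟩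
  have hb := ((Real.integrableOn_rpowIntegrand₀₁_Ioi hr (norm_nonneg S)).const_mul 3)
  refine Integrable.mono' hb ?_ ?_
  · refine ContinuousOn.aestronglyMeasurable ?_ measurableSet_Ioi
    unfold resolventIntegrand
    have hc1 : ContinuousOn (fun t : ℝ => ((t ^ (p - 2) : ℝ) : ℂ)) (Set.Ioi 0) := by
      refine Complex.continuous_ofReal.comp_continuousOn fun t ht => ?_
      exact (Real.continuousAt_rpow_const t _ (Or.inl (ne_of_gt ht))).continuousWithinAt
    have hc2 : ContinuousOn
        (fun t : ℝ => S * Ring.inverse ((t : ℂ) • (1 : H →L[ℂ] H) + S)) (Set.Ioi 0) := by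
      refine continuousOn_const.mul fun t ht => ContinuousAt.continuousWithinAt ?_
      obtain ⟨u, hu⟩ := hS.isUnit_smul_one_add (t := t) ht
      have h1 := NormedRing.inverse_continuousAt u
      rw [hu] at h1
      refine ContinuousAt.comp (f := fun t : ℝ => (t : ℂ) • (1 : H →L[ℂ] H) + S) h1 ?_
      exact Continuous.continuousAt (by fun_prop)
    exact hc1.smul hc2
  · filter_upwards [ae_restrict_mem measurableSet_Ioi] with t ht
    have ht : 0 < t := ht
    unfold resolventIntegrand
    rw [norm_smul, Complex.norm_real, Real.norm_of_nonneg (Real.rpow_nonneg ht.le _),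
      Real.rpowIntegrand₀₁_eq_pow_div hr ht.le (norm_nonneg S)]
    have h1 := mul_le_mul_of_nonneg_left (norm_mul_inverse_le hS ht)
      (Real.rpow_nonneg ht.le (p - 2))
    refine h1.trans (le_of_eq ?_)
    have : p - 1 - 1 = p - 2 := by ring
    rw [this]; ring

theorem resolventIntegrand_apply {S : H →L[ℂ] H} (hS : S.IsPositive) (p : ℝ) {t s : ℝ}
    (ht : 0 < t) (hs : 0 ≤ s) {v : H} (hv : S v = (s : ℂ) • v) :
    resolventIntegrand S p t v = (t ^ (p - 2) * (s / (t + s))) • v := by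
  have hts : ((t : ℂ) + s) ≠ 0 := by
    have : t + s ≠ 0 := by positivity
    exact_mod_cast this
  have h1 : Ring.inverse ((t : ℂ) • (1 : H →L[ℂ] H) + S) v = ((t : ℂ) + s)⁻¹ • v := by
    have h2 : (Ring.inverse ((t : ℂ) • (1 : H →L[ℂ] H) + S) * ((t : ℂ) • (1 : H →L[ℂ] H) + S)) v
        = v := by
      rw [Ring.inverse_mul_cancel _ (hS.isUnit_smul_one_add ht)]; rfl
    have h3 : ((t : ℂ) • (1 : H →L[ℂ] H) + S) v = ((t : ℂ) + s) • v := by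
      rw [add_apply, smul_apply, one_apply_eq_self, hv, add_smul]
    have h4 : Ring.inverse ((t : ℂ) • (1 : H →L[ℂ] H) + S)
      (((t : ℂ) • (1 : H →L[ℂ] H) + S) v) = v := h2
    rw [h3, map_smul] at h4
    exact (eq_inv_smul_iff₀ hts).2 h4
  unfold resolventIntegrand
  rw [smul_apply]
  change _ • S (Ring.inverse ((t : ℂ) • (1 : H →L[ℂ] H) + S) v) = _
  rw [h1, map_smul, hv, smul_smul, smul_smul, ← Complex.coe_smul]
  congr 1
  push_cast
  field_simp

/-- The power `S^{p-1}` of a positive operator, by the integral over its resolvent. -/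
noncomputable def resolventPow (S : H →L[ℂ] H) (p : ℝ) : H →L[ℂ] H :=
  ((Real.sin (Real.pi * (p - 1)) / Real.pi : ℝ) : ℂ) •
    ∫ t in Set.Ioi (0 : ℝ), resolventIntegrand S p t

theorem resolventPow_apply {S : H →L[ℂ] H} (hS : S.IsPositive) {p : ℝ} (hp : 1 < p) (hp2 : p < 2)
    {s : ℝ} (hs : 0 ≤ s) {v : H} (hv : S v = (s : ℂ) • v) :
    resolventPow S p v = ((s ^ (p - 1) : ℝ) : ℂ) • v := by
  unfold resolventPow
  rw [smul_apply, ContinuousLinearMap.integral_apply (integrableOn_resolventIntegrand hS hp hp2)]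
  have h1 : ∫ t in Set.Ioi (0 : ℝ), resolventIntegrand S p t v
      = ∫ t in Set.Ioi (0 : ℝ), (t ^ (p - 2) * (s / (t + s))) • v :=
    setIntegral_congr_fun measurableSet_Ioi fun t ht => resolventIntegrand_apply hS p ht hs hv
  rw [h1, integral_smul_const, ← Complex.coe_smul, smul_smul, ← Complex.ofReal_mul,
    integral_rpow_mul_div_add hp hp2 hs]

theorem hasFracPow_mul (hS : (Y * X).IsPositive) {p : ℝ} (hp : 1 < p) (hp2 : p < 2) :
    HasFracPow (X * Y) p := by
  refine ⟨fun t ht => isUnit_smul_one_add_mul hS ht, ?_⟩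
  have h1 : IntegrableOn (fun t => X * resolventIntegrand (Y * X) p t * Y) (Set.Ioi 0) :=
    ((integrableOn_resolventIntegrand hS hp hp2).const_mul X).mul_const Y
  exact h1.congr_fun (fun t ht => (balakrishnanIntegrand_mul hS p ht).symm) measurableSet_Ioi

theorem fracPow_mul (hS : (Y * X).IsPositive) {p : ℝ} (hp : 1 < p) (hp2 : p < 2) :
    fracPow (X * Y) p = X * resolventPow (Y * X) p * Y := by
  have hi := integrableOn_resolventIntegrand hS hp hp2
  unfold fracPow resolventPow
  rw [setIntegral_congr_fun measurableSet_Ioi fun t ht => balakrishnanIntegrand_mul hS p ht,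
    integral_mul_const_of_integrable (hi.const_mul X), integral_const_mul_of_integrable hi,
    mul_smul_comm, smul_mul_assoc]

theorem SubOrthonormal.summable_inner_smul {v : ℕ → H} (hv : SubOrthonormal v) (f : H) :
    Summable fun k => inner ℂ (v k) f • v k := by
  rw [summable_iff_vanishing_norm]
  intro ε hε
  obtain ⟨s, hs⟩ := summable_iff_vanishing_norm.1 (hv.summable_inner f) (ε ^ 2) (by positivity)
  refine ⟨s, fun t ht => ?_⟩
  have h1 := hs t ht
  rw [Real.norm_of_nonneg (Finset.sum_nonneg fun _ _ => by positivity)] at h1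
  refine lt_of_pow_lt_pow_left₀ 2 hε.le (lt_of_le_of_lt ?_ h1)
  rw [hv.norm_sum_sq]
  exact Finset.sum_le_sum fun k _ => mul_le_of_le_one_right (by positivity)
    (pow_le_one₀ (norm_nonneg _) (hv.2 k))

theorem IsSpectralSeq.map_eq_zero {S : H →L[ℂ] H} {v : ℕ → H} (hv : IsSpectralSeq S v) {z : H}
    (hz : ∀ k, inner ℂ (v k) z = 0) : S z = 0 := by
  have h1 : ∀ n, ‖S z‖ ≤ singularValue S n * ‖z‖ := by
    intro n
    have h2 := (ContinuousLinearMap.le_opNorm _ z).trans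
      (mul_le_mul_of_nonneg_right (hv.norm_sub_le n) (norm_nonneg z))
    rw [sub_apply, sum_apply, Finset.sum_eq_zero, sub_zero] at h2
    · exact h2
    · intro k _
      rw [smul_apply, InnerProductSpace.rankOne_apply, hz, zero_smul, smul_zero]
  have h2 := ge_of_tendsto' (hv.tendsto.mul_const ‖z‖) h1
  rw [zero_mul] at h2
  exact norm_le_zero_iff.1 h2

/-- Off the span of the eigenvectors `S` vanishes, and `S^{p-1}` vanishes with it because `0 ^ (p -
1) = 0`; on each eigenvector the power is scalar. -/
theorem IsSpectralSeq.hasSum_resolventPow {S : H →L[ℂ] H} {v : ℕ → H} (hS : S.IsPositive)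
    (hv : IsSpectralSeq S v) {p : ℝ} (hp : 1 < p) (hp2 : p < 2) (f : H) :
    HasSum (fun k => inner ℂ (v k) f • ((singularValue S k ^ (p - 1) : ℝ) : ℂ) • v k)
      (resolventPow S p f) := by
  obtain ⟨g, hg⟩ := hv.orth.summable_inner_smul f
  have hz : ∀ j, inner ℂ (v j) (f - g) = 0 := by
    intro j
    have h1 := (innerSL ℂ (v j)).hasSum hg
    have h2 : HasSum (fun k => innerSL ℂ (v j) (inner ℂ (v k) f • v k)) (inner ℂ (v j) f) := by
      have h3 : innerSL ℂ (v j) (inner ℂ (v j) f • v j) = inner ℂ (v j) f := by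
        rw [innerSL_apply_apply, inner_smul_right, inner_self_eq_ofReal]
        rcases eq_or_ne (singularValue S j) 0 with h | h
        · simp [hv.eq_zero j h]
        · simp [hv.norm_eq_one j h]
      have h4 := hasSum_single (f := fun k => innerSL ℂ (v j) (inner ℂ (v k) f • v k)) j
        fun k hk => by
          rw [innerSL_apply_apply, inner_smul_right, hv.orth.1 j k hk.symm, mul_zero]
      rwa [h3] at h4
    rw [inner_sub_right, sub_eq_zero]
    exact h2.unique h1
  have h0 : S (f - g) = 0 := hv.map_eq_zero hz
  have h1 : resolventPow S p (f - g) = 0 := by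
    rw [resolventPow_apply hS hp hp2 le_rfl (by rw [h0]; simp),
      Real.zero_rpow (by linarith : p - 1 ≠ 0)]
    simp
  have h2 : resolventPow S p f = resolventPow S p g := by
    rwa [map_sub, sub_eq_zero] at h1
  have h3 := (resolventPow S p).hasSum hg
  rw [h2]
  convert h3 using 2 with k
  rw [map_smul, resolventPow_apply hS hp hp2 (singularValue_nonneg S k) (hv.map_eq k)]

end Balakrishnan

/-! ### Jensen's inequality for double sums -/

/-- Weighted Hölder gives `d_j ^ p ≤ κ ^ (p - 1) ∑_i c_i ^ p w_ij`; then sum over `j` first. The row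
and column sums of `w` thus enter with different powers. Finite sums come first, so that summability
of `d_j ^ p` is a conclusion. -/
theorem summable_rpow_of_hasSum_mul {I J : Type*} {c : I → ℝ} {d : J → ℝ} {w : I → J → ℝ}
    {κ α p : ℝ} (hp : 1 < p) (hκ : 0 ≤ κ) (hα : 0 ≤ α) (hc : ∀ i, 0 ≤ c i) (hw : ∀ i j, 0 ≤ w i j)
    (hd : ∀ j, HasSum (fun i => c i * w i j) (d j))
    (h1 : ∀ j (t : Finset I), ∑ i ∈ t, w i j ≤ κ)
    (h2 : ∀ i (s : Finset J), ∑ j ∈ s, w i j ≤ α) (hs : Summable fun i => c i ^ p) :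
    (Summable fun j => d j ^ p) ∧
      ∑' j, d j ^ p ≤ κ ^ (p - 1) * α * ∑' i, c i ^ p := by
  have hp0 : 0 < p := by linarith
  have hd0 : ∀ j, 0 ≤ d j := fun j => (hd j).nonneg fun i => mul_nonneg (hc i) (hw i j)
  have hcp : ∀ i, 0 ≤ c i ^ p := fun i => Real.rpow_nonneg (hc i) p
  have key : ∀ j (t : Finset I),
      (∑ i ∈ t, c i * w i j) ^ p ≤ κ ^ (p - 1) * ∑ i ∈ t, c i ^ p * w i j := by
    intro j t
    have hW : 0 ≤ ∑ i ∈ t, w i j := Finset.sum_nonneg fun i _ => hw i j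
    have hV : 0 ≤ ∑ i ∈ t, w i j * c i ^ p :=
      Finset.sum_nonneg fun i _ => mul_nonneg (hw i j) (hcp i)
    have h3 := Real.inner_le_weight_mul_Lp_of_nonneg t hp.le (fun i => w i j) c
      (fun i => hw i j) hc
    have h4 := Real.rpow_le_rpow (Finset.sum_nonneg fun i _ => mul_nonneg (hw i j) (hc i)) h3 hp0.le
    rw [Real.mul_rpow (Real.rpow_nonneg hW _) (Real.rpow_nonneg hV _), ← Real.rpow_mul hW,
      ← Real.rpow_mul hV, inv_mul_cancel₀ hp0.ne', Real.rpow_one] at h4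
    have e1 : (1 - p⁻¹) * p = p - 1 := by field_simp
    rw [e1] at h4
    simp only [mul_comm (w _ j)] at h4
    refine h4.trans (mul_le_mul_of_nonneg_right (Real.rpow_le_rpow hW (h1 j t) (by linarith)) ?_)
    exact Finset.sum_nonneg fun i _ => mul_nonneg (hcp i) (hw i j)
  have key2 : ∀ s : Finset J, ∑ j ∈ s, d j ^ p ≤ κ ^ (p - 1) * α * ∑' i, c i ^ p := by
    intro s
    have hlim : Tendsto (fun t : Finset I => ∑ j ∈ s, (∑ i ∈ t, c i * w i j) ^ p) atTop
        (𝓝 (∑ j ∈ s, d j ^ p)) :=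
      tendsto_finsetSum _ fun j _ => (hd j).rpow_const (Or.inr hp0.le)
    refine le_of_tendsto' hlim fun t => ?_
    refine (Finset.sum_le_sum fun j _ => key j t).trans ?_
    rw [← Finset.mul_sum, Finset.sum_comm, mul_assoc]

    refine mul_le_mul_of_nonneg_left ?_ (Real.rpow_nonneg hκ _)
    rw [← tsum_mul_left]
    refine le_trans (Finset.sum_le_sum fun i _ => ?_)
      ((hs.mul_left α).sum_le_tsum t fun i _ => mul_nonneg hα (hcp i))
    rw [← Finset.mul_sum, mul_comm]
    exact mul_le_mul_of_nonneg_right (h2 i s) (hcp i)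
  have hdp : ∀ j, 0 ≤ d j ^ p := fun j => Real.rpow_nonneg (hd0 j) p
  have hsum := summable_of_sum_le hdp key2
  exact ⟨hsum, hsum.tsum_le_of_sum_le key2⟩

/-! ### Diagonal operators -/

section Diagonal

variable {H : Type*} [NormedAddCommGroup H] [InnerProductSpace ℂ H] [CompleteSpace H] {J : Type*}

theorem IsSpectralSeq.hasSum_inner {T : H →L[ℂ] H} {v : ℕ → H} (hv : IsSpectralSeq T v) (x : H) :
    HasSum (fun k => singularValue T k * ‖inner ℂ (v k) x‖ ^ 2) (inner ℂ (T x) x).re := by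
  rw [hasSum_iff_tendsto_nat_of_nonneg
    fun k => mul_nonneg (singularValue_nonneg T k) (by positivity)]
  have h1 : Tendsto (fun n => (inner ℂ (T x) x).re - singularValue T n * ‖x‖ ^ 2) atTop
      (𝓝 (inner ℂ (T x) x).re) := by
    simpa using (hv.tendsto.mul_const (‖x‖ ^ 2)).const_sub (inner ℂ (T x) x).re
  refine tendsto_of_tendsto_of_tendsto_of_le_of_le h1 tendsto_const_nhds (fun n => ?_)
    fun n => hv.sum_le n x
  have h2 := hv.le_sum n x
  have h3 : 0 ≤ singularValue T n * ∑ k ∈ Finset.range n, ‖inner ℂ (v k) x‖ ^ 2 :=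
    mul_nonneg (singularValue_nonneg T n) (Finset.sum_nonneg fun _ _ => by positivity)
  simp only
  linarith

/-- A finite sum of this kind has norm at most the largest `|c j|` involved, so the tails are small
in operator norm although the series need not converge absolutely. -/
theorem SubOrthonormal.summable_smul_rankOne {e : J → H} (he : SubOrthonormal e) {c : J → ℝ}
    (hc : Tendsto c cofinite (𝓝 0)) :
    Summable fun j => ((c j : ℂ) • InnerProductSpace.rankOne ℂ (e j) (e j) : H →L[ℂ] H) := by
  rw [summable_iff_vanishing_norm]
  intro ε hε
  have h1 := hc.eventually (Metric.ball_mem_nhds (0 : ℝ) (half_pos hε))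
  refine ⟨(Filter.eventually_cofinite.1 h1).toFinset, fun t ht => ?_⟩
  have h2 : ∀ j ∈ t, |c j| ≤ ε / 2 := by
    intro j hj
    by_contra hcon
    refine Finset.disjoint_left.1 ht hj ?_
    rw [Set.Finite.mem_toFinset]
    intro hb
    have hb : dist (c j) 0 < ε / 2 := hb
    rw [dist_zero_right, Real.norm_eq_abs] at hb
    exact hcon hb.le
  refine lt_of_le_of_lt (ContinuousLinearMap.opNorm_le_bound _ (half_pos hε).le fun x => ?_)
    (half_lt_self hε)
  refine le_of_sq_le_sq ?_ (by positivity)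
  rw [sum_apply]
  simp only [smul_apply, InnerProductSpace.rankOne_apply, smul_smul]
  rw [he.norm_sum_sq, mul_pow]
  calc ∑ j ∈ t, ‖(c j : ℂ) * inner ℂ (e j) x‖ ^ 2 * ‖e j‖ ^ 2
      ≤ ∑ j ∈ t, (ε / 2) ^ 2 * ‖inner ℂ (e j) x‖ ^ 2 := by
        refine Finset.sum_le_sum fun j hj => ?_
        rw [norm_mul, mul_pow, Complex.norm_real, Real.norm_eq_abs]
        refine (mul_le_of_le_one_right (by positivity)
          (pow_le_one₀ (norm_nonneg _) (he.2 j))).trans ?_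
        gcongr
        exact h2 j hj
    _ ≤ (ε / 2) ^ 2 * ‖x‖ ^ 2 := by
        rw [← Finset.mul_sum]
        exact mul_le_mul_of_nonneg_left (he.sum_inner_le t x) (by positivity)

/-- There is a compact self-adjoint operator that is diagonal in a given orthonormal basis with
given real entries tending to zero. -/
theorem HilbertBasis.exists_diagonal (e : HilbertBasis J ℂ H) {c : J → ℝ}
    (hc : Tendsto c cofinite (𝓝 0)) :
    ∃ Y : H →L[ℂ] H, IsSelfAdjoint Y ∧ IsCompactOperator Y ∧ ∀ j, Y (e j) = (c j : ℂ) • e j := by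
  have he : SubOrthonormal e := e.orthonormal.subOrthonormal
  obtain ⟨Y, hY⟩ := he.summable_smul_rankOne hc
  refine ⟨Y, ?_, ?_, fun j => ?_⟩
  · have h1 := hY.star
    refine HasSum.unique ?_ hY
    convert h1 using 2 with j
    rw [star_smul, ContinuousLinearMap.star_eq_adjoint, InnerProductSpace.adjoint_rankOne]
    simp
  · refine isCompactOperator_of_tendsto hY (Eventually.of_forall fun s => ?_)
    exact (compactOperator (RingHom.id ℂ) H H).sum_mem
      (f := fun j => ((c j : ℂ) • InnerProductSpace.rankOne ℂ (e j) (e j) : H →L[ℂ] H))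
      fun j _ => (isCompactOperator_rankOne _ _).smul (c j : ℂ)
  · have h1 := (ContinuousLinearMap.apply ℂ H (e j)).hasSum hY
    have h2 : ∀ k ≠ j, ContinuousLinearMap.apply ℂ H (e j)
        ((c k : ℂ) • InnerProductSpace.rankOne ℂ (e k) (e k)) = 0 := by
      intro k hk
      simp [e.orthonormal.2 hk]
    refine (h1.unique (hasSum_single j h2)).trans ?_
    simp [e.orthonormal.1 j]

theorem HilbertBasis.ext_clm (e : HilbertBasis J ℂ H) {S T : H →L[ℂ] H}
    (h : ∀ j, S (e j) = T (e j)) : S = T := by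
  refine ContinuousLinearMap.ext_on (s := Set.range e) ?_ ?_
  · exact Submodule.dense_iff_topologicalClosure_eq_top.2 e.dense_span
  · rintro _ ⟨j, rfl⟩
    exact h j

theorem HilbertBasis.hasSum_norm_sq (e : HilbertBasis J ℂ H) (x : H) :
    HasSum (fun j => ‖inner ℂ (e j) x‖ ^ 2) (‖x‖ ^ 2) := by
  have h1 := Complex.hasSum_re (e.hasSum_inner_mul_inner x x)
  rw [inner_self_eq_ofReal, Complex.ofReal_re] at h1
  convert h1 using 2 with j
  rw [← inner_conj_symm, Complex.mul_conj', ← Complex.ofReal_pow, Complex.ofReal_re,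
    RCLike.norm_conj]

end Diagonal

/-! ### Products of a positive operator with a diagonal operator -/

section SymbolProduct

open ContinuousLinearMap (adjoint)

variable {H : Type*} [NormedAddCommGroup H] [InnerProductSpace ℂ H] [CompleteSpace H] {J : Type*}

/-- The operator `A` is the product of the positive operator `K† K` with the operator that is
diagonal in the basis `e`, with entries `b`. -/
structure IsSymbolProduct (e : HilbertBasis J ℂ H) (b : J → ℝ) (α : ℝ) (K A : H →L[ℂ] H) :
    Prop where
  nonneg : ∀ j, 0 ≤ b j
  summable : ∀ p : ℝ, 1 < p → Summable fun j => b j ^ p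
  map_eq : ∀ j, A (e j) = (b j : ℂ) • adjoint K (K (e j))
  norm_sq : ∀ j, ‖K (e j)‖ ^ 2 = α

/-- A compact self-adjoint operator with `Y e_j = √b_j e_j`. -/
structure IsDiagonalSqrt (e : HilbertBasis J ℂ H) (b : J → ℝ) (Y : H →L[ℂ] H) : Prop where
  isSelfAdjoint : IsSelfAdjoint Y
  isCompactOperator : IsCompactOperator Y
  map_eq : ∀ j, Y (e j) = (√(b j) : ℂ) • e j

variable {e : HilbertBasis J ℂ H} {b : J → ℝ} {α : ℝ} {K A Y : H →L[ℂ] H}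

theorem IsSymbolProduct.exists_isDiagonalSqrt (hA : IsSymbolProduct e b α K A) :
    ∃ Y, IsDiagonalSqrt e b Y := by
  -- Only exponents above `1` are summable, so the decay is read off from `b_j²` by taking two
  -- square roots.
  have h1 : Tendsto (fun j => √(b j)) cofinite (𝓝 0) := by
    have h2 := (hA.summable 2 one_lt_two).tendsto_cofinite_zero
    have h3 := (h2.sqrt).sqrt
    rw [Real.sqrt_zero, Real.sqrt_zero] at h3
    refine h3.congr fun j => ?_
    rw [Real.rpow_two, Real.sqrt_sq (hA.nonneg j)]
  obtain ⟨Y, h2, h3, h4⟩ := e.exists_diagonal h1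
  exact ⟨Y, h2, h3, h4⟩

theorem IsDiagonalSqrt.inner_map (hY : IsDiagonalSqrt e b Y) (x y : H) :
    inner ℂ (Y x) y = inner ℂ x (Y y) := by
  rw [← ContinuousLinearMap.adjoint_inner_right, hY.isSelfAdjoint.adjoint_eq]

theorem IsDiagonalSqrt.sq_map_eq (hY : IsDiagonalSqrt e b Y) (hb : ∀ j, 0 ≤ b j) (j : J) :
    (Y * Y) (e j) = (b j : ℂ) • e j := by
  change Y (Y (e j)) = _
  rw [hY.map_eq, map_smul, hY.map_eq, smul_smul, ← Complex.ofReal_mul, Real.mul_self_sqrt (hb j)]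

theorem IsSymbolProduct.eq_mul (hA : IsSymbolProduct e b α K A) (hY : IsDiagonalSqrt e b Y) :
    A = adjoint K * K * (Y * Y) := by
  refine e.ext_clm fun j => ?_
  change _ = adjoint K (K ((Y * Y) (e j)))
  rw [hY.sq_map_eq hA.nonneg, map_smul, map_smul, hA.map_eq]

/-- The case `K = 1`: the estimates for products then apply to the diagonal factor `Y²` itself. -/
theorem IsDiagonalSqrt.isSymbolProduct_sq (hY : IsDiagonalSqrt e b Y) (hb : ∀ j, 0 ≤ b j)
    (hs : ∀ p : ℝ, 1 < p → Summable fun j => b j ^ p) : IsSymbolProduct e b 1 1 (Y * Y) where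
  nonneg := hb
  summable := hs
  map_eq j := by
    rw [hY.sq_map_eq hb, ← ContinuousLinearMap.star_eq_adjoint, star_one]
    rfl
  norm_sq j := by simp [e.orthonormal.1 j]

theorem IsDiagonalSqrt.hasSum_norm_map_sq (hY : IsDiagonalSqrt e b Y) (hb : ∀ j, 0 ≤ b j) (x : H) :
    HasSum (fun j => b j * ‖inner ℂ (e j) x‖ ^ 2) (‖Y x‖ ^ 2) := by
  convert e.hasSum_norm_sq (Y x) using 2 with j
  rw [← hY.inner_map, hY.map_eq, inner_smul_left, norm_mul, mul_pow, Complex.conj_ofReal,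
    Complex.norm_real, Real.norm_of_nonneg (Real.sqrt_nonneg _), Real.sq_sqrt (hb j)]

/-- Jensen with both constants `1`, as the squared coefficients between the two families have row
and column sums at most `1`. -/
theorem IsDiagonalSqrt.summable_norm_map_sq_rpow (hY : IsDiagonalSqrt e b Y) (hb : ∀ j, 0 ≤ b j)
    {v : ℕ → H} (hv : SubOrthonormal v) {p : ℝ} (hp : 1 < p) (hs : Summable fun j => b j ^ p) :
    Summable fun k => (‖Y (v k)‖ ^ 2) ^ p := by
  refine (summable_rpow_of_hasSum_mul (w := fun j k => ‖inner ℂ (e j) (v k)‖ ^ 2) (κ := 1) (α := 1)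
    hp zero_le_one zero_le_one hb (fun _ _ => by positivity)
    (fun k => hY.hasSum_norm_map_sq hb (v k)) (fun k t => ?_) (fun j s => ?_) hs).1
  · exact (e.orthonormal.subOrthonormal.sum_inner_le t (v k)).trans
      (pow_le_one₀ (norm_nonneg _) (hv.2 k))
  · simp only [norm_inner_symm (e j)]
    refine (hv.sum_inner_le s (e j)).trans ?_
    rw [e.orthonormal.1 j, one_pow]

/-- The operator `Y K† K Y` is positive, being `W† W` for `W = K Y`. -/
theorem IsDiagonalSqrt.conj_eq (hY : IsDiagonalSqrt e b Y) (K : H →L[ℂ] H) :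
    Y * (adjoint K * K) * Y = adjoint (K * Y) * (K * Y) := by
  rw [← ContinuousLinearMap.star_eq_adjoint, ← ContinuousLinearMap.star_eq_adjoint, star_mul,
    hY.isSelfAdjoint.star_eq]
  simp only [mul_assoc]

theorem IsDiagonalSqrt.isCompactOperator_mul (hY : IsDiagonalSqrt e b Y) (K : H →L[ℂ] H) :
    IsCompactOperator (K * Y) :=
  IsCompactOperator.clm_comp (f := Y) hY.isCompactOperator K

theorem IsDiagonalSqrt.isCompactOperator_conj (hY : IsDiagonalSqrt e b Y) (K : H →L[ℂ] H) :
    IsCompactOperator (Y * (adjoint K * K) * Y) :=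
  hY.isCompactOperator_mul _

theorem IsDiagonalSqrt.isPositive_conj (hY : IsDiagonalSqrt e b Y) (K : H →L[ℂ] H) :
    (Y * (adjoint K * K) * Y).IsPositive := by
  rw [hY.conj_eq]
  exact ContinuousLinearMap.isPositive_adjoint_comp_self _

theorem IsDiagonalSqrt.inner_conj (hY : IsDiagonalSqrt e b Y) (K : H →L[ℂ] H) (x : H) :
    (inner ℂ ((Y * (adjoint K * K) * Y) x) x).re = ‖K (Y x)‖ ^ 2 := by
  have h1 : inner ℂ ((Y * (adjoint K * K) * Y) x) x = inner ℂ (K (Y x)) (K (Y x)) := by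
    rw [hY.conj_eq]
    change inner ℂ (adjoint (K * Y) ((K * Y) x)) x = inner ℂ ((K * Y) x) ((K * Y) x)
    rw [ContinuousLinearMap.adjoint_inner_left]
  rw [h1, inner_self_eq_ofReal, Complex.ofReal_re]

/-- Pass to `W W† = K Y² K†` with `W = K Y`: its eigenvalue at `u_k` is `∑_j b_j |⟨e_j, K† u_k⟩|²`.
These weights sum to at most `‖K‖²` over `j` and to at most `‖K e_j‖² = α` over `k`. Jensen thus
yields `α` to the first power, with `‖K‖²` only to the power `p - 1`. -/
theorem IsSymbolProduct.sum_singularValue_rpow_le (hA : IsSymbolProduct e b α K A)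
    (hY : IsDiagonalSqrt e b Y) {p κ : ℝ} (hp : 1 < p) (hκ : ‖K‖ ^ 2 ≤ κ) :
    (Summable fun k => singularValue (Y * (adjoint K * K) * Y) k ^ p) ∧
      ∑' k, singularValue (Y * (adjoint K * K) * Y) k ^ p ≤ κ ^ (p - 1) * α * ∑' j, b j ^ p := by
  set W := K * Y with hW
  have hWc : IsCompactOperator W := hY.isCompactOperator_mul K
  have hc1 : IsCompactOperator (adjoint W * W) := IsCompactOperator.clm_comp (f := W) hWc (adjoint W)
  have hc2 : IsCompactOperator (W * adjoint W) := hWc.comp_clm (adjoint W)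
  have hpos : (W * adjoint W).IsPositive := by
    have := ContinuousLinearMap.isPositive_adjoint_comp_self (adjoint W)
    rwa [ContinuousLinearMap.adjoint_adjoint] at this
  obtain ⟨u, hu⟩ := exists_isSpectralSeq hpos hc2
  have hα : ∀ j, ‖K (e j)‖ ^ 2 ≤ |α| := fun j => (hA.norm_sq j).trans_le (le_abs_self α)
  have hadj : ∀ j k, ‖inner ℂ (e j) (adjoint K (u k))‖ = ‖inner ℂ (u k) (K (e j))‖ := by
    intro j k
    rw [ContinuousLinearMap.adjoint_inner_right, norm_inner_symm]
  have hadjW : adjoint W = Y * adjoint K := by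
    rw [hW, ← ContinuousLinearMap.star_eq_adjoint, ← ContinuousLinearMap.star_eq_adjoint, star_mul,
      hY.isSelfAdjoint.star_eq]
  have h0 : 0 ≤ κ := le_trans (by positivity) hκ
  have hd : ∀ k, HasSum (fun j => b j * ‖inner ℂ (e j) (adjoint K (u k))‖ ^ 2)
      (singularValue (Y * (adjoint K * K) * Y) k) := by
    intro k
    have h1 := hY.hasSum_norm_map_sq hA.nonneg (adjoint K (u k))
    have h2 : ‖Y (adjoint K (u k))‖ ^ 2 = singularValue (Y * (adjoint K * K) * Y) k := by
      rw [hY.conj_eq, ← hW, singularValue_adjoint_comp_self W hc1 hc2, ← hu.inner_map_self k]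
      have h3 : inner ℂ ((W * adjoint W) (u k)) (u k)
          = inner ℂ (Y (adjoint K (u k))) (Y (adjoint K (u k))) := by
        have h4 : Y (adjoint K (u k)) = adjoint W (u k) := by rw [hadjW]; rfl
        rw [h4]
        exact (ContinuousLinearMap.adjoint_inner_right W _ _).symm
      rw [h3, inner_self_eq_ofReal, Complex.ofReal_re]
    rwa [h2] at h1
  have hw1 : ∀ k (t : Finset J), ∑ j ∈ t, ‖inner ℂ (e j) (adjoint K (u k))‖ ^ 2 ≤ κ := by
    intro k t
    refine (e.orthonormal.subOrthonormal.sum_inner_le t _).trans (le_trans ?_ hκ)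
    refine pow_le_pow_left₀ (norm_nonneg _) (((adjoint K).le_opNorm _).trans ?_) 2
    rw [LinearIsometryEquiv.norm_map]
    exact mul_le_of_le_one_right (norm_nonneg _) (hu.orth.2 k)
  -- For empty `J` the sign of `α` is not determined, and Jensen is used with constant `0` instead.
  rcases isEmpty_or_nonempty J with hJ | ⟨⟨j0⟩⟩
  · have h1 := summable_rpow_of_hasSum_mul hp h0 le_rfl hA.nonneg (fun _ _ => by positivity) hd hw1
      (fun j => isEmptyElim j) (hA.summable p hp)
    simpa using h1
  · refine summable_rpow_of_hasSum_mul hp h0 ?_ hA.nonneg (fun _ _ => by positivity) hd hw1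
      (fun j s => ?_) (hA.summable p hp)
    · rw [← hA.norm_sq j0]; positivity
    · simp only [hadj]
      exact (hu.orth.sum_inner_le s _).trans_eq (hA.norm_sq j)

/-- Jensen in the opposite direction: `α b_j = ⟨S e_j, e_j⟩` is an average of the eigenvalues of `S`
with weights `|⟨v_k, e_j⟩|²`, whose sums in either index are at most `1`. -/
theorem IsSymbolProduct.le_sum_singularValue_rpow (hA : IsSymbolProduct e b α K A) (hα : 0 ≤ α)
    (hY : IsDiagonalSqrt e b Y) {p : ℝ} (hp : 1 < p) :
    α ^ p * ∑' j, b j ^ p ≤ ∑' k, singularValue (Y * (adjoint K * K) * Y) k ^ p := by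
  obtain ⟨v, hv⟩ := exists_isSpectralSeq (hY.isPositive_conj K) (hY.isCompactOperator_conj K)
  have hs := (hA.sum_singularValue_rpow_le hY hp le_rfl).1
  have h1 := summable_rpow_of_hasSum_mul (d := fun j => b j * α)
    (w := fun k j => ‖inner ℂ (v k) (e j)‖ ^ 2) hp zero_le_one
    zero_le_one (singularValue_nonneg _) (fun _ _ => by positivity) (fun j => ?_) (fun j t => ?_)
    (fun k s => ?_) hs
  · have h2 := h1.2
    rw [Real.one_rpow, one_mul, one_mul] at h2
    refine le_trans (le_of_eq ?_) h2
    rw [← tsum_mul_left]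
    refine tsum_congr fun j => ?_
    rw [Real.mul_rpow (hA.nonneg j) hα, mul_comm]
  · have h2 := hv.hasSum_inner (e j)
    rw [hY.inner_conj, hY.map_eq, map_smul, norm_smul, mul_pow, hA.norm_sq, Complex.norm_real,
      Real.norm_of_nonneg (Real.sqrt_nonneg _), Real.sq_sqrt (hA.nonneg j)] at h2
    exact h2
  · refine (hv.orth.sum_inner_le t (e j)).trans_eq ?_
    rw [e.orthonormal.1 j, one_pow]
  · simp only [norm_inner_symm (v k)]
    exact (e.orthonormal.subOrthonormal.sum_inner_le s (v k)).trans
      (pow_le_one₀ (norm_nonneg _) (hv.orth.2 k))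

/-- Replace the smaller of `√s` and `q` by the larger. With `q = ‖Y v_k‖` this makes the nuclear
series of `A^p` summable. -/
theorem rpow_sub_one_mul_sqrt_mul_le {s q p : ℝ} (hs : 0 ≤ s) (hq : 0 ≤ q) (hp : 1 < p) :
    s ^ (p - 1) * √s * q ≤ s ^ p + (q ^ 2) ^ p := by
  have h1 : ∀ x : ℝ, 0 ≤ x → x ^ (p - 1) * x = x ^ p := by
    intro x hx
    conv_rhs => rw [← sub_add_cancel p 1]
    rw [Real.rpow_add_one' hx (by linarith)]
  have h2 := Real.rpow_nonneg hs p
  have h3 := Real.rpow_nonneg (sq_nonneg q) p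
  rcases le_total q √s with h | h
  · have h4 : s ^ (p - 1) * √s * q ≤ s ^ (p - 1) * √s * √s := by gcongr
    rw [mul_assoc, mul_assoc, Real.mul_self_sqrt hs, h1 s hs] at h4
    rw [mul_assoc]
    linarith
  · have h5 : s ≤ q ^ 2 := by
      rw [← Real.sq_sqrt hs]
      exact pow_le_pow_left₀ (Real.sqrt_nonneg _) h 2
    have h4 : s ^ (p - 1) * √s * q ≤ (q ^ 2) ^ (p - 1) * q * q := by
      gcongr
    rw [mul_assoc _ q q, ← sq, h1 _ (sq_nonneg q)] at h4
    linarith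

theorem IsSymbolProduct.hasFracPow (hA : IsSymbolProduct e b α K A) {p : ℝ} (hp : 1 < p)
    (hp2 : p < 2) : HasFracPow A p := by
  obtain ⟨Y, hY⟩ := hA.exists_isDiagonalSqrt
  have e1 : A = adjoint K * K * Y * Y := by rw [hA.eq_mul hY, mul_assoc _ Y Y]
  have hS : (Y * (adjoint K * K * Y)).IsPositive := by
    rw [← mul_assoc]; exact hY.isPositive_conj K
  rw [e1]
  exact hasFracPow_mul hS hp hp2

/-- Expanding `A^p = X S^{p-1} Y` in eigenvectors `v_k` of `S = Y X` gives `x_k = s_k ^ (p - 1) X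
v_k` and `y_k = Y v_k`. Here `‖X v_k‖ ≤ ‖K‖ √s_k`, and `⟨Y v_k, X v_k⟩ = ⟨v_k, S v_k⟩ = s_k`. -/
theorem IsSymbolProduct.exists_isNuclearSum (hA : IsSymbolProduct e b α K A)
    (hY : IsDiagonalSqrt e b Y) {p : ℝ} (hp : 1 < p) (hp2 : p < 2) :
    ∃ x y : ℕ → H, IsNuclearSum (fracPow A p) x y ∧
      ∀ k, inner ℂ (y k) (x k) = ((singularValue (Y * (adjoint K * K) * Y) k ^ p : ℝ) : ℂ) := by
  set X := adjoint K * K * Y with hX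
  have e1 : A = X * Y := by rw [hA.eq_mul hY, hX, mul_assoc _ Y Y]
  have e2 : Y * (adjoint K * K) * Y = Y * X := by simp only [hX, mul_assoc]
  have hS : (Y * X).IsPositive := e2 ▸ hY.isPositive_conj K
  have hsum := (hA.sum_singularValue_rpow_le hY hp le_rfl).1
  rw [e2] at hsum ⊢
  obtain ⟨v, hv⟩ := exists_isSpectralSeq hS (e2 ▸ hY.isCompactOperator_conj K)
  set s := singularValue (Y * X) with hs
  have hs0 : ∀ k, 0 ≤ s k := singularValue_nonneg _
  have hKY : ∀ k, ‖K (Y (v k))‖ = √(s k) := by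
    intro k
    rw [← Real.sqrt_sq (norm_nonneg (K (Y (v k)))), ← hY.inner_conj K, e2, hv.inner_map_self]
  have hXn : ∀ k, ‖X (v k)‖ ≤ ‖K‖ * √(s k) := by
    intro k
    rw [← hKY]
    have h1 := (adjoint K).le_opNorm (K (Y (v k)))
    rwa [LinearIsometryEquiv.norm_map] at h1
  refine ⟨fun k => ((s k ^ (p - 1) : ℝ) : ℂ) • X (v k), fun k => Y (v k), ⟨?_, fun f => ?_⟩,
    fun k => ?_⟩
  · have h1 := (hsum.add (hY.summable_norm_map_sq_rpow hA.nonneg hv.orth hp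
      (hA.summable p hp))).mul_left ‖K‖
    refine Summable.of_nonneg_of_le (fun k => by positivity) (fun k => ?_) h1
    have h2 : 0 ≤ s k ^ (p - 1) := Real.rpow_nonneg (hs0 k) _
    rw [norm_smul, Complex.norm_real, Real.norm_of_nonneg h2]
    calc s k ^ (p - 1) * ‖X (v k)‖ * ‖Y (v k)‖
        ≤ s k ^ (p - 1) * (‖K‖ * √(s k)) * ‖Y (v k)‖ := by
          gcongr
          exact hXn k
      _ = ‖K‖ * (s k ^ (p - 1) * √(s k) * ‖Y (v k)‖) := by ring
      _ ≤ _ := by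
          refine mul_le_mul_of_nonneg_left ?_ (norm_nonneg _)
          exact rpow_sub_one_mul_sqrt_mul_le (hs0 k) (norm_nonneg _) hp
  · rw [e1, fracPow_mul hS hp hp2]
    have h1 := X.hasSum (hv.hasSum_resolventPow hS hp hp2 (Y f))
    change HasSum _ (X (resolventPow (Y * X) p (Y f)))
    simpa only [map_smul, hY.inner_map] using h1
  · rw [inner_smul_right, hY.inner_map]
    have h1 : Y (X (v k)) = (s k : ℂ) • v k := hv.map_eq k
    rw [h1, inner_smul_right, inner_self_eq_ofReal, ← Complex.ofReal_mul, hv.mul_norm_sq,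
      ← Complex.ofReal_mul]
    congr 1
    change s k ^ (p - 1) * s k = s k ^ p
    conv_rhs => rw [← sub_add_cancel p 1]
    rw [Real.rpow_add_one' (hs0 k) (by linarith)]

/-- Powers of `A` are trace class, and their traces are comparable to the sums of the `b_j^p`. -/
theorem IsSymbolProduct.exists_trace (hA : IsSymbolProduct e b α K A) (hα : 0 ≤ α) :
    ∃ τ : ℝ → ℝ, ∀ p : ℝ, 1 < p → p < 2 →
      (∃ x y : ℕ → H, IsNuclearSum (fracPow A p) x y) ∧
      opTrace (fracPow A p) = (τ p : ℂ) ∧ α ^ p * ∑' j, b j ^ p ≤ τ p ∧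
      τ p ≤ (‖K‖ ^ 2 + 1) ^ (p - 1) * α * ∑' j, b j ^ p := by
  obtain ⟨Y, hY⟩ := hA.exists_isDiagonalSqrt
  refine ⟨fun p => ∑' k, singularValue (Y * (adjoint K * K) * Y) k ^ p, fun p hp hp2 => ?_⟩
  obtain ⟨x, y, hxy, htr⟩ := hA.exists_isNuclearSum hY hp hp2
  refine ⟨⟨x, y, hxy⟩, ?_, hA.le_sum_singularValue_rpow hα hY hp,
    (hA.sum_singularValue_rpow_le hY hp (by linarith)).2⟩
  rw [hxy.opTrace_eq, tsum_congr htr, Complex.ofReal_tsum]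

/-- Squeezing: `α ^ p → α` while `κ ^ (p - 1) → 1`. The latter needs `κ > 0`, which is why `‖K‖² +
1` is used in place of `‖K‖²`. -/
theorem tendsto_mul_of_le_of_le {f g : ℝ → ℝ} {α κ ℓ : ℝ} (hκ : 0 < κ)
    (hg : Tendsto (fun p : ℝ => (p - 1) * g p) (𝓝[>] 1) (𝓝 ℓ))
    (h1 : ∀ p : ℝ, 1 < p → p < 2 → α ^ p * g p ≤ f p)
    (h2 : ∀ p : ℝ, 1 < p → p < 2 → f p ≤ κ ^ (p - 1) * α * g p) :
    Tendsto (fun p : ℝ => (p - 1) * f p) (𝓝[>] 1) (𝓝 (α * ℓ)) := by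
  have hα : Tendsto (fun p : ℝ => α ^ p) (𝓝[>] 1) (𝓝 α) := by
    have h3 : Tendsto (fun p : ℝ => α ^ p) (𝓝 1) (𝓝 (α ^ (1 : ℝ))) :=
      Real.continuousAt_const_rpow' one_ne_zero
    rw [Real.rpow_one] at h3
    exact h3.mono_left nhdsWithin_le_nhds
  have hκ' : Tendsto (fun p : ℝ => κ ^ (p - 1)) (𝓝[>] 1) (𝓝 1) := by
    have h3 : ContinuousAt (fun p : ℝ => κ ^ (p - 1)) 1 := by
      refine ContinuousAt.comp (g := fun q : ℝ => κ ^ q) (f := fun p : ℝ => p - 1) ?_ (by fun_prop)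
      exact Real.continuousAt_const_rpow hκ.ne'
    have h4 : Tendsto (fun p : ℝ => κ ^ (p - 1)) (𝓝 1) (𝓝 (κ ^ ((1 : ℝ) - 1))) := h3
    rw [sub_self, Real.rpow_zero] at h4
    exact h4.mono_left nhdsWithin_le_nhds
  have h3 := (hκ'.mul_const α).mul hg
  rw [one_mul] at h3
  have hI : ∀ᶠ p : ℝ in 𝓝[>] 1, p ∈ Set.Ioo (1 : ℝ) 2 := Ioo_mem_nhdsGT one_lt_two
  refine tendsto_of_tendsto_of_tendsto_of_le_of_le' (hα.mul hg) h3 ?_ ?_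
  · filter_upwards [hI] with p hp
    have := mul_le_mul_of_nonneg_left (h1 p hp.1 hp.2) (sub_nonneg.2 hp.1.le)
    linarith
  · filter_upwards [hI] with p hp
    have := mul_le_mul_of_nonneg_left (h2 p hp.1 hp.2) (sub_nonneg.2 hp.1.le)
    linarith

theorem IsSymbolProduct.tendsto_dixmierSeq (hA : IsSymbolProduct e b α K A) (hα : 0 ≤ α)
    (hY : IsDiagonalSqrt e b Y) {ℓ : ℝ}
    (hℓ : Tendsto (fun p : ℝ => (p - 1) * ∑' j, b j ^ p) (𝓝[>] 1) (𝓝 ℓ)) :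
    Tendsto (dixmierSeq (Y * (adjoint K * K) * Y)) atTop (𝓝 (α * ℓ)) := by
  refine tendsto_sum_div_log (singularValue_nonneg _) (singularValue_antitone _)
    (fun p hp => (hA.sum_singularValue_rpow_le hY hp le_rfl).1) ?_
  refine tendsto_mul_of_le_of_le (κ := ‖K‖ ^ 2 + 1) (by positivity) hℓ
    (fun p hp _ => hA.le_sum_singularValue_rpow hα hY hp)
    fun p hp _ => (hA.sum_singularValue_rpow_le hY hp (by linarith)).2

theorem isInDixmierIdeal_of_tendsto {T : H →L[ℂ] H} (hT : IsCompactOperator T) {L : ℝ}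
    (h : Tendsto (dixmierSeq T) atTop (𝓝 L)) : IsInDixmierIdeal T := by
  obtain ⟨C, hC⟩ := h.bddAbove_range
  exact ⟨hT, C, fun n => hC ⟨n, rfl⟩⟩

theorem IsSymbolProduct.dixmierTrace_eq (hA : IsSymbolProduct e b α K A) (hα : 0 ≤ α) {ℓ : ℝ}
    (hℓ : Tendsto (fun p : ℝ => (p - 1) * ∑' j, b j ^ p) (𝓝[>] 1) (𝓝 ℓ)) :
    IsInDixmierIdeal A ∧ ∀ ω : DixmierLimit, dixmierTrace ω A = ((α * ℓ : ℝ) : ℂ) := by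
  obtain ⟨Y, hY⟩ := hA.exists_isDiagonalSqrt
  -- The diagonal factor lies in the Dixmier ideal by the case `K = 1`; `A` follows by the ideal
  -- property, and its trace equals that of `Y K† K Y`.
  have hB := hY.isSymbolProduct_sq hA.nonneg hA.summable
  have hBd : IsInDixmierIdeal (Y * Y) := by
    have h1 := hB.tendsto_dixmierSeq zero_le_one hY hℓ
    rw [← ContinuousLinearMap.star_eq_adjoint, star_one, mul_one, mul_one] at h1
    exact isInDixmierIdeal_of_tendsto (hY.isCompactOperator_mul Y) h1
  have e1 := hA.eq_mul hY
  constructor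
  · rw [e1]
    refine hBd.of_singularValue_le (C := ‖adjoint K * K‖) ?_ (norm_nonneg _) fun k =>
      singularValue_mul_left_le _ _ k
    exact IsCompactOperator.clm_comp hBd.1 (adjoint K * K)
  · intro ω
    have h1 := hA.tendsto_dixmierSeq hα hY hℓ
    rw [e1, dixmierTrace_mul ω hY.isSelfAdjoint hBd, dixmierTracePos_eq_of_tendsto ω
      (isInDixmierIdeal_of_tendsto (hY.isCompactOperator_conj K) h1) h1]

end SymbolProduct

/-! ### Products of finitely many series -/

theorem hasSum_mul_of_summable_norm {R : Type*} [NormedRing R] [CompleteSpace R] {I I' : Type*}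
    {f : I → R} {g : I' → R} {c : R} (hf : Summable fun i => ‖f i‖)
    (hg : Summable fun i => ‖g i‖) (hc : HasSum g c) :
    HasSum (fun z : I × I' => f z.1 * g z.2) ((∑' i, f i) * c) :=
  hf.of_norm.hasSum.mul hc (summable_mul_of_summable_norm hf hg)

theorem hasSum_prod_of_summable_norm {R : Type*} [NormedCommRing R] [NormOneClass R]
    [CompleteSpace R] {I : Type*} {n : ℕ} {f : Fin n → I → R}
    (hf : ∀ m, Summable fun i => ‖f m i‖) :
    (Summable fun k : Fin n → I => ‖∏ m, f m (k m)‖) ∧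
      HasSum (fun k : Fin n → I => ∏ m, f m (k m)) (∏ m, ∑' i, f m i) := by
  induction n with
  | zero =>
    refine ⟨(hasSum_unique (f := fun k : Fin 0 → I => ‖∏ m, f m (k m)‖)).summable, ?_⟩
    simp
  | succ n ih =>
    obtain ⟨h1, h2⟩ := ih (f := fun m => f m.succ) fun m => hf m.succ
    have e : ∀ z : I × (Fin n → I), ∏ m, f m (Fin.consEquiv (fun _ => I) z m)
        = f 0 z.1 * ∏ m, f m.succ (z.2 m) := by
      intro z
      rw [Fin.prod_univ_succ]
      rfl
    constructor
    · rw [← (Fin.consEquiv fun _ : Fin (n + 1) => I).summable_iff]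
      refine ((hf 0).mul_norm h1).congr fun z => ?_
      rw [Function.comp_apply, e z]
    · rw [← (Fin.consEquiv fun _ : Fin (n + 1) => I).hasSum_iff, Fin.prod_univ_succ]
      have h3 := hasSum_mul_of_summable_norm (hf 0) h1 h2
      convert h3 using 1
      exact funext e

/-! ### Hilbert tensor products -/

/-- Adding a multiple of `z` to `x` does not change the coefficients, so by Bessel it cannot make
the norm smaller than the Parseval value `‖x‖`. The multiple that projects `z` out would do so
unless `z ⟂ x`. Completeness of `e` is not assumed, as this serves to prove it for tensor bases. -/
theorem Orthonormal.inner_eq_zero_of_hasSum {H : Type*} [NormedAddCommGroup H]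
    [InnerProductSpace ℂ H] [CompleteSpace H] {J : Type*} {e : J → H} (he : Orthonormal ℂ e) {x z : H}
    (hx : HasSum (fun j => ‖inner ℂ (e j) x‖ ^ 2) (‖x‖ ^ 2)) (hz : ∀ j, inner ℂ (e j) z = 0) :
    inner ℂ z x = 0 := by
  by_contra hne
  have hz0 : z ≠ 0 := fun h => hne (by rw [h, inner_zero_left])
  have hzn : 0 < ‖z‖ ^ 2 := by positivity
  set c : ℂ := -(inner ℂ z x / ((‖z‖ ^ 2 : ℝ) : ℂ)) with hc
  have h1 : ‖x‖ ^ 2 ≤ ‖x + c • z‖ ^ 2 := by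
    refine hasSum_le_of_sum_le hx fun s => ?_
    refine le_trans (le_of_eq (Finset.sum_congr rfl fun j _ => ?_))
      (he.subOrthonormal.sum_inner_le s (x + c • z))
    rw [inner_add_right, inner_smul_right, hz, mul_zero, add_zero]
  have h2 : inner ℂ z (x + c • z) = 0 := by
    rw [inner_add_right, inner_smul_right, inner_self_eq_ofReal, hc, neg_mul,
      div_mul_cancel₀ _ (by exact_mod_cast hzn.ne'), add_neg_cancel]
  have h3 : ‖x‖ ^ 2 = ‖x + c • z‖ ^ 2 + ‖c • z‖ ^ 2 := by
    have h4 : inner ℂ (x + c • z) (-(c • z)) = 0 := by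
      rw [inner_neg_right, inner_smul_right, ← inner_conj_symm, h2]
      simp
    have h5 := norm_add_sq_eq_norm_sq_add_norm_sq_of_inner_eq_zero (𝕜 := ℂ) (x + c • z) (-(c • z)) h4
    rw [add_neg_cancel_right, norm_neg] at h5
    simpa only [sq] using h5
  have h4 : 0 < ‖c • z‖ ^ 2 := by
    have : c ≠ 0 := by
      rw [hc, neg_ne_zero]
      exact div_ne_zero hne (by exact_mod_cast hzn.ne')
    have := smul_ne_zero this hz0
    positivity
  linarith

theorem exists_isNuclearSum {H : Type*} [NormedAddCommGroup H] [InnerProductSpace ℂ H]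
    [CompleteSpace H] {I : Type*} {x y : I → H} (hs : Summable fun k => ‖x k‖ * ‖y k‖) :
    ∃ T : H →L[ℂ] H, IsNuclearSum T x y := by
  have hr : Summable fun k => (InnerProductSpace.rankOne ℂ (x k) (y k) : H →L[ℂ] H) :=
    Summable.of_norm (by simpa only [InnerProductSpace.norm_rankOne] using hs)
  obtain ⟨T, hT⟩ := hr
  refine ⟨T, hs, fun f => ?_⟩
  have h1 := (ContinuousLinearMap.apply ℂ H f).hasSum hT
  simpa only [ContinuousLinearMap.apply_apply, InnerProductSpace.rankOne_apply] using h1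

theorem IsNuclearSum.hasSum_inner {H : Type*} [NormedAddCommGroup H] [InnerProductSpace ℂ H]
    [CompleteSpace H] {I : Type*} {T : H →L[ℂ] H} {x y : I → H} (h : IsNuclearSum T x y)
    (ψ φ : H) : HasSum (fun k => inner ℂ (y k) φ * inner ℂ ψ (x k)) (inner ℂ ψ (T φ)) := by
  have h1 := (innerSL ℂ ψ).hasSum (h.hasSum φ)
  simpa only [innerSL_apply_apply, inner_smul_right] using h1

theorem IsNuclearSum.summable_norm_inner {H : Type*} [NormedAddCommGroup H]
    [InnerProductSpace ℂ H] [CompleteSpace H] {I : Type*} {T : H →L[ℂ] H} {x y : I → H}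
    (h : IsNuclearSum T x y) (ψ φ : H) :
    Summable fun k => ‖inner ℂ (y k) φ * inner ℂ ψ (x k)‖ := by
  refine Summable.of_nonneg_of_le (fun _ => norm_nonneg _) (fun k => ?_)
    (h.summable.mul_left (‖φ‖ * ‖ψ‖))
  rw [norm_mul]
  calc _ ≤ (‖y k‖ * ‖φ‖) * (‖ψ‖ * ‖x k‖) :=
        mul_le_mul (norm_inner_le_norm _ _) (norm_inner_le_norm _ _) (norm_nonneg _)
          (by positivity)
    _ = _ := by ring

namespace HilbertTensor

variable {ι : Type*} [Fintype ι] {H : ι → Type*}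
  [∀ i, NormedAddCommGroup (H i)] [∀ i, InnerProductSpace ℂ (H i)]

theorem dense_span_tmul :
    Dense (Submodule.span ℂ (Set.range (tmul (H := H))) : Set (HilbertTensor H)) := by
  refine (UniformSpace.Completion.denseRange_coe (α := Alg H)).mono ?_
  rintro _ ⟨z, rfl⟩
  induction z using alg_induction with
  | smul c φ =>
    rw [UniformSpace.Completion.coe_smul]
    exact Submodule.smul_mem _ _ (Submodule.subset_span ⟨φ, rfl⟩)
  | add x y hx hy =>
    rw [UniformSpace.Completion.coe_add]
    exact Submodule.add_mem _ hx hy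

theorem ext_inner_tmul {x y : HilbertTensor H}
    (h : ∀ φ, inner ℂ (tmul φ) x = inner ℂ (tmul φ) y) : x = y := by
  have h1 : Set.EqOn (fun z : HilbertTensor H => inner ℂ z x) (fun z => inner ℂ z y)
      (Submodule.span ℂ (Set.range (tmul (H := H)))) := by
    intro z hz
    induction hz using Submodule.span_induction with
    | mem z hz => obtain ⟨φ, rfl⟩ := hz; exact h φ
    | zero => simp only [inner_zero_left]
    | add u v _ _ hu hv => simp only [inner_add_left] at *; rw [hu, hv]
    | smul c u _ hu => simp only [inner_smul_left] at *; rw [hu]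
  have h2 := Continuous.ext_on dense_span_tmul (by fun_prop) (by fun_prop) h1
  exact ext_inner_left ℂ fun z => congrFun h2 z

theorem ext_clm {S T : HilbertTensor H →L[ℂ] HilbertTensor H}
    (h : ∀ φ, S (tmul φ) = T (tmul φ)) : S = T := by
  refine ContinuousLinearMap.ext_on dense_span_tmul ?_
  rintro _ ⟨φ, rfl⟩
  exact h φ

theorem norm_tmul (φ : ∀ i, H i) : ‖tmul φ‖ = ∏ i, ‖φ i‖ := by
  have h1 := inner_tmul φ φ
  simp only [inner_self_eq_norm_sq_to_K] at h1
  rw [Finset.prod_pow] at h1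
  have h2 : ‖tmul φ‖ ^ 2 = (∏ i, ‖φ i‖) ^ 2 := by
    apply Complex.ofReal_injective
    rw [Complex.ofReal_pow, Complex.ofReal_pow, Complex.ofReal_prod]
    exact h1
  exact (pow_left_inj₀ (norm_nonneg _) (Finset.prod_nonneg fun i _ => norm_nonneg _)
    two_ne_zero).1 h2

theorem tmul_smul (c : ι → ℂ) (φ : ∀ i, H i) :
    (tmul fun i => c i • φ i) = (∏ i, c i) • tmul φ := by
  refine ext_inner_tmul fun ψ => ?_
  rw [inner_smul_right, inner_tmul, inner_tmul, ← Finset.prod_mul_distrib]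
  exact Finset.prod_congr rfl fun i _ => inner_smul_right _ _ _

theorem adjoint_map_map_tmul [∀ i, CompleteSpace (H i)] (K : ∀ i, H i →L[ℂ] H i) (φ : ∀ i, H i) :
    ContinuousLinearMap.adjoint (map K) (map K (tmul φ))
      = tmul fun i => ContinuousLinearMap.adjoint (K i) (K i (φ i)) := by
  refine ext_inner_tmul fun ψ => ?_
  rw [ContinuousLinearMap.adjoint_inner_right, map_tmul, map_tmul, inner_tmul, inner_tmul]
  exact Finset.prod_congr rfl fun i _ => (ContinuousLinearMap.adjoint_inner_right _ _ _).symm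

theorem orthonormal_tmul {J : Type*} {e : ∀ i, J → H i} (he : ∀ i, Orthonormal ℂ (e i)) :
    Orthonormal ℂ fun j : ι → J => tmul fun i => e i (j i) := by
  refine ⟨fun j => ?_, fun j k hjk => ?_⟩
  · rw [norm_tmul]
    exact Finset.prod_eq_one fun i _ => (he i).1 _
  · obtain ⟨i, hi⟩ := Function.ne_iff.1 hjk
    change inner ℂ (tmul _) (tmul _) = 0
    rw [inner_tmul]
    exact Finset.prod_eq_zero (Finset.mem_univ i) ((he i).2 hi)

end HilbertTensor

/-! ### Bases, nuclear sums and traces of tensor products -/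

namespace HilbertTensor

variable {n : ℕ} {H : Fin n → Type*} [∀ i, NormedAddCommGroup (H i)]
  [∀ i, InnerProductSpace ℂ (H i)] [∀ i, CompleteSpace (H i)]

/-- Elementary tensors of the elements of orthonormal bases form an orthonormal basis. -/
theorem exists_hilbertBasis_tmul {J : Type*} (e : ∀ i, HilbertBasis J ℂ (H i)) :
    ∃ E : HilbertBasis (Fin n → J) ℂ (HilbertTensor H), ∀ j, E j = tmul fun i => e i (j i) := by
  have ho := orthonormal_tmul fun i => (e i).orthonormal
  have hbot : (Submodule.span ℂ
      (Set.range fun j : Fin n → J => tmul fun i => e i (j i)))ᗮ = ⊥ := by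
    rw [Submodule.eq_bot_iff]
    intro z hz
    have hz' : ∀ j : Fin n → J, inner ℂ (tmul fun i => e i (j i)) z = 0 := fun j =>
      (Submodule.mem_orthogonal _ z).1 hz _ (Submodule.subset_span ⟨j, rfl⟩)
    refine ext_inner_tmul fun φ => ?_
    rw [inner_zero_right, ← inner_conj_symm, ho.inner_eq_zero_of_hasSum ?_ hz', map_zero]
    -- Multiplying the Parseval identities of the factors gives Parseval for each elementary tensor,
    -- so a vector orthogonal to the family is orthogonal to all elementary tensors.
    have h1 := (hasSum_prod_of_summable_norm (R := ℝ) (f := fun i j => ‖inner ℂ (e i j) (φ i)‖ ^ 2)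
      fun i => ((e i).hasSum_norm_sq (φ i)).summable.norm).2
    simp only [((e _).hasSum_norm_sq (φ _)).tsum_eq] at h1
    rw [norm_tmul, ← Finset.prod_pow]
    simpa only [inner_tmul, norm_prod, Finset.prod_pow] using h1
  exact ⟨HilbertBasis.mkOfOrthogonalEqBot ho hbot, fun j => by
    rw [HilbertBasis.coe_mkOfOrthogonalEqBot]⟩

/-- Norms of elementary tensors multiply, so the tensored series converges absolutely. Its sum is
identified with `map T` through matrix coefficients on elementary tensors, which are products of
those of the factors. -/
theorem isNuclearSum_map {I : Type*} {T : ∀ i, H i →L[ℂ] H i} {x y : ∀ i, I → H i}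
    (h : ∀ i, IsNuclearSum (T i) (x i) (y i)) :
    IsNuclearSum (map T) (fun k : Fin n → I => tmul fun i => x i (k i))
      fun k => tmul fun i => y i (k i) := by
  have hs : Summable fun k : Fin n → I =>
      ‖tmul fun i => x i (k i)‖ * ‖tmul fun i => y i (k i)‖ := by
    have h1 := (hasSum_prod_of_summable_norm (R := ℝ) (f := fun i k => ‖x i k‖ * ‖y i k‖)
      fun i => (h i).summable.norm).2.summable
    simpa only [norm_tmul, Finset.prod_mul_distrib] using h1
  obtain ⟨S, hS⟩ := exists_isNuclearSum hs
  have hST : S = map T := by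
    refine ext_clm fun φ => ext_inner_tmul fun ψ => ?_
    have h1 := hS.hasSum_inner (tmul ψ) (tmul φ)
    have h3 := (hasSum_prod_of_summable_norm (R := ℂ)
      (f := fun i k => inner ℂ (y i k) (φ i) * inner ℂ (ψ i) (x i k)) fun i =>
        (h i).summable_norm_inner (ψ i) (φ i)).2
    simp only [((h _).hasSum_inner _ _).tsum_eq, Finset.prod_mul_distrib] at h3
    simp only [inner_tmul] at h1
    rw [map_tmul, inner_tmul]
    exact h1.unique h3
  exact hST ▸ hS

theorem opTrace_map {I : Type*} {T : ∀ i, H i →L[ℂ] H i} {x y : ∀ i, I → H i}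
    (h : ∀ i, IsNuclearSum (T i) (x i) (y i)) : opTrace (map T) = ∏ i, opTrace (T i) := by
  rw [(isNuclearSum_map h).opTrace_eq]
  simp only [inner_tmul, (h _).opTrace_eq]
  refine (hasSum_prod_of_summable_norm (R := ℂ) (f := fun i k => inner ℂ (y i k) (x i k))
    fun i => ?_).2.tsum_eq
  refine Summable.of_nonneg_of_le (fun _ => norm_nonneg _) (fun k => ?_) (h i).summable
  rw [mul_comm]
  exact norm_inner_le_norm _ _

/-- The tensor product of operators of the form `K† K B`, with `B` diagonal. -/
theorem isSymbolProduct_map {J : Type*} {e : ∀ i, HilbertBasis J ℂ (H i)} {b : Fin n → J → ℝ}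
    {α : Fin n → ℝ} {K A : ∀ i, H i →L[ℂ] H i}
    (hA : ∀ i, IsSymbolProduct (e i) (b i) (α i) (K i) (A i)) :
    ∃ E : HilbertBasis (Fin n → J) ℂ (HilbertTensor H),
      IsSymbolProduct E (fun j => ∏ i, b i (j i)) (∏ i, α i) (map K) (map A) ∧
      ∀ p : ℝ, 1 < p → ∑' j : Fin n → J, (∏ i, b i (j i)) ^ p = ∏ i, ∑' j, b i j ^ p := by
  obtain ⟨E, hE⟩ := exists_hilbertBasis_tmul e
  have hpow : ∀ (p : ℝ) (j : Fin n → J), (∏ i, b i (j i)) ^ p = ∏ i, b i (j i) ^ p := fun p j =>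
    (Real.finsetProd_rpow _ _ (fun i _ => (hA i).nonneg _) p).symm
  have hs := fun (p : ℝ) (hp : 1 < p) => (hasSum_prod_of_summable_norm (R := ℝ)
    (f := fun i j => b i j ^ p) fun i => ((hA i).summable p hp).norm).2
  refine ⟨E, ⟨fun j => Finset.prod_nonneg fun i _ => (hA i).nonneg _, fun p hp => ?_,
    fun j => ?_, fun j => ?_⟩, fun p hp => ?_⟩
  · simpa only [hpow] using (hs p hp).summable
  · rw [hE, adjoint_map_map_tmul, map_tmul]
    simp only [(hA _).map_eq]
    rw [tmul_smul, Complex.ofReal_prod]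
  · rw [hE, map_tmul, norm_tmul, ← Finset.prod_pow]
    exact Finset.prod_congr rfl fun i _ => (hA i).norm_sq _
  · simpa only [hpow] using (hs p hp).tsum_eq

end HilbertTensor

/-! ### Traces of tensor products -/

/-- The Dixmier trace of a tensor product of operators of the form `K† K B`, with `B` diagonal, is
the residue of the traces of its powers and of the tensor products of the powers. -/
theorem HilbertTensor.dixmierTrace_map {N : ℕ} {H : Fin N → Type*}
    [∀ i, NormedAddCommGroup (H i)] [∀ i, InnerProductSpace ℂ (H i)] [∀ i, CompleteSpace (H i)]
    {J : Type*} {e : ∀ i, HilbertBasis J ℂ (H i)} {b : Fin N → J → ℝ} {α : Fin N → ℝ}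
    {K A : ∀ i, H i →L[ℂ] H i} (hA : ∀ i, IsSymbolProduct (e i) (b i) (α i) (K i) (A i))
    (hα : ∀ i, 0 ≤ α i) {ℓ : ℝ}
    (hℓ : Tendsto (fun p : ℝ => (p - 1) * ∏ i, ∑' j, b i j ^ p) (𝓝[>] 1) (𝓝 ℓ)) :
    (∀ p : ℝ, 1 < p → p < 2 →
      (∀ m, HasFracPow (A m) p ∧ IsTraceClass (fracPow (A m) p)) ∧
      HasFracPow (HilbertTensor.map A) p ∧
      IsTraceClass (fracPow (HilbertTensor.map A) p) ∧
      IsTraceClass (HilbertTensor.map fun m => fracPow (A m) p)) ∧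
    IsInDixmierIdeal (HilbertTensor.map A) ∧
    ∃ L : ℝ,
      Tendsto (fun p : ℝ => ((p - 1 : ℝ) : ℂ) * opTrace (fracPow (HilbertTensor.map A) p))
        (𝓝[>] 1) (𝓝 (L : ℂ)) ∧
      Tendsto (fun p : ℝ =>
          ((p - 1 : ℝ) : ℂ) * opTrace (HilbertTensor.map fun m => fracPow (A m) p))
        (𝓝[>] 1) (𝓝 (L : ℂ)) ∧
      ∀ ω : DixmierLimit, dixmierTrace ω (HilbertTensor.map A) = (L : ℂ) := by
  obtain ⟨E, hE, hsum⟩ := HilbertTensor.isSymbolProduct_map hA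
  have hα' : 0 ≤ ∏ i, α i := Finset.prod_nonneg fun i _ => hα i
  have hI : ∀ᶠ p : ℝ in 𝓝[>] 1, p ∈ Set.Ioo (1 : ℝ) 2 := Ioo_mem_nhdsGT one_lt_two
  have hℓ' : Tendsto (fun p : ℝ => (p - 1) * ∑' j : Fin N → J, (∏ i, b i (j i)) ^ p) (𝓝[>] 1)
      (𝓝 ℓ) := by
    refine hℓ.congr' ?_
    filter_upwards [hI] with p hp
    rw [hsum p hp.1]
  obtain ⟨τ, hτ⟩ := hE.exists_trace hα'
  choose σ hσ using fun i => (hA i).exists_trace (hα i)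
  have hnuc : ∀ p : ℝ, 1 < p → p < 2 → ∃ x y : ∀ i, ℕ → H i,
      ∀ i, IsNuclearSum (fracPow (A i) p) (x i) (y i) := by
    intro p hp hp2
    choose x y hxy using fun i => (hσ i p hp hp2).1
    exact ⟨x, y, hxy⟩
  obtain ⟨hd, hω⟩ := hE.dixmierTrace_eq hα' hℓ'
  have hg : ∀ (i : Fin N) (p : ℝ), 0 ≤ ∑' j, b i j ^ p := fun i p =>
    tsum_nonneg fun j => Real.rpow_nonneg ((hA i).nonneg j) p
  refine ⟨fun p hp hp2 => ?_, hd, (∏ i, α i) * ℓ, ?_, ?_, hω⟩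
  · obtain ⟨x, y, hxy⟩ := hnuc p hp hp2
    obtain ⟨x', y', hxy'⟩ := (hτ p hp hp2).1
    exact ⟨fun m => ⟨(hA m).hasFracPow hp hp2, (hxy m).isTraceClass⟩, hE.hasFracPow hp hp2,
      hxy'.isTraceClass, (HilbertTensor.isNuclearSum_map hxy).isTraceClass⟩
  · have h1 := tendsto_mul_of_le_of_le (f := τ) (κ := ‖HilbertTensor.map K‖ ^ 2 + 1)
      (by positivity) hℓ' (fun p hp hp2 => (hτ p hp hp2).2.2.1)
      fun p hp hp2 => (hτ p hp hp2).2.2.2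
    refine ((Complex.continuous_ofReal.tendsto _).comp h1).congr' ?_
    filter_upwards [hI] with p hp
    rw [Function.comp_apply, (hτ p hp.1 hp.2).2.1, Complex.ofReal_mul]
  -- Here the trace is a product over the factors. Multiplying their two-sided bounds gives a
  -- different `κ` but the same `∏ α i`, hence the same limit.
  · have h1 := tendsto_mul_of_le_of_le (f := fun p => ∏ i, σ i p) (κ := ∏ i, (‖K i‖ ^ 2 + 1))
      (α := ∏ i, α i) (Finset.prod_pos fun i _ => by positivity) hℓ (fun p hp hp2 => ?_)
      fun p hp hp2 => ?_
    · refine ((Complex.continuous_ofReal.tendsto _).comp h1).congr' ?_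
      filter_upwards [hI] with p hp
      obtain ⟨x, y, hxy⟩ := hnuc p hp.1 hp.2
      rw [Function.comp_apply, HilbertTensor.opTrace_map hxy, Complex.ofReal_mul,
        Complex.ofReal_prod]
      congr 1
      exact Finset.prod_congr rfl fun i _ => ((hσ i p hp.1 hp.2).2.1).symm
    · rw [← Real.finsetProd_rpow _ _ fun i _ => hα i, ← Finset.prod_mul_distrib]
      exact Finset.prod_le_prod (fun i _ => mul_nonneg (Real.rpow_nonneg (hα i) _) (hg i p))
        fun i _ => (hσ i p hp hp2).2.2.1
    · rw [← Real.finsetProd_rpow _ _ fun i _ => by positivity, ← Finset.prod_mul_distrib,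
        ← Finset.prod_mul_distrib]
      exact Finset.prod_le_prod
        (fun i _ => le_trans (mul_nonneg (Real.rpow_nonneg (hα i) _) (hg i p))
          (hσ i p hp hp2).2.2.1) fun i _ => (hσ i p hp hp2).2.2.2

/-! ### Multiplication operators on the circle -/

theorem exists_mul_operator {g : UnitAddCircle → ℝ} (hg : MemLp g ⊤ circleMeasure) :
    ∃ K : L2Circle →L[ℂ] L2Circle, ∀ f : L2Circle,
      K f =ᵐ[circleMeasure] fun x => (g x : ℂ) * f x := by
  have hgc : MemLp (fun x => (g x : ℂ)) ⊤ circleMeasure := hg.ofReal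
  refine ⟨(ContinuousLinearMap.mul ℂ ℂ).holderL circleMeasure ⊤ 2 2 hgc.toLp, fun f => ?_⟩
  have h1 := (ContinuousLinearMap.mul ℂ ℂ).coeFn_holder (r := 2) (hgc.toLp) f
  filter_upwards [h1, hgc.coeFn_toLp] with x h2 h3
  exact h2.trans (by rw [h3]; rfl)

theorem memLp_sqrt {a : UnitAddCircle → ℝ} (ha : MemLp a ⊤ circleMeasure) :
    MemLp (fun x => √(a x)) ⊤ circleMeasure := by
  refine memLp_top_of_bound (Real.continuous_sqrt.comp_aestronglyMeasurable ha.1)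
    (√(eLpNorm a ⊤ circleMeasure).toReal) ?_
  filter_upwards [ae_le_eLpNormEssSup (f := a) (μ := circleMeasure)] with x hx
  rw [Real.norm_of_nonneg (Real.sqrt_nonneg _)]
  refine Real.sqrt_le_sqrt ((le_abs_self _).trans ?_)
  rw [← Real.norm_eq_abs, ← toReal_enorm]
  refine ENNReal.toReal_mono ha.2.ne ?_
  rwa [eLpNorm_exponent_top]

/-- The operator of multiplication by `a ≥ 0` is `K† K`, with `K` the multiplication by `√a`. -/
theorem exists_sqrt_mul_operator {a : UnitAddCircle → ℝ} (ha : MemLp a ⊤ circleMeasure)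
    (ha0 : ∀ᵐ x ∂circleMeasure, 0 ≤ a x) :
    ∃ K : L2Circle →L[ℂ] L2Circle,
      (∀ f : L2Circle, ContinuousLinearMap.adjoint K (K f) =ᵐ[circleMeasure]
        fun x => (a x : ℂ) * f x) ∧
      ∀ j : ℤ, ‖K (fourierBasis j)‖ ^ 2 = ∫ x, a x ∂circleMeasure := by
  obtain ⟨M, hM⟩ := exists_mul_operator ha
  obtain ⟨K, hK⟩ := exists_mul_operator (memLp_sqrt ha)
  have hin : ∀ ψ φ : L2Circle, inner ℂ (K ψ) (K φ) = inner ℂ ψ (M φ) := by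
    intro ψ φ
    rw [L2.inner_def, L2.inner_def]
    refine integral_congr_ae ?_
    filter_upwards [hK ψ, hK φ, hM φ, ha0] with x h1 h2 h3 h4
    rw [h1, h2, h3]
    simp only [RCLike.inner_apply, map_mul, Complex.conj_ofReal]
    have h5 : (a x : ℂ) = (√(a x) : ℂ) * (√(a x) : ℂ) := by
      rw [← Complex.ofReal_mul, Real.mul_self_sqrt h4]
    rw [h5]; ring
  refine ⟨K, fun f => ?_, fun j => ?_⟩
  · have h1 : ContinuousLinearMap.adjoint K (K f) = M f := by
      refine ext_inner_left ℂ fun ψ => ?_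
      rw [ContinuousLinearMap.adjoint_inner_right, hin]
    rw [h1]
    exact hM f
  · have h1 := hin (fourierBasis j) (fourierBasis j)
    rw [inner_self_eq_ofReal] at h1
    apply Complex.ofReal_injective
    rw [h1, L2.inner_def, ← integral_complex_ofReal]
    refine integral_congr_ae ?_
    have h2 := coeFn_fourierLp (T := 1) 2 j
    rw [← coe_fourierBasis] at h2
    filter_upwards [hM (fourierBasis j), h2] with x h3 h4
    rw [h3, h4]
    simp only [RCLike.inner_apply]
    -- Characters have modulus one, so the norm is the same for every frequency.
    rw [mul_assoc, Complex.mul_conj', fourier_apply, Circle.norm_coe]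
    simp

theorem fourierCoeff_fourierBasis (j k : ℤ) :
    fourierCoeff (fourierBasis j : L2Circle) k = if k = j then 1 else 0 := by
  rw [← fourierBasis_repr, HilbertBasis.repr_self, lp.single_apply]
  split_ifs with h <;> simp_all

theorem HasSymbol.apply_fourierBasis {a : UnitAddCircle → ℝ} {β : ℤ → ℝ}
    {A : L2Circle →L[ℂ] L2Circle}
    (hA : HasSymbol (fun x j => (a x : ℂ) * (β j : ℂ)) A) (j : ℤ) :
    A (fourierBasis j) =ᵐ[circleMeasure]
      fun x => (β j : ℂ) * ((a x : ℂ) * (fourierBasis j : L2Circle) x) := by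
  obtain ⟨u, hu, hs⟩ := hA (fourierBasis j)
  have h1 : ∀ k ≠ j, u k = 0 := by
    intro k hk
    refine (Lp.eq_zero_iff_ae_eq_zero).2 ((hu k).trans ?_)
    simp only [fourierCoeff_fourierBasis, if_neg hk, mul_zero, zero_mul]
    rfl
  rw [hs.unique (hasSum_single j h1)]
  have h2 := coeFn_fourierLp (T := 1) 2 j
  rw [← coe_fourierBasis] at h2
  filter_upwards [hu j, h2] with x h3 h4
  rw [h3, h4, fourierCoeff_fourierBasis, if_pos rfl]
  ring

/-- The constant is `∫ a`. When `a = 0` almost everywhere the operator vanishes on the basis, and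
`β` is replaced by zero: the limit assumed in the theorem then carries no information on the growth
of `β`. -/
theorem HasSymbol.exists_isSymbolProduct {a : UnitAddCircle → ℝ} {β : ℤ → ℝ}
    {A : L2Circle →L[ℂ] L2Circle} (ha : MemLp a ⊤ circleMeasure)
    (ha0 : ∀ᵐ x ∂circleMeasure, 0 ≤ a x) (hβ0 : ∀ j, 0 ≤ β j)
    (hβ : ∀ p : ℝ, 1 < p → Summable fun j => β j ^ p)
    (hA : HasSymbol (fun x j => (a x : ℂ) * (β j : ℂ)) A) :
    ∃ (α : ℝ) (K : L2Circle →L[ℂ] L2Circle), 0 ≤ α ∧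
      IsSymbolProduct fourierBasis (fun j => if supNorm a = 0 then 0 else β j) α K A := by
  obtain ⟨K, hK, hKn⟩ := exists_sqrt_mul_operator ha ha0
  refine ⟨∫ x, a x ∂circleMeasure, K, integral_nonneg_of_ae ha0, fun j => ?_, fun p hp => ?_,
    fun j => ?_, hKn⟩
  · split_ifs
    · exact le_rfl
    · exact hβ0 j
  · split_ifs
    · simp only [Real.zero_rpow (by linarith : p ≠ 0)]
      exact summable_zero
    · exact hβ p hp
  · refine Lp.ext ((hA.apply_fourierBasis j).trans ?_)
    refine EventuallyEq.trans ?_ (Lp.coeFn_smul _ _).symm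
    split_ifs with h0
    · have h1 : eLpNorm a ⊤ circleMeasure = 0 :=
        ((ENNReal.toReal_eq_zero_iff _).1 h0).resolve_right ha.2.ne
      filter_upwards [(eLpNorm_eq_zero_iff ha.1 ENNReal.top_ne_zero).1 h1] with x hx
      rw [hx]
      simp
    · filter_upwards [hK (fourierBasis j)] with x hx
      rw [Pi.smul_apply, hx, smul_eq_mul]

theorem ellNorm_rpow {β : ℤ → ℝ} (hβ0 : ∀ j, 0 ≤ β j) {p : ℝ} (hp : 1 < p) :
    ellNorm p β ^ p = ∑' j, β j ^ p := by
  unfold ellNorm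
  simp only [abs_of_nonneg (hβ0 _)]
  rw [← Real.rpow_mul (tsum_nonneg fun j => Real.rpow_nonneg (hβ0 j) p),
    one_div_mul_cancel (by linarith), Real.rpow_one]

/-- The sup norms are divided out, since `(∏ ‖a_m‖) ^ p` tends to a nonzero limit; if one of them
vanishes, the modified entries make the whole product zero. -/
theorem exists_tendsto_prod_tsum {N : ℕ} {a : Fin N → UnitAddCircle → ℝ} {β : Fin N → ℤ → ℝ}
    (hβ0 : ∀ m j, 0 ≤ β m j)
    (hlim : ∃ ℓ : ℝ, Tendsto
      (fun p : ℝ => (p - 1) * ∏ m, (supNorm (a m) ^ p * ellNorm p (β m) ^ p))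
      (𝓝[>] 1) (𝓝 ℓ)) :
    ∃ ℓ : ℝ, Tendsto
      (fun p : ℝ => (p - 1) * ∏ m, ∑' j, (if supNorm (a m) = 0 then 0 else β m j) ^ p)
      (𝓝[>] 1) (𝓝 ℓ) := by
  by_cases h0 : ∃ m, supNorm (a m) = 0
  · obtain ⟨m, hm⟩ := h0
    refine ⟨0, tendsto_const_nhds.congr' ?_⟩
    filter_upwards [self_mem_nhdsWithin] with p hp
    have hp : (1 : ℝ) < p := hp
    rw [Finset.prod_eq_zero (Finset.mem_univ m), mul_zero]
    simp [hm, Real.zero_rpow (by linarith : p ≠ 0)]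
  · push Not at h0
    obtain ⟨ℓ, hℓ⟩ := hlim
    have hc : 0 < ∏ m, supNorm (a m) :=
      Finset.prod_pos fun m _ => lt_of_le_of_ne ENNReal.toReal_nonneg (h0 m).symm
    have h1 : Tendsto (fun p : ℝ => (∏ m, supNorm (a m)) ^ p) (𝓝[>] 1)
        (𝓝 (∏ m, supNorm (a m))) := by
      have h3 : Tendsto (fun p : ℝ => (∏ m, supNorm (a m)) ^ p) (𝓝 1)
          (𝓝 ((∏ m, supNorm (a m)) ^ (1 : ℝ))) := Real.continuousAt_const_rpow' one_ne_zero
      rw [Real.rpow_one] at h3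
      exact h3.mono_left nhdsWithin_le_nhds
    refine ⟨ℓ / ∏ m, supNorm (a m), (hℓ.div h1 hc.ne').congr' ?_⟩
    filter_upwards [self_mem_nhdsWithin] with p hp
    have hp : (1 : ℝ) < p := hp
    have h2 : (∏ m, supNorm (a m)) ^ p ≠ 0 := (Real.rpow_pos_of_pos hc p).ne'
    simp only [Pi.div_apply, ellNorm_rpow (hβ0 _) hp, if_neg (h0 _)]
    rw [Finset.prod_mul_distrib, Real.finsetProd_rpow _ (fun m => supNorm (a m))
      fun m _ => ENNReal.toReal_nonneg]
    field_simp

/-! ### The theorem for the symbols `a_m(x) β_m(j)` -/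

theorem mainTheorem4 (N : ℕ)
    (a : Fin N → UnitAddCircle → ℝ) (β : Fin N → ℤ → ℝ)
    (ha : ∀ m, MemLp (a m) ⊤ circleMeasure)
    (ha0 : ∀ m, ∀ᵐ x ∂circleMeasure, 0 ≤ a m x)
    (hβ0 : ∀ m j, 0 ≤ β m j)
    (hβ : ∀ m, ∀ p : ℝ, 1 < p → Summable fun j => β m j ^ p)
    (A : Fin N → (L2Circle →L[ℂ] L2Circle))
    (hA : ∀ m, HasSymbol (fun x j => (a m x : ℂ) * (β m j : ℂ)) (A m))
    (hlim : ∃ ℓ : ℝ, Tendsto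
      (fun p : ℝ => (p - 1) * ∏ m, (supNorm (a m) ^ p * ellNorm p (β m) ^ p))
      (𝓝[>] 1) (𝓝 ℓ)) :
    (∀ p : ℝ, 1 < p → p < 2 →
      (∀ m, HasFracPow (A m) p ∧ IsTraceClass (fracPow (A m) p)) ∧
      HasFracPow (HilbertTensor.map A) p ∧
      IsTraceClass (fracPow (HilbertTensor.map A) p) ∧
      IsTraceClass (HilbertTensor.map fun m => fracPow (A m) p)) ∧
    IsInDixmierIdeal (HilbertTensor.map A) ∧
    ∃ L : ℝ,
      Tendsto (fun p : ℝ => ((p - 1 : ℝ) : ℂ) * opTrace (fracPow (HilbertTensor.map A) p))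
        (𝓝[>] 1) (𝓝 (L : ℂ)) ∧
      Tendsto (fun p : ℝ =>
          ((p - 1 : ℝ) : ℂ) * opTrace (HilbertTensor.map fun m => fracPow (A m) p))
        (𝓝[>] 1) (𝓝 (L : ℂ)) ∧
      ∀ ω : DixmierLimit, dixmierTrace ω (HilbertTensor.map A) = (L : ℂ) := by
  choose α K hα hK using fun m =>
    (hA m).exists_isSymbolProduct (ha m) (ha0 m) (hβ0 m) (hβ m)
  obtain ⟨ℓ, hℓ⟩ := exists_tendsto_prod_tsum hβ0 hlim
  exact HilbertTensor.dixmierTrace_map hK hα hℓ
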